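/- Let $\overline\tau_1,\overline\tau_2,\overline\tau_3>0$, $\Omega_1,\Omega_2,\Omega_3>0$, $s_0\in(0,1)$, and let $\tau_j=\tau_{j,n_j}>0$, $j=1,2,3$, be sampling periods with $n_j\tau_j\to\overline\tau_j$ as $n_j\to\infty$. Let $b_j\ge\overline\tau_j$ be such that $n_j\tau_j\le b_j$ for all sufficiently large $n_j$ (every $b_j>\overline\tau_j$ has this property, and $b_j=\overline\tau_j$ has it if no sampling point lies beyond $\overline\tau_j$). Put $$\varphi(t,r_2,r_3)=\frac{\sin(\Omega_1t)}{\pi t}\,\frac{\sin(\Omega_2r_2)}{\pi r_2}\,\frac{\sin(\Omega_3r_3)}{\pi r_3},$$ where a factor whose variable vanishes has the value $\Omega_j/\pi$. For $a\le b$ in $\mathbb R^q$ and real functions on $[a,b]$ let $\Delta(f;a,b)=\sum_{v\subseteq\{1,\dots,q\}}(-1)^{|v|}f(a_v:b_{-v})$, where $a_v:b_{-v}$ has the coordinates of $a$ in $v$ and those of $b$ outside $v$. The Vitali variation of $f$ on $[a,b]$ is the supremum over all grids of $\sum|\Delta(f;y,y^+)|$, the sum over the cells $[y,y^+]$ of the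 grid, and $V_{HK}(f)$, the variation in the sense of Hardy and Krause, is the sum over $\emptyset\ne u\subseteq\{1,\dots,q\}$ of the Vitali variations of $x_u\mapsto f(x_u:b_{-u})$ on $[a_u,b_u]$. The Riemann–Stieltjes integral $\int_a^b h\,df$ is the limit of $\sum h(\tilde y)\Delta(f;y,y^+)$ with arbitrary $\tilde y\in[y,y^+]$ as the mesh of the grid tends to $0$. For $h$ of unbounded variation, $\int_a^b f\,dh$ is defined through integration by parts, $$\int_a^b f\,dh=\sum_{v\subseteq\{1,\dots,q\}}(-1)^{|v|}\int_{a_v}^{b_v}[h\,df]_{a_{-v}}^{b_{-v}},$$ provided that all the integrals on the right exist; here $[\,\cdot\,]_{a_{-v}}^{b_{-v}}$ is the alternating sum over the corners of $[a_{-v},b_{-v}]$, and the term for $v=\emptyset$ is $\Delta(hf;a,b)$. The space $D$ of a hyperrectangle consists of the real functions on it that have a limit within each quadrant $\{s: s_pR_pt_p,\ 1\le p\le q\}$, $R_p\in\{<,\ge\}$, at each point $t$, equal to the value at $t$ if every $R_p$ is $\ge$; it carries the Skorohod metric $d(x,y)=\inf_\lambda\max(\|x-y\circ\lambda\|_\infty,\|\lambda-\mathrm{id}\|_\infty)$,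 the infimum over all coordinatewise increasing bijections $\lambda$ of the hyperrectangle. Weak convergence in $D$ is denoted by $\Rightarrow$. The standard Brownian motion $B$ on $[0,1]^3$ has almost surely continuous paths, vanishes almost surely at each point with a zero coordinate, and its increments $\Delta(B;s,t)$ around pairwise disjoint blocks $\prod_j(s_j,t_j]$ are independent centred normal variables whose variances are the volumes of the blocks. **Assumption 1.** $\{\varepsilon_{\mathbf i}\}_{\mathbf i\in\mathbb Z^3}$ is a weakly stationary random field with mean zero such that, for some $\sigma>0$, $$(n_1n_2n_3)^{-1/2}\sum_{i_1=1}^{\lfloor n_1v_1\rfloor}\sum_{i_2=1}^{\lfloor n_2v_2\rfloor}\sum_{i_3=1}^{\lfloor n_3v_3\rfloor}\varepsilon_{i_1,i_2,i_3}\Rightarrow\sigma B(v_1,v_2,v_3)\quad\text{in } D[0,1]^3\text{ as }\min_i n_i\to\infty .$$ **Model and hypothesis.** The observations are $y_{l_1,l_2,l_3}=f(l_1\tau_1,l_2\tau_2,l_3\tau_3)+\varepsilon_{l_1,l_2,l_3}$, and $H_0$ states that $f=f_0$ on $\prod_{j=1}^3[0,b_j]$, where $f_0$ is the reference signal. **Weight.**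 The function $w(z_2,z_3,r_2,r_3)$ is continuous on $[0,b_2]\times[0,b_3]\times[0,\overline\tau_2]\times[0,\overline\tau_3]$ and $$\sup_{r_2\in[0,\overline\tau_2],\,r_3\in[0,\overline\tau_3]}V_{HK}\bigl(w(\cdot,\cdot,r_2,r_3)\bigr)<\infty,$$ the variation being taken on $[0,b_2]\times[0,b_3]$. **Theorem.** Under Assumption 1 and $H_0$, the processes $$\mathcal F^w_n(s,t,r_2,r_3)=\sqrt{\tau_1\tau_2\tau_3}\sum_{l_1=1}^{\lfloor n_1s\rfloor}\sum_{l_2=1}^{n_2}\sum_{l_3=1}^{n_3}\bigl[y_{l_1,l_2,l_3}-f_0(l_1\tau_1,l_2\tau_2,l_3\tau_3)\bigr]\,\varphi(t-l_1\tau_1,r_2-l_2\tau_2,r_3-l_3\tau_3)\,w(l_2\tau_2,l_3\tau_3,r_2,r_3)$$ satisfy $\mathcal F^w_n\Rightarrow\mathcal F^w$ in $D\bigl([s_0,1]\times[0,\overline\tau_1]\times[0,\overline\tau_2]\times[0,\overline\tau_3]\bigr)$ as $\min_i n_i\to\infty$, where $$\mathcal F^w(s,t,r_2,r_3)=\sqrt{\overline\tau_1\overline\tau_2\overline\tau_3}\,\sigma\int_0^s\!\int_0^1\!\int_0^1\varphi(t-\overline\tau_1z_1,r_2-\overline\tau_2z_2,r_3-\overline\tau_3z_3)\,w(\overline\tau_2z_2,\overline\tau_3z_3,r_2,r_3)\,dB(z_1,z_2,z_3).$$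 Almost surely, this integral, defined through integration by parts, exists for all $(s,t,r_2,r_3)$ in that hyperrectangle. -/

import Mathlib

open MeasureTheory ProbabilityTheory Filter Topology

noncomputable section

/-! ### The Skorohod space of functions on a hyperrectangle -/

/-- The quadrant of the hyperrectangle `[a, b]` at `t`: coordinates with `R p = true` satisfy
`t p ≤ s p`, coordinates with `R p = false` satisfy `s p < t p`. -/
def quadrant {q : ℕ} {a b : Fin q → ℝ} (R : Fin q → Bool) (t : Set.Icc a b) :
    Set (Set.Icc a b) :=
  {s | ∀ p, if R p = true then t.1 p ≤ s.1 p else s.1 p < t.1 p}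

/-- The Skorohod space `D[a, b]`: functions on the hyperrectangle `[a, b]` that have a limit
within every quadrant at every point and are continuous from above. -/
@[ext]
structure SkorohodSpace {q : ℕ} (a b : Fin q → ℝ) where
  toFun : Set.Icc a b → ℝ
  exists_limit : ∀ (R : Fin q → Bool) (t : Set.Icc a b),
    ∃ L : ℝ, Tendsto toFun (𝓝[quadrant R t] t) (𝓝 L)
  continuous_from_above : ∀ t : Set.Icc a b,
    Tendsto toFun (𝓝[quadrant (fun _ => true) t] t) (𝓝 (toFun t))

/-- A coordinatewise change of parameter: each coordinate is moved by an increasing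
bijection of `[a j, b j]` onto itself. -/
abbrev ParamChange {q : ℕ} (a b : Fin q → ℝ) : Type :=
  (j : Fin q) → Set.Icc (a j) (b j) ≃o Set.Icc (a j) (b j)

/-- The action of a change of parameter on the hyperrectangle. -/
def ParamChange.act {q : ℕ} {a b : Fin q → ℝ} (lam : ParamChange a b) (x : Set.Icc a b) :
    Set.Icc a b :=
  ⟨fun j => (lam j ⟨x.1 j, x.2.1 j, x.2.2 j⟩).1,
    fun j => (lam j ⟨x.1 j, x.2.1 j, x.2.2 j⟩).2.1,
    fun j => (lam j ⟨x.1 j, x.2.1 j, x.2.2 j⟩).2.2⟩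

/-- The Skorohod distance `inf_λ max (sup_x |f x - g (λ x)|, sup_x |λ x - x|)`. -/
def skorohodEDist {q : ℕ} {a b : Fin q → ℝ} (f g : SkorohodSpace a b) : ENNReal :=
  ⨅ lam : ParamChange a b, ⨆ x : Set.Icc a b,
    max (edist (f.toFun x) (g.toFun (lam.act x))) (edist (lam.act x) x)

theorem skorohodEDist_self {q : ℕ} {a b : Fin q → ℝ} (f : SkorohodSpace a b) :
    skorohodEDist f f = 0 := by
  refine le_antisymm ?_ bot_le
  refine (iInf_le _ (fun _ => OrderIso.refl _)).trans (iSup_le fun x => ?_)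
  have h : ParamChange.act (a := a) (b := b) (fun _ => OrderIso.refl _) x = x := rfl
  simp [h]

theorem skorohodEDist_comm_le {q : ℕ} {a b : Fin q → ℝ} (f g : SkorohodSpace a b) :
    skorohodEDist f g ≤ skorohodEDist g f := by
  refine le_iInf fun lam => ?_
  refine (iInf_le _ (fun j => (lam j).symm)).trans (iSup_le fun x => ?_)
  have h : lam.act (ParamChange.act (a := a) (b := b) (fun j => (lam j).symm) x) = x := by
    ext j; simp [ParamChange.act]
  refine le_trans ?_ (le_iSup _ (ParamChange.act (a := a) (b := b) (fun j => (lam j).symm) x))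
  rw [h, edist_comm (f.toFun x), edist_comm x]

theorem skorohodEDist_triangle {q : ℕ} {a b : Fin q → ℝ} (f g h : SkorohodSpace a b) :
    skorohodEDist f h ≤ skorohodEDist f g + skorohodEDist g h := by
  unfold skorohodEDist
  refine ENNReal.le_iInf_add_iInf fun lam mu => ?_
  refine (iInf_le _ (fun j => (lam j).trans (mu j))).trans (iSup_le fun x => ?_)
  have hx : ParamChange.act (a := a) (b := b) (fun j => (lam j).trans (mu j)) x
      = mu.act (lam.act x) := rfl
  rw [hx]
  have h1 := le_iSup (fun x : Set.Icc a b =>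
    max (edist (f.toFun x) (g.toFun (lam.act x))) (edist (lam.act x) x)) x
  have h2 := le_iSup (fun x : Set.Icc a b =>
    max (edist (g.toFun x) (h.toFun (mu.act x))) (edist (mu.act x) x)) (lam.act x)
  refine max_le ?_ ?_
  · exact (edist_triangle _ (g.toFun (lam.act x)) _).trans
      (add_le_add ((le_max_left _ _).trans h1) ((le_max_left _ _).trans h2))
  · refine (edist_triangle _ (lam.act x) _).trans ?_
    rw [add_comm]
    exact add_le_add ((le_max_right _ _).trans h1) ((le_max_right _ _).trans h2)

instance {q : ℕ} {a b : Fin q → ℝ} : PseudoEMetricSpace (SkorohodSpace a b) where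
  edist := skorohodEDist
  edist_self := skorohodEDist_self
  edist_comm f g := le_antisymm (skorohodEDist_comm_le f g) (skorohodEDist_comm_le g f)
  edist_triangle := skorohodEDist_triangle

instance {q : ℕ} {a b : Fin q → ℝ} : MeasurableSpace (SkorohodSpace a b) := borel _

instance {q : ℕ} {a b : Fin q → ℝ} : BorelSpace (SkorohodSpace a b) := ⟨rfl⟩

/-- Weak convergence, in the Skorohod space `D[a, b]`, of processes with parameter in `[a, b]`.
The processes are given by functions on `ℝ^q`, of which only the values on `[a, b]` matter; for
all large indices they agree almost surely on `[a, b]` with random elements of `D[a, b]`, and the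
laws of these converge weakly. -/
def ConvergesWeaklyInSkorohod {q : ℕ} (a b : Fin q → ℝ) {κ S S' : Type*}
    [MeasurableSpace S] [MeasurableSpace S']
    (X : κ → S → (Fin q → ℝ) → ℝ) (P : Measure S) [IsProbabilityMeasure P] (l : Filter κ)
    (Y : S' → (Fin q → ℝ) → ℝ) (P' : Measure S') [IsProbabilityMeasure P'] : Prop :=
  ∃ (X' : κ → S → SkorohodSpace a b) (Y' : S' → SkorohodSpace a b),
    (∀ᶠ k in l, ∀ᵐ ω ∂P, ∀ x : Set.Icc a b, (X' k ω).toFun x = X k ω x) ∧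
    (∀ᵐ ω ∂P', ∀ x : Set.Icc a b, (Y' ω).toFun x = Y ω x) ∧
    TendstoInDistribution X' l Y' (fun _ => P) P'

/-! ### Alternating sums, ladders, variation -/

/-- The alternating sum `Δ(f; a, b) = ∑_v (-1)^|v| f(a_v : b_{-v})`. -/
def altSum {ι : Type*} [Fintype ι] [DecidableEq ι] (f : (ι → ℝ) → ℝ) (a b : ι → ℝ) : ℝ :=
  ∑ v : Finset ι, (-1 : ℝ) ^ v.card * f (v.piecewise a b)

/-- The point `x_u : z_{-u}`. -/
def glue {ι : Type*} [DecidableEq ι] (u : Finset ι) (x : u → ℝ) (z : ι → ℝ) : ι → ℝ :=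
  fun j => if h : j ∈ u then x ⟨j, h⟩ else z j

/-- A ladder on `[a, b]`: it contains `a` and otherwise finitely many points of `(a, b)`. -/
def IsLadder (a b : ℝ) (Y : Finset ℝ) : Prop :=
  a ∈ Y ∧ ∀ y ∈ Y, y = a ∨ y ∈ Set.Ioo a b

/-- The successor of `y` in a ladder `Y` on an interval with right end point `b`. -/
def ladderSucc (b : ℝ) (Y : Finset ℝ) (y : ℝ) : ℝ :=
  if h : (Y.filter (fun z => y < z)).Nonempty then (Y.filter (fun z => y < z)).min' h else b

/-- The componentwise successor in a product of ladders. -/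
def ladderSuccPi {ι : Type*} (b : ι → ℝ) (Y : ι → Finset ℝ) (y : ι → ℝ) : ι → ℝ :=
  fun j => ladderSucc (b j) (Y j) (y j)

/-- The variation of `f` on `[a, b]` in the sense of Vitali. -/
def vitaliVariation {ι : Type*} [Fintype ι] [DecidableEq ι] (f : (ι → ℝ) → ℝ) (a b : ι → ℝ) :
    ENNReal :=
  ⨆ (Y : ι → Finset ℝ) (_ : ∀ j, IsLadder (a j) (b j) (Y j)),
    ∑ y ∈ Fintype.piFinset Y, ENNReal.ofReal |altSum f y (ladderSuccPi b Y y)|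

/-- The variation of `f` on `[a, b]` in the sense of Hardy and Krause:
the sum over nonempty `u` of the Vitali variation of `x_u ↦ f(x_u : b_{-u})` on `[a_u, b_u]`. -/
def hardyKrauseVariation {ι : Type*} [Fintype ι] [DecidableEq ι] (f : (ι → ℝ) → ℝ)
    (a b : ι → ℝ) : ENNReal :=
  ∑ u ∈ (Finset.univ : Finset (Finset ι)).erase ∅,
    vitaliVariation (fun x : u → ℝ => f (glue u x b)) (fun j => a j) (fun j => b j)

/-! ### The multivariate Riemann-Stieltjes integral -/

/-- `I` is the Riemann-Stieltjes integral of `h` with respect to `f` over `[a, b]`: the limit of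
the sums `∑_y h(ỹ) Δ(f; y, y⁺)` over ladders as the mesh tends to zero, for arbitrary tags
`ỹ ∈ [y, y⁺]`. Over an empty index set this says `I = h * f`. -/
def HasRSIntegral {ι : Type*} [Fintype ι] [DecidableEq ι] (h f : (ι → ℝ) → ℝ) (a b : ι → ℝ)
    (I : ℝ) : Prop :=
  ∀ ε > 0, ∃ δ > 0, ∀ (Y : ι → Finset ℝ) (tag : (ι → ℝ) → ι → ℝ),
    (∀ j, IsLadder (a j) (b j) (Y j)) →
    (∀ j, ∀ y ∈ Y j, ladderSucc (b j) (Y j) y - y < δ) →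
    (∀ y ∈ Fintype.piFinset Y, tag y ∈ Set.Icc y (ladderSuccPi b Y y)) →
    |∑ y ∈ Fintype.piFinset Y, h (tag y) * altSum f y (ladderSuccPi b Y y) - I| < ε

/-- `I` is the Riemann-Stieltjes integral of `f` with respect to `h` over `[a, b]`, defined by the
integration by parts formula
`∫ f dh = [h f] + (-1)^q ∫ h df + ∑_{1 ≤ |v| ≤ q-1} (-1)^|v| ∫_{a_v}^{b_v} [h df]_{a_{-v}}^{b_{-v}}`
(all the integrals on the right existing), in which the square bracket is the alternating sum over
the corners `a_c : b_{-v-c}`, `c ⊆ -v`. The terms `[h f]` and `(-1)^q ∫ h df` are those of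
`v = ∅` and of `v = {1, …, q}` in the sum below. -/
def HasPartsIntegral {ι : Type*} [Fintype ι] [DecidableEq ι] (f h : (ι → ℝ) → ℝ) (a b : ι → ℝ)
    (I : ℝ) : Prop :=
  ∃ J : Finset ι → Finset ι → ℝ,
    (∀ v : Finset ι, ∀ c ⊆ vᶜ,
      HasRSIntegral (fun x : v → ℝ => h (glue v x (c.piecewise a b)))
        (fun x : v → ℝ => f (glue v x (c.piecewise a b)))
        (fun j => a j) (fun j => b j) (J v c)) ∧
    I = ∑ v : Finset ι, (-1 : ℝ) ^ v.card * ∑ c ∈ vᶜ.powerset, (-1 : ℝ) ^ c.card * J v c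

open Classical in
/-- The value of the integral `∫ f dh` over `[a, b]` (zero if it does not exist). -/
def partsIntegral {ι : Type*} [Fintype ι] [DecidableEq ι] (f h : (ι → ℝ) → ℝ) (a b : ι → ℝ) : ℝ :=
  if hI : ∃ I, HasPartsIntegral f h a b I then hI.choose else 0

/-! ### Brownian motion on the cube, weakly stationary random fields -/

/-- The block `∏_j (s_j, t_j]`. -/
def block {q : ℕ} (s t : Fin q → ℝ) : Set (Fin q → ℝ) :=
  Set.univ.pi fun j => Set.Ioc (s j) (t j)

/-- Standard Brownian motion (the Brownian sheet) on `[0, 1]^q`. Only the values on the cube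
matter. -/
structure IsBrownianSheet {q : ℕ} {S : Type*} [MeasurableSpace S]
    (B : S → (Fin q → ℝ) → ℝ) (P : Measure S) : Prop where
  aemeasurable : ∀ t ∈ Set.Icc (0 : Fin q → ℝ) 1, AEMeasurable (fun ω => B ω t) P
  continuous : ∀ᵐ ω ∂P, ContinuousOn (B ω) (Set.Icc 0 1)
  zero_boundary : ∀ t ∈ Set.Icc (0 : Fin q → ℝ) 1, (∃ j, t j = 0) → ∀ᵐ ω ∂P, B ω t = 0
  increments : ∀ (k : ℕ) (s t : Fin k → Fin q → ℝ),
    (∀ i, s i ∈ Set.Icc 0 1) → (∀ i, t i ∈ Set.Icc 0 1) → (∀ i, s i ≤ t i) →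
    Pairwise (fun i i' => Disjoint (block (s i) (t i)) (block (s i') (t i'))) →
    iIndepFun (fun i ω => altSum (B ω) (s i) (t i)) P ∧
    ∀ i, HasLaw (fun ω => altSum (B ω) (s i) (t i))
      (gaussianReal 0 (volume (block (s i) (t i))).toNNReal) P

/-- A weakly stationary random field on `ℤ^q`. -/
structure IsWeaklyStationary {q : ℕ} {S : Type*} [MeasurableSpace S]
    (ε : (Fin q → ℤ) → S → ℝ) (P : Measure S) : Prop where
  memLp : ∀ i, MemLp (ε i) 2 P
  mean : ∀ i j, ∫ ω, ε i ω ∂P = ∫ ω, ε j ω ∂P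
  cov : ∀ i j h, covariance (ε (i + h)) (ε (j + h)) P = covariance (ε i) (ε j) P

/-- The normalized partial sum process `Z_n` of the noise. -/
def partialSumProcess {S : Type*} (ε : (Fin 3 → ℤ) → S → ℝ) (n : Fin 3 → ℕ) (ω : S)
    (v : Fin 3 → ℝ) : ℝ :=
  (√((n 0 : ℝ) * n 1 * n 2))⁻¹ *
    ∑ i₁ ∈ Finset.Icc 1 ⌊n 0 * v 0⌋₊, ∑ i₂ ∈ Finset.Icc 1 ⌊n 1 * v 1⌋₊,
      ∑ i₃ ∈ Finset.Icc 1 ⌊n 2 * v 2⌋₊, ε ![(i₁ : ℤ), (i₂ : ℤ), (i₃ : ℤ)] ω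

/-- The assumption on the noise: it is a weakly stationary random field on `ℤ³` with mean zero
that satisfies the functional central limit theorem `Z_n ⇒ σ B` in `D[0,1]³` as
`min n_i → ∞`, with `0 < σ`. (The filter `atTop` on `Fin 3 → ℕ` is that of `min n_i → ∞`.) -/
structure NoiseAssumption {S S' : Type*} [MeasurableSpace S] [MeasurableSpace S']
    (ε : (Fin 3 → ℤ) → S → ℝ) (P : Measure S) [IsProbabilityMeasure P] (σ : ℝ)
    (B : S' → (Fin 3 → ℝ) → ℝ) (P' : Measure S') [IsProbabilityMeasure P'] : Prop where
  stationary : IsWeaklyStationary ε P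
  mean_zero : ∀ i, ∫ ω, ε i ω ∂P = 0
  sigma_pos : 0 < σ
  fclt : ConvergesWeaklyInSkorohod 0 1 (partialSumProcess ε) P atTop (fun ω v => σ * B ω v) P'

/-! ### The detector process and its limit -/

/-- The one-dimensional reconstruction kernel `sin(Ω t) / (π t)`, with value `Ω / π` at `0`. -/
def kernel₁ (Om t : ℝ) : ℝ :=
  if t = 0 then Om / Real.pi else Real.sin (Om * t) / (Real.pi * t)

/-- The product reconstruction kernel `φ`. -/
def kernel₃ (Om : Fin 3 → ℝ) (t r₂ r₃ : ℝ) : ℝ :=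
  kernel₁ (Om 0) t * kernel₁ (Om 1) r₂ * kernel₁ (Om 2) r₃

/-- The noisy samples `y_l = f(l₁ τ₁, l₂ τ₂, l₃ τ₃) + ε_l` for the sampling periods `τ`. -/
def observation {S : Type*} (f : ℝ → ℝ → ℝ → ℝ) (ε : (Fin 3 → ℤ) → S → ℝ) (τ : Fin 3 → ℝ)
    (ω : S) (l₁ l₂ l₃ : ℕ) : ℝ :=
  f (l₁ * τ 0) (l₂ * τ 1) (l₃ * τ 2) + ε ![(l₁ : ℤ), (l₂ : ℤ), (l₃ : ℤ)] ω

/-- The weighted detector process `F^w_n(s, t, r₂, r₃)`, `x = (s, t, r₂, r₃)`, of the data `y`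
for the reference signal `f₀`, the sample sizes `n` and the sampling periods `τ`. -/
def weightedDetector (Om : Fin 3 → ℝ) (w : ℝ → ℝ → ℝ → ℝ → ℝ) (f₀ : ℝ → ℝ → ℝ → ℝ)
    (n : Fin 3 → ℕ) (τ : Fin 3 → ℝ) (y : ℕ → ℕ → ℕ → ℝ) (x : Fin 4 → ℝ) : ℝ :=
  √(τ 0 * τ 1 * τ 2) *
    ∑ l₁ ∈ Finset.Icc 1 ⌊n 0 * x 0⌋₊, ∑ l₂ ∈ Finset.Icc 1 (n 1), ∑ l₃ ∈ Finset.Icc 1 (n 2),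
      (y l₁ l₂ l₃ - f₀ (l₁ * τ 0) (l₂ * τ 1) (l₃ * τ 2)) *
        kernel₃ Om (x 1 - l₁ * τ 0) (x 2 - l₂ * τ 1) (x 3 - l₃ * τ 2) *
        w (l₂ * τ 1) (l₃ * τ 2) (x 2) (x 3)

/-- The integrand of the limit process at `x = (s, t, r₂, r₃)`:
`z ↦ φ(t - τ̄₁ z₁, r₂ - τ̄₂ z₂, r₃ - τ̄₃ z₃) w(τ̄₂ z₂, τ̄₃ z₃, r₂, r₃)`. -/
def limitIntegrand (Om τbar : Fin 3 → ℝ) (w : ℝ → ℝ → ℝ → ℝ → ℝ) (x : Fin 4 → ℝ)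
    (z : Fin 3 → ℝ) : ℝ :=
  kernel₃ Om (x 1 - τbar 0 * z 0) (x 2 - τbar 1 * z 1) (x 3 - τbar 2 * z 2) *
    w (τbar 1 * z 1) (τbar 2 * z 2) (x 2) (x 3)

/-- The limit process `F^w(s, t, r₂, r₃)`, `x = (s, t, r₂, r₃)`, for the path `β` of the Brownian
motion; the integral runs over `[0, s] × [0, 1] × [0, 1]`. -/
def limitProcess (Om τbar : Fin 3 → ℝ) (w : ℝ → ℝ → ℝ → ℝ → ℝ) (σ : ℝ) (β : (Fin 3 → ℝ) → ℝ)
    (x : Fin 4 → ℝ) : ℝ :=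
  √(τbar 0 * τbar 1 * τbar 2) * σ *
    partsIntegral (limitIntegrand Om τbar w x) β 0 ![x 0, 1, 1]

end

/-! Under the null hypothesis the residuals are pure noise, and `ε_l` is `√(n₁n₂n₃)` times the
increment of the partial sum process `Z_n` over the grid cell with upper corner `l/n`. With `θ_j =
n_j τ_j` the detector is therefore `T_n(Z_n)`, where `T_n(z)` is `√(θ₁θ₂θ₃)` times a Stieltjes sum:
increments of `z` over grid cells, weighted by the limit integrand, with `θ` in place of `τbar`, at
the upper corners (`weightedDetector_eq`, `altSum_partialSumProcess`).

Summation by parts (`sum_altSum_mul`) moves the differences from `z` to the integrand and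
reproduces, face by face, the formula that defines the integral. For an integrand of bounded
variation on all faces this has two consequences: the sum is bounded by a constant times `sup |z|`
(`abs_gridSum_le`), and for continuous `z` its distance to the integral is bounded by the modulus of
continuity of `z` times the variation (`abs_gridSum_sub_le`). The variation is bounded uniformly in
all parameters (`limitIntegrand_faceVariationLe`): the kernels are bounded and Lipschitz, and the
weight is controlled by its Hardy-Krause variation.

While the mesh tends to zero, the box and the dilation `θ` move too. Both effects are separated by
comparison with a grid having a fixed number of cells, whose sum is jointly continuous in box,
dilation and parameters (`continuousOn_coarseSum`, `gridSum_close`). Hence `T_n(z_n)` converges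
uniformly to the limit functional of `β` whenever `z_n → σβ` uniformly and `β` is continuous
(`detector_close`).

Brownian paths are almost surely continuous, and Skorohod convergence to a continuous function is
uniform (`abs_sub_le_of_skorohod_edist_lt`). So the `T_n` converge continuously at almost every
value of the limit, and the extended continuous mapping theorem
`tendstoInDistribution_of_tendsto_prod` transfers the central limit theorem. Measurability comes
from the finite linear combinations of fixed functions of which the detector consists
(`SkorohodSpace.continuous_linComb`). -/

noncomputable section

/-! ### Reduction of multilinear identities to product functions -/

/-- A property of functions on `ℝ^ι` that only depends on the values on a finite grid and is
stable under linear combinations holds as soon as it holds for product functions. -/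
theorem product_induction {ι : Type*} [Fintype ι] [DecidableEq ι] (W : ι → Finset ℝ)
    (p : ((ι → ℝ) → ℝ) → Prop)
    (congr : ∀ f g, (∀ z, (∀ j, z j ∈ W j) → f z = g z) → p f → p g)
    (add : ∀ f g, p f → p g → p (fun z => f z + g z))
    (smul : ∀ (c : ℝ) f, p f → p (fun z => c * f z))
    (prod : ∀ g : ι → ℝ → ℝ, p (fun z => ∏ j, g j (z j))) (f : (ι → ℝ) → ℝ) : p f := by
  -- On the grid `f` is a combination of indicators of grid points, and the indicator of a point is
  -- a product over the coordinates.
  have key : p (∑ q ∈ Fintype.piFinset W,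
      fun z => f q * ∏ j, (if z j = q j then (1 : ℝ) else 0)) := by
    refine Finset.sum_induction _ p (fun f g hf hg => add f g hf hg) ?_ ?_
    · have := smul 0 _ (prod fun _ _ => 1)
      simp only [zero_mul] at this
      exact this
    · intro q _
      exact smul _ _ (prod fun j x => if x = q j then 1 else 0)
  refine congr _ _ (fun z hz => ?_) key
  rw [Finset.sum_apply, Finset.sum_eq_single z]
  · simp
  · intro q _ hq
    obtain ⟨j, hj⟩ := Function.ne_iff.mp hq
    rw [Finset.prod_eq_zero (Finset.mem_univ j) (if_neg (Ne.symm hj)), mul_zero]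
  · intro h
    exact absurd (Fintype.mem_piFinset.mpr hz) h

theorem altSum_add {ι : Type*} [Fintype ι] [DecidableEq ι] (f g : (ι → ℝ) → ℝ) (a b : ι → ℝ) :
    altSum (fun z => f z + g z) a b = altSum f a b + altSum g a b := by
  simp [altSum, mul_add, Finset.sum_add_distrib]

theorem altSum_const_mul {ι : Type*} [Fintype ι] [DecidableEq ι] (c : ℝ) (f : (ι → ℝ) → ℝ)
    (a b : ι → ℝ) : altSum (fun z => c * f z) a b = c * altSum f a b := by
  simp [altSum, Finset.mul_sum, mul_left_comm]

theorem altSum_sub {ι : Type*} [Fintype ι] [DecidableEq ι] (f g : (ι → ℝ) → ℝ) (a b : ι → ℝ) :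
    altSum (fun z => f z - g z) a b = altSum f a b - altSum g a b := by
  simp [altSum, mul_sub, Finset.sum_sub_distrib]

theorem altSum_congr {ι : Type*} [Fintype ι] [DecidableEq ι] {f g : (ι → ℝ) → ℝ} {a b : ι → ℝ}
    (h : ∀ z, (∀ j, z j = a j ∨ z j = b j) → f z = g z) : altSum f a b = altSum g a b := by
  refine Finset.sum_congr rfl fun v _ => ?_
  rw [h]
  intro j
  by_cases hj : j ∈ v <;> simp [hj]

theorem prod_piecewise_apply {ι : Type*} [Fintype ι] [DecidableEq ι] (g : ι → ℝ → ℝ)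
    (v : Finset ι) (a b : ι → ℝ) :
    ∏ j, g j (v.piecewise a b j) = (∏ j ∈ v, g j (a j)) * ∏ j ∈ vᶜ, g j (b j) := by
  rw [← Finset.prod_mul_prod_compl v]
  congr 1
  · exact Finset.prod_congr rfl fun j hj => by rw [Finset.piecewise_eq_of_mem _ _ _ hj]
  · exact Finset.prod_congr rfl fun j hj => by
      rw [Finset.piecewise_eq_of_notMem _ _ _ (Finset.mem_compl.mp hj)]

/-- Expand the product over the set of coordinates in which the term at `a` is picked. This
factorization reduces identities for product functions to dimension one. -/
theorem altSum_prod {ι : Type*} [Fintype ι] [DecidableEq ι] (g : ι → ℝ → ℝ) (a b : ι → ℝ) :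
    altSum (fun z => ∏ j, g j (z j)) a b = ∏ j, (g j (b j) - g j (a j)) := by
  rw [Finset.prod_sub, Finset.powerset_univ]
  refine Finset.sum_congr rfl fun v _ => ?_
  beta_reduce
  rw [prod_piecewise_apply, Finset.compl_eq_univ_sdiff]
  ring

/-! ### Ladders -/

theorem ladderSucc_eq {b : ℝ} {Y : Finset ℝ} {y z : ℝ} (hz : z ∈ Y) (hyz : y < z)
    (h : ∀ w ∈ Y, y < w → z ≤ w) : ladderSucc b Y y = z := by
  have hne : (Y.filter (fun z => y < z)).Nonempty := ⟨z, by simp [hz, hyz]⟩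
  rw [ladderSucc, dif_pos hne]
  refine le_antisymm (Finset.min'_le _ _ (by simp [hz, hyz])) ?_
  refine Finset.le_min' _ _ _ fun w hw => ?_
  simp only [Finset.mem_filter] at hw
  exact h w hw.1 hw.2

theorem ladderSucc_eq_right {b : ℝ} {Y : Finset ℝ} {y : ℝ} (h : ∀ w ∈ Y, w ≤ y) :
    ladderSucc b Y y = b := by
  rw [ladderSucc, dif_neg]
  rintro ⟨w, hw⟩
  simp only [Finset.mem_filter] at hw
  exact absurd (h w hw.1) (not_le.mpr hw.2)

theorem ladderSucc_cases (b : ℝ) (Y : Finset ℝ) (y : ℝ) :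
    (ladderSucc b Y y ∈ Y ∧ y < ladderSucc b Y y ∧ ∀ w ∈ Y, y < w → ladderSucc b Y y ≤ w) ∨
      (ladderSucc b Y y = b ∧ ∀ w ∈ Y, w ≤ y) := by
  by_cases hne : (Y.filter (fun z => y < z)).Nonempty
  · left
    rw [ladderSucc, dif_pos hne]
    have := Finset.min'_mem _ hne
    simp only [Finset.mem_filter] at this
    exact ⟨this.1, this.2, fun w hw hyw => Finset.min'_le _ _ (by simp [hw, hyw])⟩
  · right
    refine ⟨by rw [ladderSucc, dif_neg hne], fun w hw => ?_⟩
    by_contra hlt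
    exact hne ⟨w, by simp [hw, not_le.mp hlt]⟩

theorem ladderSucc_mem_insert (b : ℝ) (Y : Finset ℝ) (y : ℝ) :
    ladderSucc b Y y ∈ insert b Y := by
  rcases ladderSucc_cases b Y y with h | h
  · exact Finset.mem_insert_of_mem h.1
  · rw [h.1]; exact Finset.mem_insert_self _ _

namespace IsLadder

variable {a b : ℝ} {Y : Finset ℝ}

theorem left_le (hY : IsLadder a b Y) {y : ℝ} (hy : y ∈ Y) : a ≤ y := by
  rcases hY.2 y hy with h | h
  · exact h.ge
  · exact h.1.le

theorem le_right (hY : IsLadder a b Y) (hab : a ≤ b) {y : ℝ} (hy : y ∈ Y) : y ≤ b := by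
  rcases hY.2 y hy with h | h
  · exact h ▸ hab
  · exact h.2.le

theorem le_succ (hY : IsLadder a b Y) (hab : a ≤ b) {y : ℝ} (hy : y ∈ Y) :
    y ≤ ladderSucc b Y y := by
  rcases ladderSucc_cases b Y y with h | h
  · exact h.2.1.le
  · rw [h.1]; exact hY.le_right hab hy

theorem succ_le (hY : IsLadder a b Y) (hab : a ≤ b) (y : ℝ) : ladderSucc b Y y ≤ b := by
  rcases ladderSucc_cases b Y y with h | h
  · exact hY.le_right hab h.1
  · exact h.1.le

theorem union {Y' : Finset ℝ} (hY : IsLadder a b Y) (hY' : IsLadder a b Y') :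
    IsLadder a b (Y ∪ Y') := by
  refine ⟨Finset.mem_union_left _ hY.1, fun y hy => ?_⟩
  rcases Finset.mem_union.mp hy with h | h
  · exact hY.2 y h
  · exact hY'.2 y h

/-- Every point of `[a, b)` (or the point `a`) lies in a cell of the ladder. -/
theorem exists_floor (hY : IsLadder a b Y) {z : ℝ} (hz : a ≤ z) :
    ∃ y ∈ Y, y ≤ z ∧ ∀ w ∈ Y, w ≤ z → w ≤ y := by
  have hne : (Y.filter (fun w => w ≤ z)).Nonempty := ⟨a, by simp [hY.1, hz]⟩
  have hm := Finset.max'_mem _ hne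
  simp only [Finset.mem_filter] at hm
  exact ⟨_, hm.1, hm.2, fun w hw hwz => Finset.le_max' _ _ (by simp [hw, hwz])⟩

end IsLadder

/-- Telescoping, by induction on the largest point: once it is removed, it serves as the right end
point for the others. Nothing is asked of `b`, so that the lemma also applies to the points of a
refinement inside a single cell. -/
theorem sum_ladder_sub (g : ℝ → ℝ) (Y : Finset ℝ) : ∀ (a b : ℝ), a ∈ Y → (∀ y ∈ Y, a ≤ y) →
    ∑ y ∈ Y, (g (ladderSucc b Y y) - g y) = g b - g a := by
  induction Y using Finset.induction_on_max with
  | empty => intro a b ha; simp at ha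
  | insert m s hs ih =>
    intro a b ha hle
    have hm : m ∉ s := fun h => lt_irrefl _ (hs m h)
    rw [Finset.sum_insert hm, ladderSucc_eq_right (y := m)]
    swap
    · intro w hw
      rcases Finset.mem_insert.mp hw with h | h
      · exact h.le
      · exact (hs w h).le
    have hsucc : ∀ y ∈ s, ladderSucc b (insert m s) y = ladderSucc m s y := by
      intro y hy
      rcases ladderSucc_cases m s y with h | h
      · refine ladderSucc_eq (Finset.mem_insert_of_mem h.1) h.2.1 fun w hw hyw => ?_
        rcases Finset.mem_insert.mp hw with h' | h'
        · rw [h']; exact (hs _ h.1).le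
        · exact h.2.2 w h' hyw
      · rw [h.1]
        refine ladderSucc_eq (Finset.mem_insert_self _ _) (hs y hy) fun w hw hyw => ?_
        rcases Finset.mem_insert.mp hw with h' | h'
        · exact h'.ge
        · exact absurd (h.2 w h') (not_le.mpr hyw)
    rw [Finset.sum_congr rfl fun y hy => by rw [hsucc y hy]]
    rcases Finset.mem_insert.mp ha with rfl | ha'
    · have : s = ∅ := by
        by_contra hne
        obtain ⟨y, hy⟩ := Finset.nonempty_iff_ne_empty.mpr hne
        exact absurd (hle y (Finset.mem_insert_of_mem hy)) (not_le.mpr (hs y hy))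
      simp [this]
    · rw [ih a m ha' fun y hy => hle y (Finset.mem_insert_of_mem hy)]
      ring

theorem IsLadder.sum_sub {a b : ℝ} {Y : Finset ℝ} (hY : IsLadder a b Y) (g : ℝ → ℝ) :
    ∑ y ∈ Y, (g (ladderSucc b Y y) - g y) = g b - g a :=
  sum_ladder_sub g Y a b hY.1 fun _ hy => hY.left_le hy

/-- The sum of the increments over the cells of a refinement contained in a cell. -/
theorem sum_cell_refine {b : ℝ} {Y Y' : Finset ℝ} (hYY' : Y ⊆ Y') (g : ℝ → ℝ) (fl : ℝ → ℝ)
    (hfl : ∀ z ∈ Y', fl z ∈ Y ∧ fl z ≤ z ∧ ∀ w ∈ Y, w ≤ z → w ≤ fl z) {y : ℝ} (hy : y ∈ Y) :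
    ∑ z ∈ Y' with fl z = y, (g (ladderSucc b Y' z) - g z) = g (ladderSucc b Y y) - g y := by
  set F := Y'.filter (fun z => fl z = y) with hF
  have hmem : ∀ z, z ∈ F ↔ z ∈ Y' ∧ y ≤ z ∧ ∀ w ∈ Y, w ≤ z → w ≤ y := by
    intro z
    rw [hF, Finset.mem_filter]
    constructor
    · rintro ⟨hz, rfl⟩
      exact ⟨hz, (hfl z hz).2⟩
    · rintro ⟨hz, h1, h2⟩
      exact ⟨hz, le_antisymm (h2 _ (hfl z hz).1 (hfl z hz).2.1) ((hfl z hz).2.2 y hy h1)⟩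
  -- Inside the cell of `y`, successors in the refinement are successors in `F`, with the right end
  -- of the cell as end point; then the sum over `F` telescopes.
  have hsucc : ∀ z ∈ F, ladderSucc b Y' z = ladderSucc (ladderSucc b Y y) F z := by
    intro z hz
    obtain ⟨hzY', hyz, hzF⟩ := (hmem z).mp hz
    rcases ladderSucc_cases (ladderSucc b Y y) F z with h | h
    · refine ladderSucc_eq ((hmem _).mp h.1).1 h.2.1 fun w hw hzw => ?_
      by_contra! hlt
      exact absurd (h.2.2 w ((hmem w).mpr ⟨hw, hyz.trans hzw.le,
        fun u hu huw => ((hmem _).mp h.1).2.2 u hu (huw.trans hlt.le)⟩) hzw) (not_le.mpr hlt)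
    · rw [h.1]
      have hnext : ∀ w ∈ Y', z < w → ∃ u ∈ Y, u ≤ w ∧ y < u := by
        intro w hw hzw
        by_contra! hcon
        exact absurd (h.2 w ((hmem w).mpr ⟨hw, hyz.trans hzw.le, hcon⟩)) (not_le.mpr hzw)
      rcases ladderSucc_cases b Y y with h' | h'
      · refine ladderSucc_eq (hYY' h'.1) ?_ fun w hw hzw => ?_
        · by_contra! hle
          exact absurd (hzF _ h'.1 hle) (not_le.mpr h'.2.1)
        · obtain ⟨u, hu, huw, hyu⟩ := hnext w hw hzw
          exact (h'.2.2 u hu hyu).trans huw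
      · rw [h'.1]
        refine ladderSucc_eq_right fun w hw => ?_
        by_contra! hzw
        obtain ⟨u, hu, huw, hyu⟩ := hnext w hw hzw
        exact absurd (h'.2 u hu) (not_le.mpr hyu)
  rw [Finset.sum_congr rfl fun z hz => by rw [hsucc z hz]]
  exact sum_ladder_sub g F y _ ((hmem y).mpr ⟨hYY' hy, le_rfl, fun _ _ h => h⟩)
    fun z hz => ((hmem z).mp hz).2.1

/-- Every increment over a coarse cell splits into those over the refined cells in it, on which `fl`
is constantly the left end of the coarse cell. -/
theorem sum_ladder_refine {b : ℝ} {Y Y' : Finset ℝ} (hYY' : Y ⊆ Y') (u g : ℝ → ℝ) (fl : ℝ → ℝ)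
    (hfl : ∀ z ∈ Y', fl z ∈ Y ∧ fl z ≤ z ∧ ∀ w ∈ Y, w ≤ z → w ≤ fl z) :
    ∑ y ∈ Y, u y * (g (ladderSucc b Y y) - g y)
      = ∑ z ∈ Y', u (fl z) * (g (ladderSucc b Y' z) - g z) := by
  rw [← Finset.sum_fiberwise_of_maps_to (g := fl) (t := Y) fun z hz => (hfl z hz).1]
  refine Finset.sum_congr rfl fun y hy => ?_
  rw [← sum_cell_refine hYY' g fl hfl hy, Finset.mul_sum]
  exact Finset.sum_congr rfl fun z hz => by rw [(Finset.mem_filter.mp hz).2]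

theorem mem_insert_of_corner {ι : Type*} {b : ι → ℝ} {Y : ι → Finset ℝ}
    {y z : ι → ℝ} (hy : ∀ j, y j ∈ Y j)
    (hz : ∀ j, z j = y j ∨ z j = ladderSuccPi b Y y j) (j : ι) : z j ∈ insert (b j) (Y j) := by
  rcases hz j with h | h
  · rw [h]; exact Finset.mem_insert_of_mem (hy j)
  · rw [h]; exact ladderSucc_mem_insert _ _ _

/-- A Riemann-Stieltjes sum, written as a sum over the cells of a refinement. -/
theorem rsSum_refine {ι : Type*} [Fintype ι] [DecidableEq ι] {b : ι → ℝ}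
    {Y Y' : ι → Finset ℝ} (hYY' : ∀ j, Y j ⊆ Y' j) (H f : (ι → ℝ) → ℝ) (fl : ι → ℝ → ℝ)
    (hfl : ∀ j, ∀ z ∈ Y' j, fl j z ∈ Y j ∧ fl j z ≤ z ∧ ∀ w ∈ Y j, w ≤ z → w ≤ fl j z) :
    ∑ y ∈ Fintype.piFinset Y, H y * altSum f y (ladderSuccPi b Y y)
      = ∑ z ∈ Fintype.piFinset Y', H (fun j => fl j (z j)) * altSum f z (ladderSuccPi b Y' z) := by
  revert H
  refine product_induction (fun j => insert (b j) (Y' j)) (fun f => ∀ H : (ι → ℝ) → ℝ,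
    ∑ y ∈ Fintype.piFinset Y, H y * altSum f y (ladderSuccPi b Y y)
      = ∑ z ∈ Fintype.piFinset Y', H (fun j => fl j (z j)) * altSum f z (ladderSuccPi b Y' z))
    ?_ ?_ ?_ ?_ f
  · intro f g hfg hf H
    have h1 : ∀ y ∈ Fintype.piFinset Y, altSum g y (ladderSuccPi b Y y)
        = altSum f y (ladderSuccPi b Y y) := fun y hy => altSum_congr fun z hz =>
      (hfg z fun j => Finset.insert_subset_insert _ (hYY' j)
        (mem_insert_of_corner (Fintype.mem_piFinset.mp hy) hz j)).symm
    have h2 : ∀ y ∈ Fintype.piFinset Y', altSum g y (ladderSuccPi b Y' y)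
        = altSum f y (ladderSuccPi b Y' y) := fun y hy => altSum_congr fun z hz =>
      (hfg z fun j => mem_insert_of_corner (Fintype.mem_piFinset.mp hy) hz j).symm
    rw [Finset.sum_congr rfl fun y hy => by rw [h1 y hy], hf H,
      Finset.sum_congr rfl fun y hy => by rw [← h2 y hy]]
  · intro f g hf hg H
    simp only [altSum_add, mul_add, Finset.sum_add_distrib, hf H, hg H]
  · intro c f hf H
    have := congrArg (fun t => c * t) (hf H)
    simpa only [altSum_const_mul, mul_left_comm _ c, Finset.mul_sum] using this
  · intro g
    -- With `f` a product, `H` is reduced as well: it is evaluated only on the grid of `Y`, into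
    -- which `fl` maps. Then both sides factor over the coordinates.
    refine product_induction Y _ ?_ ?_ ?_ ?_
    · intro H H' hH h
      rw [Finset.sum_congr rfl fun y hy => by rw [← hH y (Fintype.mem_piFinset.mp hy)], h]
      refine Finset.sum_congr rfl fun z hz => ?_
      rw [hH _ fun j => (hfl j _ (Fintype.mem_piFinset.mp hz j)).1]
    · intro H H' h h'
      simp only [add_mul, Finset.sum_add_distrib, h, h']
    · intro c H h
      simp only [mul_assoc, ← Finset.mul_sum, h]
    · intro u
      simp only [altSum_prod, ← Finset.prod_mul_distrib]
      have h := fun (A : ι → Finset ℝ) (F : ι → ℝ → ℝ) => (Finset.prod_univ_sum A F).symm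
      simp only [ladderSuccPi]
      rw [h Y fun j y => u j y * (g j (ladderSucc (b j) (Y j) y) - g j y),
        h Y' fun j y => u j (fl j y) * (g j (ladderSucc (b j) (Y' j) y) - g j y)]
      exact Finset.prod_congr rfl fun j _ =>
        sum_ladder_refine (hYY' j) (u j) (g j) (fl j) (hfl j)

/-! ### Equidistant ladders -/

/-- The ladder `{a, a + h, …, a + (N - 1) h}`. -/
def gridLadder (a h : ℝ) (N : ℕ) : Finset ℝ :=
  (Finset.range N).image fun i : ℕ => a + i * h

theorem mem_gridLadder {a h y : ℝ} {N : ℕ} :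
    y ∈ gridLadder a h N ↔ ∃ i < N, a + i * h = y := by
  simp [gridLadder]

/-- The degenerate step `h = 0`, where the grid is `{a}`, is allowed so that `exists_fine_ladder`
covers intervals with `a = b`. -/
theorem isLadder_gridLadder {a h : ℝ} {N : ℕ} (hh : 0 ≤ h) (hN : 0 < N) :
    IsLadder a (a + N * h) (gridLadder a h N) := by
  refine ⟨mem_gridLadder.mpr ⟨0, hN, by simp⟩, fun y hy => ?_⟩
  obtain ⟨i, hi, rfl⟩ := mem_gridLadder.mp hy
  rcases hh.eq_or_lt with rfl | hh
  · simp
  rcases Nat.eq_zero_or_pos i with rfl | hi0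
  · simp
  · right
    have h1 : (0 : ℝ) < i := by exact_mod_cast hi0
    have h2 : (i : ℝ) < N := by exact_mod_cast hi
    constructor
    · have := mul_pos h1 hh
      linarith
    · have := mul_lt_mul_of_pos_right h2 hh
      linarith

theorem ladderSucc_gridLadder {a h : ℝ} {N i : ℕ} (hh : 0 ≤ h) (hi : i < N) :
    ladderSucc (a + N * h) (gridLadder a h N) (a + i * h) = a + (i + 1 : ℕ) * h := by
  rcases hh.eq_or_lt with rfl | hh
  · rw [ladderSucc_eq_right]
    · simp
    · intro w hw
      obtain ⟨k, -, rfl⟩ := mem_gridLadder.mp hw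
      simp
  rcases Nat.lt_or_ge (i + 1) N with h1 | h1
  · refine ladderSucc_eq (mem_gridLadder.mpr ⟨i + 1, h1, rfl⟩) ?_ fun w hw hlt => ?_
    · push_cast
      linarith
    · obtain ⟨k, -, rfl⟩ := mem_gridLadder.mp hw
      have hik : (i : ℝ) < k := by
        by_contra! hle
        have := mul_le_mul_of_nonneg_right hle hh.le
        linarith
      have hik' : ((i + 1 : ℕ) : ℝ) ≤ k := by exact_mod_cast hik
      have := mul_le_mul_of_nonneg_right hik' hh.le
      linarith
  · have hN : N = i + 1 := by omega
    subst hN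
    refine ladderSucc_eq_right fun w hw => ?_
    obtain ⟨k, hk, rfl⟩ := mem_gridLadder.mp hw
    have : (k : ℝ) ≤ i := by exact_mod_cast Nat.lt_succ_iff.mp hk
    have := mul_le_mul_of_nonneg_right this hh.le
    linarith

theorem exists_fine_ladder {a b δ : ℝ} (hab : a ≤ b) (hδ : 0 < δ) :
    ∃ Y, IsLadder a b Y ∧ ∀ y ∈ Y, ladderSucc b Y y - y < δ := by
  obtain ⟨N, hN⟩ := exists_nat_gt ((b - a) / δ)
  have hN0 : (0 : ℝ) < N := lt_of_le_of_lt (div_nonneg (by linarith) hδ.le) hN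
  have hN' : 0 < N := by exact_mod_cast hN0
  have hh : 0 ≤ (b - a) / N := div_nonneg (by linarith) hN0.le
  have hb : a + N * ((b - a) / N) = b := by field_simp; ring
  have h1 := isLadder_gridLadder (a := a) hh hN'
  rw [hb] at h1
  refine ⟨_, h1, fun y hy => ?_⟩
  obtain ⟨i, hi, rfl⟩ := mem_gridLadder.mp hy
  have h2 := ladderSucc_gridLadder (a := a) hh hi
  rw [hb] at h2
  rw [h2]
  have : (b - a) / N < δ := by
    rw [div_lt_iff₀ hN0]
    rw [div_lt_iff₀ hδ] at hN
    linarith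
  push_cast
  linarith

/-! ### Existence of Riemann-Stieltjes integrals and the error of their sums -/

/-- The function `f` has Vitali variation at most `V` on `[a, b]`. -/
def VitaliBounded {ι : Type*} [Fintype ι] [DecidableEq ι] (f : (ι → ℝ) → ℝ) (a b : ι → ℝ)
    (V : ℝ) : Prop :=
  ∀ Y : ι → Finset ℝ, (∀ j, IsLadder (a j) (b j) (Y j)) →
    ∑ y ∈ Fintype.piFinset Y, |altSum f y (ladderSuccPi b Y y)| ≤ V

/-- The function `h` varies by at most `η` on subsets of `[a, b]` of diameter at most `δ`. -/
def ModulusLe {ι : Type*} (h : (ι → ℝ) → ℝ) (a b : ι → ℝ) (δ η : ℝ) : Prop :=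
  ∀ p ∈ Set.Icc a b, ∀ q ∈ Set.Icc a b, (∀ j, |p j - q j| ≤ δ) → |h p - h q| ≤ η

theorem ContinuousOn.exists_modulusLe {ι : Type*} [Fintype ι] {h : (ι → ℝ) → ℝ} {a b : ι → ℝ}
    (hc : ContinuousOn h (Set.Icc a b)) {η : ℝ} (hη : 0 < η) :
    ∃ δ > 0, ModulusLe h a b δ η := by
  have huc := isCompact_Icc.uniformContinuousOn_of_continuous hc
  rw [Metric.uniformContinuousOn_iff] at huc
  obtain ⟨δ, hδ, H⟩ := huc η hη
  refine ⟨δ / 2, by positivity, fun p hp q hq hpq => (H p hp q hq ?_).le⟩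
  refine lt_of_le_of_lt ((dist_pi_le_iff (by positivity)).mpr hpq) (by linarith)

theorem VitaliBounded.nonneg {ι : Type*} [Fintype ι] [DecidableEq ι] {f : (ι → ℝ) → ℝ}
    {a b : ι → ℝ} {V : ℝ} (hab : a ≤ b) (hf : VitaliBounded f a b V) : 0 ≤ V := by
  choose Y hY _ using fun j => exists_fine_ladder (hab j) zero_lt_one
  exact (Finset.sum_nonneg fun _ _ => abs_nonneg _).trans (hf Y hY)

/-- Both sums are rewritten over the common refinement of the two ladders. The two tags belonging to
a refined cell at `z` are within `δ₁` and `δ₂` of `z`, so the values of `h` there differ by at most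
`η`, and the variation of `f` bounds the rest. -/
theorem rsSum_sub_rsSum_le {ι : Type*} [Fintype ι] [DecidableEq ι] {h f : (ι → ℝ) → ℝ}
    {a b : ι → ℝ} {V δ₁ δ₂ η : ℝ} (hab : a ≤ b) (hf : VitaliBounded f a b V) (hη : 0 ≤ η)
    (hh : ModulusLe h a b (δ₁ + δ₂) η) {Y₁ Y₂ : ι → Finset ℝ} {tag₁ tag₂ : (ι → ℝ) → ι → ℝ}
    (hY₁ : ∀ j, IsLadder (a j) (b j) (Y₁ j)) (hY₂ : ∀ j, IsLadder (a j) (b j) (Y₂ j))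
    (hm₁ : ∀ j, ∀ y ∈ Y₁ j, ladderSucc (b j) (Y₁ j) y - y ≤ δ₁)
    (hm₂ : ∀ j, ∀ y ∈ Y₂ j, ladderSucc (b j) (Y₂ j) y - y ≤ δ₂)
    (ht₁ : ∀ y ∈ Fintype.piFinset Y₁, tag₁ y ∈ Set.Icc y (ladderSuccPi b Y₁ y))
    (ht₂ : ∀ y ∈ Fintype.piFinset Y₂, tag₂ y ∈ Set.Icc y (ladderSuccPi b Y₂ y)) :
    |∑ y ∈ Fintype.piFinset Y₁, h (tag₁ y) * altSum f y (ladderSuccPi b Y₁ y) -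
      ∑ y ∈ Fintype.piFinset Y₂, h (tag₂ y) * altSum f y (ladderSuccPi b Y₂ y)| ≤ η * V := by
  have hY : ∀ j, IsLadder (a j) (b j) (Y₁ j ∪ Y₂ j) := fun j => (hY₁ j).union (hY₂ j)
  have hfloor : ∀ (Z : ι → Finset ℝ) (_ : ∀ j, IsLadder (a j) (b j) (Z j)), ∃ fl : ι → ℝ → ℝ,
      ∀ j, ∀ z ∈ Y₁ j ∪ Y₂ j,
        fl j z ∈ Z j ∧ fl j z ≤ z ∧ ∀ w ∈ Z j, w ≤ z → w ≤ fl j z := by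
    intro Z hZ
    have : ∀ j z, ∃ y, z ∈ Y₁ j ∪ Y₂ j → y ∈ Z j ∧ y ≤ z ∧ ∀ w ∈ Z j, w ≤ z → w ≤ y := by
      intro j z
      by_cases hz : z ∈ Y₁ j ∪ Y₂ j
      · obtain ⟨y, hy⟩ := (hZ j).exists_floor ((hY j).left_le hz)
        exact ⟨y, fun _ => hy⟩
      · exact ⟨0, fun h => absurd h hz⟩
    choose fl hfl using this
    exact ⟨fl, hfl⟩
  have hclose : ∀ (Z : ι → Finset ℝ) (_ : ∀ j, IsLadder (a j) (b j) (Z j)) (fl : ι → ℝ → ℝ)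
      (_ : ∀ j, ∀ z ∈ Y₁ j ∪ Y₂ j,
        fl j z ∈ Z j ∧ fl j z ≤ z ∧ ∀ w ∈ Z j, w ≤ z → w ≤ fl j z)
      (δ : ℝ) (_ : ∀ j, ∀ y ∈ Z j, ladderSucc (b j) (Z j) y - y ≤ δ) (tag : (ι → ℝ) → ι → ℝ)
      (_ : ∀ y ∈ Fintype.piFinset Z, tag y ∈ Set.Icc y (ladderSuccPi b Z y)),
      ∀ z ∈ Fintype.piFinset (fun j => Y₁ j ∪ Y₂ j),
        tag (fun j => fl j (z j)) ∈ Set.Icc a b ∧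
          ∀ j, |tag (fun j => fl j (z j)) j - z j| ≤ δ := by
    intro Z hZ fl hfl δ hδ tag ht z hz
    have hz' := fun j => hfl j (z j) (Fintype.mem_piFinset.mp hz j)
    have hmem := ht _ (Fintype.mem_piFinset.mpr fun j => (hz' j).1)
    refine ⟨⟨fun j => ((hZ j).left_le (hz' j).1).trans (hmem.1 j),
      fun j => (hmem.2 j).trans ((hZ j).succ_le (hab j) _)⟩, fun j => ?_⟩
    have h1 := hmem.1 j
    have h2 := hmem.2 j
    have h3 := hδ j _ (hz' j).1
    -- A successor below `z j` would contradict the maximality of the floor.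
    have h4 : z j ≤ ladderSucc (b j) (Z j) (fl j (z j)) := by
      rcases ladderSucc_cases (b j) (Z j) (fl j (z j)) with h | h
      · by_contra! hlt
        exact absurd ((hz' j).2.2 _ h.1 hlt.le) (not_le.mpr h.2.1)
      · rw [h.1]
        exact (hY j).le_right (hab j) (Fintype.mem_piFinset.mp hz j)
    have h5 := (hz' j).2.1
    simp only [ladderSuccPi] at h1 h2
    rw [abs_le]
    constructor <;> linarith
  obtain ⟨fl₁, hfl₁⟩ := hfloor Y₁ hY₁
  obtain ⟨fl₂, hfl₂⟩ := hfloor Y₂ hY₂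
  rw [rsSum_refine (fun j => Finset.subset_union_left (s₂ := Y₂ j)) (fun y => h (tag₁ y)) f fl₁ hfl₁,
    rsSum_refine (fun j => Finset.subset_union_right (s₁ := Y₁ j)) (fun y => h (tag₂ y)) f fl₂ hfl₂,
    ← Finset.sum_sub_distrib]
  refine (Finset.abs_sum_le_sum_abs _ _).trans (le_trans ?_
    (mul_le_mul_of_nonneg_left (hf _ hY) hη))
  rw [Finset.mul_sum]
  refine Finset.sum_le_sum fun z hz => ?_
  rw [← sub_mul, abs_mul]
  refine mul_le_mul_of_nonneg_right ?_ (abs_nonneg _)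
  obtain ⟨h1, h1'⟩ := hclose Y₁ hY₁ fl₁ hfl₁ δ₁ hm₁ tag₁ ht₁ z hz
  obtain ⟨h2, h2'⟩ := hclose Y₂ hY₂ fl₂ hfl₂ δ₂ hm₂ tag₂ ht₂ z hz
  refine hh _ h1 _ h2 fun j => ?_
  have := abs_sub_le (tag₁ (fun j => fl₁ j (z j)) j) (z j) (tag₂ (fun j => fl₂ j (z j)) j)
  have e2 := h2' j
  rw [abs_sub_comm] at e2
  linarith [h1' j]

theorem le_ladderSuccPi {ι : Type*} {a b : ι → ℝ} (hab : a ≤ b) {Y : ι → Finset ℝ}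
    (hY : ∀ j, IsLadder (a j) (b j) (Y j)) {y : ι → ℝ} (hy : ∀ j, y j ∈ Y j) :
    y ≤ ladderSuccPi b Y y :=
  fun j => (hY j).le_succ (hab j) (hy j)

/-- By `rsSum_sub_rsSum_le` and uniform continuity of `h`, the sums along ladders of mesh below
`1/(k+1)` form a Cauchy sequence. Comparing an arbitrary fine sum with these and letting `k → ∞`
identifies the integral. -/
theorem exists_hasRSIntegral {ι : Type*} [Fintype ι] [DecidableEq ι] {h f : (ι → ℝ) → ℝ}
    {a b : ι → ℝ} {V : ℝ} (hab : a ≤ b) (hf : VitaliBounded f a b V)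
    (hc : ContinuousOn h (Set.Icc a b)) : ∃ I, HasRSIntegral h f a b I := by
  have hV := hf.nonneg hab
  choose Y hY hm using fun (k : ℕ) j =>
    exists_fine_ladder (hab j) (Nat.one_div_pos_of_nat (α := ℝ) (n := k))
  set S : ℕ → ℝ := fun k =>
    ∑ y ∈ Fintype.piFinset (Y k), h y * altSum f y (ladderSuccPi b (Y k) y) with hS
  have htag : ∀ k, ∀ y ∈ Fintype.piFinset (Y k),
      (fun y => y : (ι → ℝ) → ι → ℝ) y ∈ Set.Icc y (ladderSuccPi b (Y k) y) :=
    fun k y hy => ⟨le_rfl, le_ladderSuccPi hab (hY k) (Fintype.mem_piFinset.mp hy)⟩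
  have hchoose : ∀ ε > 0, ∃ η > 0, η * V < ε := fun ε hε => by
    -- The summand `1` covers `V = 0`.
    refine ⟨ε / (V + 1), by positivity, ?_⟩
    rw [div_mul_eq_mul_div, div_lt_iff₀ (by positivity)]
    nlinarith
  have hmesh : ∀ δ > 0, ∃ K : ℕ, ∀ k ≥ K, ∀ j, ∀ y ∈ Y k j,
      ladderSucc (b j) (Y k j) y - y ≤ δ := by
    intro δ hδ
    obtain ⟨K, hK⟩ := exists_nat_one_div_lt hδ
    refine ⟨K, fun k hk j y hy => ((hm k j y hy).le.trans ?_).trans hK.le⟩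
    exact Nat.one_div_le_one_div hk
  have hcauchy : CauchySeq S := by
    rw [Metric.cauchySeq_iff']
    intro ε hε
    obtain ⟨η, hη, hηV⟩ := hchoose ε hε
    obtain ⟨δ, hδ, hmod⟩ := hc.exists_modulusLe hη
    obtain ⟨K, hK⟩ := hmesh (δ / 2) (by positivity)
    refine ⟨K, fun k hk => ?_⟩
    rw [Real.dist_eq]
    exact (rsSum_sub_rsSum_le (tag₁ := fun y => y) (tag₂ := fun y => y) hab hf hη.le
      (by rwa [add_halves]) (hY k) (hY K) (hK k hk) (hK K le_rfl) (htag k) (htag K)).trans_lt hηV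
  obtain ⟨I, hI⟩ := cauchySeq_tendsto_of_complete hcauchy
  refine ⟨I, fun ε hε => ?_⟩
  obtain ⟨η, hη, hηV⟩ := hchoose ε hε
  obtain ⟨δ, hδ, hmod⟩ := hc.exists_modulusLe hη
  obtain ⟨K, hK⟩ := hmesh (δ / 2) (by positivity)
  refine ⟨δ / 2, by positivity, fun Y' tag hY' hm' ht => lt_of_le_of_lt ?_ hηV⟩
  refine le_of_tendsto (tendsto_const_nhds.sub hI).abs ?_
  filter_upwards [eventually_ge_atTop K] with k hk
  exact rsSum_sub_rsSum_le (tag₂ := fun y => y) hab hf hη.le (by rwa [add_halves]) hY' (hY k)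
    (fun j y hy => (hm' j y hy).le) (hK k hk) ht (htag k)

/-- The error of a Riemann-Stieltjes sum with tags at the lower corners. -/
theorem HasRSIntegral.abs_sum_sub_le {ι : Type*} [Fintype ι] [DecidableEq ι]
    {h f : (ι → ℝ) → ℝ} {a b : ι → ℝ} {V δ η I : ℝ} (hI : HasRSIntegral h f a b I) (hab : a ≤ b)
    (hf : VitaliBounded f a b V) (hδ : 0 < δ) (hη : 0 ≤ η) (hmod : ModulusLe h a b δ η)
    {Y : ι → Finset ℝ} (hY : ∀ j, IsLadder (a j) (b j) (Y j))
    (hm : ∀ j, ∀ y ∈ Y j, ladderSucc (b j) (Y j) y - y ≤ δ / 2) :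
    |∑ y ∈ Fintype.piFinset Y, h y * altSum f y (ladderSuccPi b Y y) - I| ≤ η * V := by
  refine le_of_forall_pos_le_add fun ε hε => ?_
  obtain ⟨δ', hδ', H⟩ := hI ε hε
  -- The auxiliary ladder is fine enough for the definition of the integral with error `ε`, and has
  -- mesh below `δ / 2`, so that the two meshes in the comparison add up to at most `δ`.
  choose Z hZ hmZ using fun j => exists_fine_ladder (hab j) (lt_min hδ' (half_pos hδ))
  have htZ : ∀ y ∈ Fintype.piFinset Z,
      (fun y => y : (ι → ℝ) → ι → ℝ) y ∈ Set.Icc y (ladderSuccPi b Z y) :=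
    fun y hy => ⟨le_rfl, le_ladderSuccPi hab hZ (Fintype.mem_piFinset.mp hy)⟩
  have htY : ∀ y ∈ Fintype.piFinset Y,
      (fun y => y : (ι → ℝ) → ι → ℝ) y ∈ Set.Icc y (ladderSuccPi b Y y) :=
    fun y hy => ⟨le_rfl, le_ladderSuccPi hab hY (Fintype.mem_piFinset.mp hy)⟩
  have h1 := H Z (fun y => y) hZ (fun j y hy => (hmZ j y hy).trans_le (min_le_left _ _)) htZ
  have h2 := rsSum_sub_rsSum_le (tag₁ := fun y => y) (tag₂ := fun y => y) hab hf hη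
    (by rwa [add_halves]) hY hZ hm
    (fun j y hy => (hmZ j y hy).le.trans (min_le_right _ _)) htY htZ
  refine (abs_sub_le _ _ _).trans (add_le_add h2 h1.le)

/-! ### Summation by parts on products of ladders -/

theorem prod_glue {ι : Type*} [Fintype ι] [DecidableEq ι] (g : ι → ℝ → ℝ) (v : Finset ι)
    (x : v → ℝ) (z : ι → ℝ) :
    ∏ j, g j (glue v x z j) = (∏ j : v, g j (x j)) * ∏ j ∈ vᶜ, g j (z j) := by
  rw [← Finset.prod_mul_prod_compl v]
  congr 1
  · rw [← Finset.prod_coe_sort v]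
    refine Finset.prod_congr rfl fun j _ => ?_
    simp [glue]
  · refine Finset.prod_congr rfl fun j hj => ?_
    simp [glue, Finset.mem_compl.mp hj]

/-- The increments of `u * g` telescope. Since `g` is taken at the right end of each cell on the
left-hand side, `u` appears at the left end on the other. -/
theorem sum_ladder_by_parts {a b : ℝ} {Y : Finset ℝ} (hY : IsLadder a b Y) (u g : ℝ → ℝ) :
    ∑ y ∈ Y, (u (ladderSucc b Y y) - u y) * g (ladderSucc b Y y)
      = (u b * g b - u a * g a) - ∑ y ∈ Y, u y * (g (ladderSucc b Y y) - g y) := by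
  rw [← hY.sum_sub fun t => u t * g t, ← Finset.sum_sub_distrib]
  exact Finset.sum_congr rfl fun y _ => by ring

theorem glue_mem {ι : Type*} [DecidableEq ι] {v : Finset ι} {x : v → ℝ} {z : ι → ℝ}
    {W : ι → Set ℝ} (hx : ∀ j : v, x j ∈ W j) (hz : ∀ j, z j ∈ W j) (j : ι) :
    glue v x z j ∈ W j := by
  by_cases hj : j ∈ v
  · simpa [glue, hj] using hx ⟨j, hj⟩
  · simpa [glue, hj] using hz j

theorem piecewise_mem {ι : Type*} [DecidableEq ι] (c : Finset ι) {a b : ι → ℝ}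
    {W : ι → Set ℝ} (ha : ∀ j, a j ∈ W j) (hb : ∀ j, b j ∈ W j) (j : ι) :
    c.piecewise a b j ∈ W j := by
  by_cases hj : j ∈ c
  · simpa [hj] using ha j
  · simpa [hj] using hb j

/-- Multidimensional summation by parts, the discrete counterpart of `HasPartsIntegral`. For product
functions it is the product of the one-dimensional formulas; `product_induction`, first in `f` and
then in `x`, gives the general case. -/
theorem sum_altSum_mul {ι : Type*} [Fintype ι] [DecidableEq ι] {a b : ι → ℝ}
    {Y : ι → Finset ℝ} (hY : ∀ j, IsLadder (a j) (b j) (Y j)) (x f : (ι → ℝ) → ℝ) :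
    ∑ y ∈ Fintype.piFinset Y, altSum x y (ladderSuccPi b Y y) * f (ladderSuccPi b Y y)
      = ∑ v : Finset ι, (-1 : ℝ) ^ v.card * ∑ c ∈ vᶜ.powerset, (-1 : ℝ) ^ c.card *
          ∑ y ∈ Fintype.piFinset fun j : v => Y j, x (glue v y (c.piecewise a b)) *
            altSum (fun t : v → ℝ => f (glue v t (c.piecewise a b))) y
              (ladderSuccPi (fun j : v => b j) (fun j : v => Y j) y) := by
  have hcorner : ∀ (c : Finset ι) (j : ι),
      c.piecewise a b j ∈ ((insert (b j) (Y j) : Finset ℝ) : Set ℝ) := fun c =>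
    piecewise_mem c (W := fun j => ((insert (b j) (Y j) : Finset ℝ) : Set ℝ))
      (fun j => Finset.mem_insert_of_mem (hY j).1) fun j => Finset.mem_insert_self _ _
  have hglue : ∀ (v c : Finset ι) (t : v → ℝ), (∀ j : v, t j ∈ insert (b j) (Y j)) →
      ∀ j, glue v t (c.piecewise a b) j ∈ insert (b j) (Y j) := fun v c t ht =>
    glue_mem (W := fun j => ((insert (b j) (Y j) : Finset ℝ) : Set ℝ)) ht (hcorner c)
  revert x
  refine product_induction (fun j => insert (b j) (Y j)) (fun f => ∀ x : (ι → ℝ) → ℝ,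
    ∑ y ∈ Fintype.piFinset Y, altSum x y (ladderSuccPi b Y y) * f (ladderSuccPi b Y y)
      = ∑ v : Finset ι, (-1 : ℝ) ^ v.card * ∑ c ∈ vᶜ.powerset, (-1 : ℝ) ^ c.card *
          ∑ y ∈ Fintype.piFinset fun j : v => Y j, x (glue v y (c.piecewise a b)) *
            altSum (fun t : v → ℝ => f (glue v t (c.piecewise a b))) y
              (ladderSuccPi (fun j : v => b j) (fun j : v => Y j) y)) ?_ ?_ ?_ ?_ f
  · intro f g hfg h x
    rw [Finset.sum_congr rfl fun y hy => by
      rw [← hfg (ladderSuccPi b Y y) fun j => ladderSucc_mem_insert (b j) (Y j) (y j)], h x]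
    refine Finset.sum_congr rfl fun v _ => congrArg _ (Finset.sum_congr rfl fun c _ =>
      congrArg _ (Finset.sum_congr rfl fun y hy => congrArg _ (altSum_congr fun z hz =>
        hfg _ (hglue v c z fun j => ?_))))
    exact mem_insert_of_corner (b := fun j : v => b j) (Y := fun j : v => Y j)
      (Fintype.mem_piFinset.mp hy) hz j
  · intro f g hf hg x
    simp only [altSum_add, mul_add, Finset.sum_add_distrib, hf x, hg x]
  · intro c f hf x
    simp only [altSum_const_mul, mul_left_comm _ c, ← Finset.mul_sum, hf x]
  · intro g
    refine product_induction (fun j => insert (b j) (Y j)) _ ?_ ?_ ?_ ?_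
    · intro x x' hx h
      rw [Finset.sum_congr rfl fun y hy => by
        rw [← altSum_congr fun z hz =>
          hx z (mem_insert_of_corner (Fintype.mem_piFinset.mp hy) hz)], h]
      refine Finset.sum_congr rfl fun v _ => congrArg _ (Finset.sum_congr rfl fun c _ =>
        congrArg _ (Finset.sum_congr rfl fun y hy => ?_))
      rw [hx _ (hglue v c y fun j => Finset.mem_insert_of_mem (Fintype.mem_piFinset.mp hy j))]
    · intro x x' h h'
      simp only [altSum_add, add_mul, mul_add, Finset.sum_add_distrib, h, h']
    · intro c x h
      simp only [altSum_const_mul, mul_assoc, mul_left_comm _ c, ← Finset.mul_sum, h]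
    · intro u
      have hsum := fun (A : ι → Finset ℝ) (F : ι → ℝ → ℝ) => (Finset.prod_univ_sum A F).symm
      simp only [altSum_prod, ← Finset.prod_mul_distrib, ladderSuccPi]
      rw [hsum Y fun j y => (u j (ladderSucc (b j) (Y j) y) - u j y) *
        g j (ladderSucc (b j) (Y j) y)]
      simp only [sum_ladder_by_parts (hY _)]
      -- Each factor is a boundary term minus a Stieltjes sum. In the expansion `v` collects the
      -- coordinates with the Stieltjes sum; below, `c` collects those of the remaining ones taken
      -- at the lower end.
      rw [Finset.prod_sub, Finset.powerset_univ]
      refine Finset.sum_congr rfl fun v _ => ?_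
      rw [mul_assoc]
      congr 1
      rw [← Finset.compl_eq_univ_sdiff, Finset.prod_sub, Finset.sum_mul]
      refine Finset.sum_congr rfl fun c hc => ?_
      rw [mul_assoc, mul_assoc]
      congr 1
      have hinner : ∀ y : v → ℝ,
          (∏ j, u j (glue v y (c.piecewise a b) j)) *
            altSum (fun t : v → ℝ => ∏ j, g j (glue v t (c.piecewise a b) j)) y
              (ladderSuccPi (fun j : v => b j) (fun j : v => Y j) y)
          = (∏ j ∈ vᶜ, u j (c.piecewise a b j) * g j (c.piecewise a b j)) *
            ∏ j : v, u j (y j) * (g j (ladderSucc (b j) (Y j) (y j)) - g j (y j)) := by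
        intro y
        simp only [prod_glue, mul_comm (∏ j : v, g _ _)]
        rw [altSum_const_mul, altSum_prod (fun j : v => g j), Finset.prod_mul_distrib,
          Finset.prod_mul_distrib]
        simp only [ladderSuccPi]
        ring
      have hsum' := fun (F : v → ℝ → ℝ) =>
        (Finset.prod_univ_sum (fun j : v => Y j) F).symm
      rw [Finset.sum_congr rfl fun y _ => hinner y, ← Finset.mul_sum,
        hsum' fun j y => u j y * (g j (ladderSucc (b j) (Y j) y) - g j y),
        Finset.prod_coe_sort v fun j => ∑ y ∈ Y j, u j y *
          (g j (ladderSucc (b j) (Y j) y) - g j y), ← mul_assoc]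
      congr 1
      have hcv := Finset.mem_powerset.mp hc
      rw [← Finset.prod_sdiff hcv]
      congr 1
      · exact Finset.prod_congr rfl fun j hj => by
          rw [Finset.piecewise_eq_of_notMem _ _ _ (Finset.mem_sdiff.mp hj).2]
      · exact Finset.prod_congr rfl fun j hj => by rw [Finset.piecewise_eq_of_mem _ _ _ hj]

/-- On all faces of `[a, b]` the function `f` has Vitali variation at most `V`. -/
def FaceBounded {ι : Type*} [Fintype ι] [DecidableEq ι] (f : (ι → ℝ) → ℝ) (a b : ι → ℝ)
    (V : ℝ) : Prop :=
  ∀ v c : Finset ι, VitaliBounded (fun x : v → ℝ => f (glue v x (c.piecewise a b)))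
    (fun j : v => a j) (fun j : v => b j) V

/-- There are `2 ^ q` choices of `v` and at most `2 ^ q` of `c`. -/
theorem abs_face_sum_le {ι : Type*} [Fintype ι] [DecidableEq ι] {F : Finset ι → Finset ι → ℝ}
    {K : ℝ} (hF : ∀ v, ∀ c ⊆ vᶜ, |F v c| ≤ K) :
    |∑ v : Finset ι, (-1 : ℝ) ^ v.card * ∑ c ∈ vᶜ.powerset, (-1 : ℝ) ^ c.card * F v c|
      ≤ 4 ^ Fintype.card ι * K := by
  have hK : 0 ≤ K := (abs_nonneg _).trans (hF Finset.univ ∅ (by simp))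
  have h1 : ∀ v : Finset ι, |(-1 : ℝ) ^ v.card * ∑ c ∈ vᶜ.powerset, (-1 : ℝ) ^ c.card * F v c|
      ≤ 2 ^ Fintype.card ι * K := by
    intro v
    rw [abs_mul, abs_pow, abs_neg, abs_one, one_pow, one_mul]
    refine (Finset.abs_sum_le_sum_abs _ _).trans ((Finset.sum_le_card_nsmul _ _ K ?_).trans ?_)
    · intro c hc
      rw [abs_mul, abs_pow, abs_neg, abs_one, one_pow, one_mul]
      exact hF v c (Finset.mem_powerset.mp hc)
    · rw [nsmul_eq_mul]
      refine mul_le_mul_of_nonneg_right ?_ hK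
      rw [Finset.card_powerset]
      push_cast
      exact pow_le_pow_right₀ one_le_two (Finset.card_le_univ _)
  refine (Finset.abs_sum_le_sum_abs _ _).trans ((Finset.sum_le_card_nsmul _ _ _
    fun v _ => h1 v).trans_eq ?_)
  rw [Finset.card_univ, Fintype.card_finset, nsmul_eq_mul]
  push_cast
  rw [← mul_assoc, ← mul_pow]
  norm_num

theorem glue_mem_Icc {ι : Type*} [DecidableEq ι] {a b : ι → ℝ} (hab : a ≤ b) {v : Finset ι}
    (c : Finset ι) {x : v → ℝ} (hx : x ∈ Set.Icc (fun j : v => a j) (fun j : v => b j)) :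
    glue v x (c.piecewise a b) ∈ Set.Icc a b := by
  have := glue_mem (W := fun j => Set.Icc (a j) (b j)) (v := v) (x := x)
    (fun j => ⟨hx.1 j, hx.2 j⟩) (piecewise_mem c (W := fun j => Set.Icc (a j) (b j))
      (fun j => Set.left_mem_Icc.mpr (hab j)) fun j => Set.right_mem_Icc.mpr (hab j))
  exact ⟨fun j => (this j).1, fun j => (this j).2⟩

theorem ModulusLe.face {ι : Type*} [DecidableEq ι] {h : (ι → ℝ) → ℝ} {a b : ι → ℝ} {δ η : ℝ}
    (hh : ModulusLe h a b δ η) (hab : a ≤ b) (hδ : 0 ≤ δ) (v c : Finset ι) :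
    ModulusLe (fun x : v → ℝ => h (glue v x (c.piecewise a b))) (fun j : v => a j)
      (fun j : v => b j) δ η := by
  intro p hp q hq hpq
  refine hh _ (glue_mem_Icc hab c hp) _ (glue_mem_Icc hab c hq) fun j => ?_
  by_cases hj : j ∈ v
  · simpa [glue, hj] using hpq ⟨j, hj⟩
  · simpa [glue, hj] using hδ

theorem exists_hasPartsIntegral {ι : Type*} [Fintype ι] [DecidableEq ι] {f h : (ι → ℝ) → ℝ}
    {a b : ι → ℝ} {V : ℝ} (hab : a ≤ b) (hf : FaceBounded f a b V)
    (hc : ContinuousOn h (Set.Icc a b)) : ∃ I, HasPartsIntegral f h a b I := by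
  have : ∀ v c : Finset ι, ∃ J, HasRSIntegral (fun x : v → ℝ => h (glue v x (c.piecewise a b)))
      (fun x : v → ℝ => f (glue v x (c.piecewise a b))) (fun j => a j) (fun j => b j) J := by
    intro v c
    refine exists_hasRSIntegral (fun j => hab j) (hf v c) ?_
    refine hc.comp (Continuous.continuousOn ?_) fun x hx => glue_mem_Icc hab c hx
    refine continuous_pi fun j => ?_
    by_cases hj : j ∈ v
    · simpa [glue, hj] using continuous_apply _
    · simpa [glue, hj] using continuous_const
  choose J hJ using this
  exact ⟨_, J, fun v c _ => hJ v c, rfl⟩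

/-- After summation by parts, sum and integral are matched face by face, and
`HasRSIntegral.abs_sum_sub_le` applies on each. The error depends on `f` only through its variation
bound, hence is uniform over families of integrands. -/
theorem HasPartsIntegral.abs_sum_sub_le {ι : Type*} [Fintype ι] [DecidableEq ι]
    {f h : (ι → ℝ) → ℝ} {a b : ι → ℝ} {V δ η I : ℝ} (hI : HasPartsIntegral f h a b I)
    (hab : a ≤ b) (hf : FaceBounded f a b V) (hδ : 0 < δ) (hη : 0 ≤ η)
    (hmod : ModulusLe h a b δ η) {Y : ι → Finset ℝ} (hY : ∀ j, IsLadder (a j) (b j) (Y j))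
    (hm : ∀ j, ∀ y ∈ Y j, ladderSucc (b j) (Y j) y - y ≤ δ / 2) :
    |∑ y ∈ Fintype.piFinset Y, altSum h y (ladderSuccPi b Y y) * f (ladderSuccPi b Y y) - I|
      ≤ 4 ^ Fintype.card ι * (η * V) := by
  obtain ⟨J, hJ, rfl⟩ := hI
  rw [sum_altSum_mul hY, ← Finset.sum_sub_distrib]
  simp only [← mul_sub, ← Finset.sum_sub_distrib]
  refine abs_face_sum_le fun v c hc => ?_
  exact (hJ v c hc).abs_sum_sub_le (fun j => hab j) (hf v c) hδ hη (hmod.face hab hδ.le v c)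
    (fun j => hY j) fun j => hm j

/-- Summation by parts leaves only values of `x`, no increments; no regularity of `x` is needed.
This is the continuity of the sums in the integrator for the supremum norm. -/
theorem abs_sum_altSum_mul_le {ι : Type*} [Fintype ι] [DecidableEq ι]
    {f x : (ι → ℝ) → ℝ} {a b : ι → ℝ} {V M : ℝ} (hab : a ≤ b) (hf : FaceBounded f a b V)
    (hM : 0 ≤ M) (hx : ∀ z ∈ Set.Icc a b, |x z| ≤ M) {Y : ι → Finset ℝ}
    (hY : ∀ j, IsLadder (a j) (b j) (Y j)) :
    |∑ y ∈ Fintype.piFinset Y, altSum x y (ladderSuccPi b Y y) * f (ladderSuccPi b Y y)|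
      ≤ 4 ^ Fintype.card ι * (M * V) := by
  rw [sum_altSum_mul hY]
  refine abs_face_sum_le fun v c _ => ?_
  refine (Finset.abs_sum_le_sum_abs _ _).trans (le_trans ?_
    (mul_le_mul_of_nonneg_left (hf v c _ fun j => hY j) hM))
  rw [Finset.mul_sum]
  refine Finset.sum_le_sum fun y hy => ?_
  rw [abs_mul]
  refine mul_le_mul_of_nonneg_right (hx _ (glue_mem_Icc hab c ?_)) (abs_nonneg _)
  exact ⟨fun j => (hY j).left_le (Fintype.mem_piFinset.mp hy j),
    fun j => (hY j).le_right (hab j) (Fintype.mem_piFinset.mp hy j)⟩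

/-! ### Variation on the faces of a hyperrectangle -/

/-- The alternating sum over the corners of the face spanned by the coordinates in `v` between
`y` and `y'`, the other coordinates being those of `y`. -/
def faceAltSum {ι : Type*} [DecidableEq ι] (f : (ι → ℝ) → ℝ) (v : Finset ι) (y y' : ι → ℝ) : ℝ :=
  ∑ u ∈ v.powerset, (-1 : ℝ) ^ u.card * f (u.piecewise y (v.piecewise y' y))

theorem faceAltSum_congr_right {ι : Type*} [DecidableEq ι] (f : (ι → ℝ) → ℝ) {v : Finset ι}
    (y : ι → ℝ) {y' y'' : ι → ℝ} (h : ∀ j ∈ v, y' j = y'' j) :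
    faceAltSum f v y y' = faceAltSum f v y y'' := by
  have : v.piecewise y' y = v.piecewise y'' y := by
    ext j
    by_cases hj : j ∈ v
    · simp [hj, h j hj]
    · simp [hj]
  rw [faceAltSum, faceAltSum, this]

theorem faceAltSum_empty {ι : Type*} [DecidableEq ι] (f : (ι → ℝ) → ℝ) (y y' : ι → ℝ) :
    faceAltSum f ∅ y y' = f y := by
  simp [faceAltSum]

/-- The subsets of `insert i v` are the sets `t` and `insert i t` with `t ⊆ v`; the latter carry an
extra sign and have coordinate `i` at its lower value. -/
theorem faceAltSum_insert_aux {ι : Type*} [DecidableEq ι] (f : (ι → ℝ) → ℝ) {v : Finset ι} {i : ι}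
    (hi : i ∉ v) (y y' : ι → ℝ) :
    faceAltSum f (insert i v) y y' =
      ∑ t ∈ v.powerset, (-1 : ℝ) ^ t.card * f (t.piecewise y ((insert i v).piecewise y' y))
        - faceAltSum f v y y' := by
  rw [faceAltSum, Finset.sum_powerset_insert hi, sub_eq_add_neg]
  congr 1
  rw [faceAltSum, ← Finset.sum_neg_distrib]
  refine Finset.sum_congr rfl fun t ht => ?_
  have hit : i ∉ t := fun h => hi (Finset.mem_powerset.mp ht h)
  rw [Finset.card_insert_of_notMem hit, pow_succ, mul_neg_one, neg_mul]
  congr 3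
  ext j
  by_cases hj : j = i
  · subst hj
    simp [hi, hit]
  · by_cases hjt : j ∈ t <;> by_cases hjv : j ∈ v <;> simp [hj, hjt, hjv]

theorem faceAltSum_insert {ι : Type*} [DecidableEq ι] (f : (ι → ℝ) → ℝ) {v : Finset ι} {i : ι}
    (hi : i ∉ v) (y y' : ι → ℝ) :
    faceAltSum f (insert i v) y y' =
      faceAltSum f v (Function.update y i (y' i)) y' - faceAltSum f v y y' := by
  rw [faceAltSum_insert_aux f hi]
  congr 1
  refine Finset.sum_congr rfl fun t ht => ?_
  have hit : i ∉ t := fun h => hi (Finset.mem_powerset.mp ht h)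
  congr 2
  ext j
  by_cases hj : j = i
  · subst hj
    simp [hi, hit]
  · by_cases hjt : j ∈ t <;> by_cases hjv : j ∈ v <;> simp [hj, hjt, hjv]

/-- On every face of `[a, b]`, with the remaining coordinates fixed anywhere, the variation of `f`
in the sense of Vitali is at most `V`. -/
def FaceVariationLe {ι : Type*} [Fintype ι] [DecidableEq ι] (f : (ι → ℝ) → ℝ) (a b : ι → ℝ)
    (V : ℝ) : Prop :=
  ∀ (v : Finset ι) (Y : ι → Finset ℝ), (∀ j ∈ v, IsLadder (a j) (b j) (Y j)) →
    (∀ j ∉ v, ∃ z ∈ Set.Icc (a j) (b j), Y j = {z}) →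
    ∑ y ∈ Fintype.piFinset Y, |faceAltSum f v y (ladderSuccPi b Y y)| ≤ V

/-- Links alternating sums over functions on the subtype `v`, as in the definitions of integral and
variation, with sums over full points, for which induction on `v` is possible. -/
theorem altSum_glue {ι : Type*} [DecidableEq ι] (f : (ι → ℝ) → ℝ) (v : Finset ι)
    (x x' : v → ℝ) (z y' : ι → ℝ) (hy' : ∀ j : v, y' j = x' j) :
    altSum (fun t : v → ℝ => f (glue v t z)) x x' = faceAltSum f v (glue v x z) y' := by
  refine Finset.sum_nbij (fun u => u.map (Function.Embedding.subtype _)) ?_ ?_ ?_ ?_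
  · intro u _
    rw [Finset.mem_powerset]
    intro j hj
    obtain ⟨k, -, rfl⟩ := Finset.mem_map.mp hj
    exact k.2
  · exact (Finset.map_injective _).injOn
  · intro u hu
    refine ⟨u.subtype (· ∈ v), by simp, ?_⟩
    beta_reduce
    rw [Finset.subtype_map]
    exact Finset.filter_true_of_mem fun j hj =>
      Finset.mem_powerset.mp (Finset.mem_coe.mp hu) hj
  · intro u _
    rw [Finset.card_map]
    refine congrArg _ (congrArg f (funext fun j => ?_))
    by_cases hj : j ∈ v
    · by_cases hu : (⟨j, hj⟩ : v) ∈ u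
      · have : j ∈ u.map (Function.Embedding.subtype _) := Finset.mem_map.mpr ⟨_, hu, rfl⟩
        simp [glue, hj, hu]
      · simp [glue, hj, hu, hy' ⟨j, hj⟩]
    · simp [glue, hj]

/-- Sums over ladders on a face as sums over products of ladders in all coordinates. -/
theorem sum_face_eq {ι : Type*} [Fintype ι] [DecidableEq ι] (f : (ι → ℝ) → ℝ) (b z : ι → ℝ)
    (v : Finset ι) (Y : ι → Finset ℝ) (hY : ∀ j ∉ v, Y j = {z j}) :
    ∑ x ∈ Fintype.piFinset (fun j : v => Y j),
        |altSum (fun t : v → ℝ => f (glue v t z)) x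
          (ladderSuccPi (fun j : v => b j) (fun j : v => Y j) x)|
      = ∑ y ∈ Fintype.piFinset Y, |faceAltSum f v y (ladderSuccPi b Y y)| := by
  refine Finset.sum_nbij (fun x => glue v x z) ?_ ?_ ?_ ?_
  · intro x hx
    rw [Fintype.mem_piFinset] at hx ⊢
    intro j
    by_cases hj : j ∈ v
    · simpa [glue, hj] using hx ⟨j, hj⟩
    · simp [glue, hj, hY j hj]
  · intro x _ x' _ h
    ext j
    have := congrFun h j
    simpa [glue] using this
  · intro y hy
    rw [Finset.mem_coe, Fintype.mem_piFinset] at hy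
    refine ⟨fun j : v => y j, ?_, ?_⟩
    · rw [Finset.mem_coe, Fintype.mem_piFinset]
      exact fun j => hy j
    · ext j
      by_cases hj : j ∈ v
      · simp [glue, hj]
      · have := hy j
        rw [hY j hj, Finset.mem_singleton] at this
        simp [glue, hj, this]
  · intro x _
    rw [altSum_glue f v x _ z (ladderSuccPi b Y (glue v x z))]
    intro j
    simp [ladderSuccPi, glue]

theorem FaceVariationLe.faceBounded {ι : Type*} [Fintype ι] [DecidableEq ι] {f : (ι → ℝ) → ℝ}
    {a b : ι → ℝ} {V : ℝ} (hab : a ≤ b) (hf : FaceVariationLe f a b V) :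
    FaceBounded f a b V := by
  intro v c Y hY
  have h := sum_face_eq f b (c.piecewise a b) v
    (fun j => if h : j ∈ v then Y ⟨j, h⟩ else {c.piecewise a b j}) (fun j hj => by simp [hj])
  simp only [Finset.coe_mem, dite_true, Subtype.coe_eta] at h
  rw [h]
  refine hf v _ (fun j hj => ?_) fun j hj => ⟨c.piecewise a b j, ?_, by simp [hj]⟩
  · simpa [hj] using hY ⟨j, hj⟩
  · exact piecewise_mem c (W := fun j => Set.Icc (a j) (b j))
      (fun j => Set.left_mem_Icc.mpr (hab j)) (fun j => Set.right_mem_Icc.mpr (hab j)) j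

theorem FaceVariationLe.nonneg {ι : Type*} [Fintype ι] [DecidableEq ι] {f : (ι → ℝ) → ℝ}
    {a b : ι → ℝ} {V : ℝ} (hab : a ≤ b) (hf : FaceVariationLe f a b V) : 0 ≤ V :=
  (Finset.sum_nonneg fun _ _ => abs_nonneg _).trans
    (hf ∅ (fun j => {a j}) (by simp) fun j _ => ⟨a j, Set.left_mem_Icc.mpr (hab j), rfl⟩)

theorem FaceVariationLe.mono {ι : Type*} [Fintype ι] [DecidableEq ι] {f : (ι → ℝ) → ℝ}
    {a b : ι → ℝ} {V V' : ℝ} (hf : FaceVariationLe f a b V) (h : V ≤ V') :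
    FaceVariationLe f a b V' :=
  fun v Y h1 h2 => (hf v Y h1 h2).trans h

theorem faceAltSum_mul_coord_of_notMem {ι : Type*} [DecidableEq ι] (f : (ι → ℝ) → ℝ)
    (k : ℝ → ℝ) {v : Finset ι} {i : ι} (hi : i ∉ v) (y y' : ι → ℝ) :
    faceAltSum (fun z => k (z i) * f z) v y y' = k (y i) * faceAltSum f v y y' := by
  rw [faceAltSum, faceAltSum, Finset.mul_sum]
  refine Finset.sum_congr rfl fun u hu => ?_
  have hiu : i ∉ u := fun h => hi (Finset.mem_powerset.mp hu h)
  simp only [Finset.piecewise_eq_of_notMem _ _ _ hi, Finset.piecewise_eq_of_notMem _ _ _ hiu]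
  ring

/-- Leibniz rule in coordinate `i`; the factor `k` is constant for the differences in the other
coordinates. -/
theorem faceAltSum_mul_coord_insert {ι : Type*} [DecidableEq ι] (f : (ι → ℝ) → ℝ)
    (k : ℝ → ℝ) {v : Finset ι} {i : ι} (hi : i ∉ v) (y y' : ι → ℝ) :
    faceAltSum (fun z => k (z i) * f z) (insert i v) y y' =
      k (y' i) * faceAltSum f (insert i v) y y' + (k (y' i) - k (y i)) * faceAltSum f v y y' := by
  rw [faceAltSum_insert _ hi, faceAltSum_insert _ hi, faceAltSum_mul_coord_of_notMem f k hi,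
    faceAltSum_mul_coord_of_notMem f k hi, Function.update_self]
  ring

theorem sum_piFinset_split {ι : Type*} [Fintype ι] [DecidableEq ι] (Y : ι → Finset ℝ) (i : ι)
    (F : (ι → ℝ) → ℝ) :
    ∑ y ∈ Fintype.piFinset Y, F y
      = ∑ c ∈ Y i, ∑ y ∈ Fintype.piFinset (Function.update Y i {c}), F y := by
  rw [← Finset.sum_fiberwise_of_maps_to (g := fun y => y i) (t := Y i)
    fun y hy => Fintype.mem_piFinset.mp hy i]
  refine Finset.sum_congr rfl fun c hc => Finset.sum_congr ?_ fun _ _ => rfl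
  rw [Fintype.piFinset_update_singleton_eq_filter_piFinset_eq _ _ hc]

/-- Multiplication by a bounded Lipschitz function of one coordinate. -/
theorem FaceVariationLe.mul_coord {ι : Type*} [Fintype ι] [DecidableEq ι] {f : (ι → ℝ) → ℝ}
    {a b : ι → ℝ} {V K L : ℝ} (hab : a ≤ b) (hf : FaceVariationLe f a b V) (i : ι)
    (k : ℝ → ℝ) (hK : ∀ t, |k t| ≤ K) (hL : ∀ s t, |k s - k t| ≤ L * |s - t|) :
    FaceVariationLe (fun z => k (z i) * f z) a b ((K + L * (b i - a i)) * V) := by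
  have hV := hf.nonneg hab
  have hK0 : 0 ≤ K := (abs_nonneg _).trans (hK 0)
  have hL0 : 0 ≤ L := by simpa using (abs_nonneg _).trans (hL 1 0)
  intro v Y hYv hY
  by_cases hi : i ∈ v
  · obtain ⟨v', hiv', rfl⟩ : ∃ v', i ∉ v' ∧ insert i v' = v :=
      ⟨v.erase i, Finset.notMem_erase i v, Finset.insert_erase hi⟩
    have h1 : ∑ y ∈ Fintype.piFinset Y, |k (ladderSuccPi b Y y i) *
        faceAltSum f (insert i v') y (ladderSuccPi b Y y)| ≤ K * V := by
      refine le_trans (Finset.sum_le_sum fun y _ => ?_)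
        ((Finset.mul_sum _ _ K).symm.le.trans (mul_le_mul_of_nonneg_left (hf _ Y hYv hY) hK0))
      rw [abs_mul]
      exact mul_le_mul_of_nonneg_right (hK _) (abs_nonneg _)
    -- Sum over the fibres `y i = c`: each costs `L` times the length of the cell at `c`, and these
    -- lengths add up to `b i - a i`.
    have h2 : ∑ y ∈ Fintype.piFinset Y, |(k (ladderSuccPi b Y y i) - k (y i)) *
        faceAltSum f v' y (ladderSuccPi b Y y)| ≤ L * (b i - a i) * V := by
      rw [sum_piFinset_split Y i]
      have hYi := hYv i (Finset.mem_insert_self i v')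
      rw [← hYi.sum_sub fun t => t, Finset.mul_sum, Finset.sum_mul]
      refine Finset.sum_le_sum fun c hc => ?_
      have hcIcc : c ∈ Set.Icc (a i) (b i) := ⟨hYi.left_le hc, hYi.le_right (hab i) hc⟩
      have hle := hYi.le_succ (hab i) hc
      -- Here coordinate `i` is frozen at an arbitrary ladder point `c`; this is why
      -- `FaceVariationLe` lets the frozen coordinates lie anywhere and not only at the ends.
      have hf' := hf v' (Function.update Y i {c}) (fun j hj => by
        have hji : j ≠ i := fun h => hiv' (h ▸ hj)
        rw [Function.update_of_ne hji]
        exact hYv j (Finset.mem_insert_of_mem hj)) (fun j hj => by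
        by_cases hji : j = i
        · subst hji
          exact ⟨c, hcIcc, by simp⟩
        · rw [Function.update_of_ne hji]
          exact hY j (by simp [hji, hj]))
      refine le_trans ?_ (mul_le_mul_of_nonneg_left hf' (mul_nonneg hL0 (sub_nonneg.mpr hle)))
      rw [Finset.mul_sum]
      refine Finset.sum_le_sum fun y hy => ?_
      have hyc : y i = c := by simpa using Fintype.mem_piFinset.mp hy i
      rw [abs_mul, faceAltSum_congr_right f y (y'' := ladderSuccPi b (Function.update Y i {c}) y)]
      · refine mul_le_mul_of_nonneg_right ?_ (abs_nonneg _)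
        have := hL (ladderSucc (b i) (Y i) c) c
        rw [abs_of_nonneg (sub_nonneg.mpr hle)] at this
        simpa only [ladderSuccPi, hyc] using this
      · intro j hj
        have hji : j ≠ i := fun h => hiv' (h ▸ hj)
        simp [ladderSuccPi, hji]
    simp only [faceAltSum_mul_coord_insert f k hiv']
    refine (Finset.sum_le_sum fun y _ => abs_add_le _ _).trans ?_
    rw [Finset.sum_add_distrib, add_mul]
    exact add_le_add h1 h2
  · refine le_trans (Finset.sum_le_sum fun y _ => ?_)
      ((Finset.mul_sum _ _ K).symm.le.trans ((mul_le_mul_of_nonneg_left (hf v Y hYv hY) hK0).trans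
        (mul_le_mul_of_nonneg_right
          (le_add_of_nonneg_right (mul_nonneg hL0 (sub_nonneg.mpr (hab i)))) hV)))
    rw [faceAltSum_mul_coord_of_notMem f k hi, abs_mul]
    exact mul_le_mul_of_nonneg_right (hK _) (abs_nonneg _)

/-! ### The reconstruction kernel -/

/-- This form needs no separate case at `t = 0`; boundedness and the Lipschitz property of the
kernel are inherited from the cosine. -/
theorem kernel₁_eq_integral (Om t : ℝ) :
    kernel₁ Om t = Om / Real.pi * ∫ u in (0 : ℝ)..1, Real.cos (Om * t * u) := by
  rw [kernel₁]
  split_ifs with ht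
  · simp [ht]
  · by_cases hO : Om = 0
    · simp [hO]
    · have hc : Om * t ≠ 0 := mul_ne_zero hO ht
      rw [intervalIntegral.integral_comp_mul_left (fun x => Real.cos x) hc, integral_cos]
      simp only [mul_zero, mul_one, Real.sin_zero, sub_zero, smul_eq_mul]
      have := Real.pi_ne_zero
      field_simp

theorem abs_kernel₁_le {Om : ℝ} (hOm : 0 < Om) (t : ℝ) : |kernel₁ Om t| ≤ Om / Real.pi := by
  have hpos : 0 < Om / Real.pi := div_pos hOm Real.pi_pos
  rw [kernel₁_eq_integral, abs_mul, abs_of_pos hpos]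
  refine mul_le_of_le_one_right hpos.le ?_
  have := intervalIntegral.norm_integral_le_of_norm_le_const (a := 0) (b := 1) (C := 1)
    (f := fun u => Real.cos (Om * t * u)) fun u _ => Real.abs_cos_le_one _
  simpa using this

theorem abs_kernel₁_sub_le {Om : ℝ} (hOm : 0 < Om) (s t : ℝ) :
    |kernel₁ Om s - kernel₁ Om t| ≤ Om / Real.pi * Om * |s - t| := by
  have hpos : 0 < Om / Real.pi := div_pos hOm Real.pi_pos
  rw [kernel₁_eq_integral, kernel₁_eq_integral, ← mul_sub, abs_mul, abs_of_pos hpos, mul_assoc]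
  refine mul_le_mul_of_nonneg_left ?_ hpos.le
  rw [← intervalIntegral.integral_sub]
  · have := intervalIntegral.norm_integral_le_of_norm_le_const (a := 0) (b := 1)
      (C := Om * |s - t|)
      (f := fun u => Real.cos (Om * s * u) - Real.cos (Om * t * u)) fun u hu => ?_
    · simpa using this
    · rw [Set.uIoc_of_le zero_le_one] at hu
      have h := Real.abs_cos_sub_cos_le (Om * s * u) (Om * t * u)
      have e : Om * s * u - Om * t * u = Om * (s - t) * u := by ring
      rw [e, abs_mul, abs_mul, abs_of_pos hOm, abs_of_pos hu.1] at h
      exact h.trans (mul_le_of_le_one_right (by positivity) hu.2)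
  · exact (Continuous.intervalIntegrable (by fun_prop) _ _)
  · exact (Continuous.intervalIntegrable (by fun_prop) _ _)

theorem continuous_kernel₁ {Om : ℝ} (hOm : 0 < Om) : Continuous (kernel₁ Om) := by
  have hpos : 0 ≤ Om / Real.pi * Om := by have := Real.pi_pos; positivity
  refine (LipschitzWith.of_dist_le_mul (K := ⟨_, hpos⟩) fun s t => ?_).continuous
  exact abs_kernel₁_sub_le hOm s t

/-! ### Variation of the weight function -/

theorem sum_piFinset_fin_two {α : Type*} [DecidableEq α] (Y : Fin 2 → Finset α)
    (F : (Fin 2 → α) → ℝ) :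
    ∑ y ∈ Fintype.piFinset Y, F y = ∑ c₀ ∈ Y 0, ∑ c₁ ∈ Y 1, F ![c₀, c₁] := by
  rw [← Finset.sum_product']
  refine Finset.sum_nbij' (fun y => (y 0, y 1)) (fun c => ![c.1, c.2]) ?_ ?_ ?_ ?_ ?_
  · intro y hy
    rw [Fintype.mem_piFinset] at hy
    exact Finset.mem_product.mpr ⟨hy 0, hy 1⟩
  · intro c hc
    rw [Finset.mem_product] at hc
    rw [Fintype.mem_piFinset, Fin.forall_fin_two]
    exact hc
  · intro y _
    ext j
    fin_cases j <;> rfl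
  · intro c _
    rfl
  · intro y _
    congr 1
    ext j
    fin_cases j <;> rfl

theorem sum_piFinset_fin_three {α : Type*} [DecidableEq α] (Y : Fin 3 → Finset α)
    (F : (Fin 3 → α) → ℝ) :
    ∑ y ∈ Fintype.piFinset Y, F y
      = ∑ c₀ ∈ Y 0, ∑ c₁ ∈ Y 1, ∑ c₂ ∈ Y 2, F ![c₀, c₁, c₂] := by
  simp only [← Finset.sum_product']
  refine Finset.sum_nbij' (fun y => (y 0, y 1, y 2)) (fun c => ![c.1, c.2.1, c.2.2])
    ?_ ?_ ?_ ?_ ?_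
  · intro y hy
    rw [Fintype.mem_piFinset] at hy
    exact Finset.mem_product.mpr ⟨hy 0, Finset.mem_product.mpr ⟨hy 1, hy 2⟩⟩
  · intro c hc
    rw [Finset.mem_product, Finset.mem_product] at hc
    rw [Fintype.mem_piFinset]
    intro j
    fin_cases j
    exacts [hc.1, hc.2.1, hc.2.2]
  · intro y _
    ext j
    fin_cases j <;> rfl
  · intro c _
    rfl
  · intro y _
    congr 1
    ext j
    fin_cases j <;> rfl

theorem faceAltSum_singleton {ι : Type*} [DecidableEq ι] (f : (ι → ℝ) → ℝ) (i : ι)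
    (y y' : ι → ℝ) : faceAltSum f {i} y y' = f (Function.update y i (y' i)) - f y := by
  rw [← insert_empty_eq, faceAltSum_insert _ (Finset.notMem_empty i), faceAltSum_empty,
    faceAltSum_empty]

/-- The Hardy-Krause variation contains only the faces through the upper corner `b`, hence the
frozen coordinates `{b j}`. Each of these faces is one nonnegative term of the defining sum. -/
theorem face_sum_le_of_hardyKrauseVariation_le {ι : Type*} [Fintype ι] [DecidableEq ι]
    {f : (ι → ℝ) → ℝ} {a b : ι → ℝ} {V : ℝ} (hV : 0 ≤ V)
    (hf : hardyKrauseVariation f a b ≤ ENNReal.ofReal V) {v : Finset ι} (hv : v ≠ ∅)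
    {Y : ι → Finset ℝ} (hYv : ∀ j ∈ v, IsLadder (a j) (b j) (Y j)) (hY : ∀ j ∉ v, Y j = {b j}) :
    ∑ y ∈ Fintype.piFinset Y, |faceAltSum f v y (ladderSuccPi b Y y)| ≤ V := by
  rw [← sum_face_eq f b b v Y hY, ← ENNReal.ofReal_le_ofReal_iff hV,
    ENNReal.ofReal_sum_of_nonneg fun _ _ => abs_nonneg _]
  refine le_trans ?_ hf
  refine le_trans ?_ (Finset.single_le_sum
    (f := fun u : Finset ι => vitaliVariation (fun x : u → ℝ => f (glue u x b)) (fun j => a j)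
      (fun j => b j)) (fun _ _ => zero_le) (Finset.mem_erase.mpr ⟨hv, Finset.mem_univ v⟩))
  exact le_iSup₂_of_le (fun j : v => Y j) (fun j => hYv j j.2) le_rfl

/-- The image of a ladder under a dilation, completed to a ladder of a larger interval. -/
theorem IsLadder.exists_dilate {B b θ : ℝ} {Y : Finset ℝ} (hY : IsLadder 0 B Y) (hB0 : 0 < B)
    (hθ : 0 < θ) (hb : θ * B ≤ b) : ∃ Y', IsLadder 0 b Y' ∧
      ∀ G : ℝ → ℝ → ℝ, (∀ s t, 0 ≤ G s t) →
        ∑ y ∈ Y, G (θ * y) (θ * ladderSucc B Y y) ≤ ∑ y ∈ Y', G y (ladderSucc b Y' y) := by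
  have hinj : Function.Injective fun y : ℝ => θ * y := mul_right_injective₀ hθ.ne'
  have hB := hB0.le
  -- Once successors match, the dilated cells are among those of `Y'`, and additional cells only
  -- increase a sum of nonnegative terms.
  have main : ∀ Y', (∀ y ∈ Y, θ * y ∈ Y') →
      (∀ y ∈ Y, ladderSucc b Y' (θ * y) = θ * ladderSucc B Y y) →
      ∀ G : ℝ → ℝ → ℝ, (∀ s t, 0 ≤ G s t) →
        ∑ y ∈ Y, G (θ * y) (θ * ladderSucc B Y y) ≤ ∑ y ∈ Y', G y (ladderSucc b Y' y) := by
    intro Y' hsub hsucc G hG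
    refine le_trans (le_of_eq ?_) (Finset.sum_le_sum_of_subset_of_nonneg
      (s := Y.image fun y => θ * y) ?_ fun _ _ _ => hG _ _)
    · rw [Finset.sum_image fun _ _ _ _ h => hinj h]
      exact Finset.sum_congr rfl fun y hy => by rw [hsucc y hy]
    · exact Finset.image_subset_iff.mpr hsub
  -- If `θ * B < b`, the point `θ * B` has to be added so that the last dilated cell ends there. If
  -- `θ * B = b`, it must not be added, as a ladder does not contain an upper end point distinct
  -- from the lower one.
  rcases hb.eq_or_lt with hb | hb
  · refine ⟨Y.image fun y => θ * y, ⟨?_, ?_⟩, main _ (fun y hy => Finset.mem_image_of_mem _ hy) ?_⟩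
    · exact Finset.mem_image.mpr ⟨0, hY.1, mul_zero _⟩
    · intro z hz
      obtain ⟨y, hy, rfl⟩ := Finset.mem_image.mp hz
      rcases hY.2 y hy with h | h
      · left; simp [h]
      · right
        exact ⟨mul_pos hθ h.1, hb ▸ mul_lt_mul_of_pos_left h.2 hθ⟩
    · intro y _
      rcases ladderSucc_cases B Y y with h | h
      · refine ladderSucc_eq (Finset.mem_image_of_mem _ h.1)
          (mul_lt_mul_of_pos_left h.2.1 hθ) fun w hw hlt => ?_
        obtain ⟨w', hw', rfl⟩ := Finset.mem_image.mp hw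
        exact mul_le_mul_of_nonneg_left (h.2.2 w' hw' (lt_of_mul_lt_mul_left hlt hθ.le)) hθ.le
      · rw [h.1, hb]
        refine ladderSucc_eq_right fun w hw => ?_
        obtain ⟨w', hw', rfl⟩ := Finset.mem_image.mp hw
        exact mul_le_mul_of_nonneg_left (h.2 w' hw') hθ.le
  · refine ⟨insert (θ * B) (Y.image fun y => θ * y), ⟨?_, ?_⟩, main _ (fun y hy =>
      Finset.mem_insert_of_mem (Finset.mem_image_of_mem _ hy)) ?_⟩
    · exact Finset.mem_insert_of_mem (Finset.mem_image.mpr ⟨0, hY.1, mul_zero _⟩)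
    · intro z hz
      rcases Finset.mem_insert.mp hz with rfl | hz
      · right
        exact ⟨mul_pos hθ hB0, hb⟩
      obtain ⟨y, hy, rfl⟩ := Finset.mem_image.mp hz
      rcases hY.2 y hy with h | h
      · left; simp [h]
      · right
        exact ⟨mul_pos hθ h.1, (mul_lt_mul_of_pos_left h.2 hθ).trans hb⟩
    · intro y hy
      have hyB : y < B := by
        rcases hY.2 y hy with h | h
        · rwa [h]
        · exact h.2
      rcases ladderSucc_cases B Y y with h | h
      · refine ladderSucc_eq (Finset.mem_insert_of_mem (Finset.mem_image_of_mem _ h.1))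
          (mul_lt_mul_of_pos_left h.2.1 hθ) fun w hw hlt => ?_
        rcases Finset.mem_insert.mp hw with rfl | hw
        · exact mul_le_mul_of_nonneg_left (hY.succ_le hB y) hθ.le
        obtain ⟨w', hw', rfl⟩ := Finset.mem_image.mp hw
        exact mul_le_mul_of_nonneg_left (h.2.2 w' hw' (lt_of_mul_lt_mul_left hlt hθ.le)) hθ.le
      · rw [h.1]
        refine ladderSucc_eq (Finset.mem_insert_self _ _) (mul_lt_mul_of_pos_left hyB hθ)
          fun w hw hlt => ?_
        rcases Finset.mem_insert.mp hw with rfl | hw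
        · exact le_rfl
        obtain ⟨w', hw', rfl⟩ := Finset.mem_image.mp hw
        exact absurd (h.2 w' hw') (not_le.mpr (lt_of_mul_lt_mul_left hlt hθ.le))

section
variable {g : ℝ → ℝ → ℝ} {b₁ b₂ V : ℝ}

theorem weight_sum₂_le (hV : 0 ≤ V)
    (hg : hardyKrauseVariation (fun z : Fin 2 → ℝ => g (z 0) (z 1)) 0 ![b₁, b₂]
      ≤ ENNReal.ofReal V) {Y₁ Y₂ : Finset ℝ} (h₁ : IsLadder 0 b₁ Y₁) (h₂ : IsLadder 0 b₂ Y₂) :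
    ∑ y ∈ Y₁, ∑ z ∈ Y₂, |(g (ladderSucc b₁ Y₁ y) (ladderSucc b₂ Y₂ z) -
      g y (ladderSucc b₂ Y₂ z)) - (g (ladderSucc b₁ Y₁ y) z - g y z)| ≤ V := by
  have h := face_sum_le_of_hardyKrauseVariation_le hV hg (v := {1, 0}) (by simp)
    (Y := ![Y₁, Y₂]) (fun j _ => by fin_cases j; exacts [h₁, h₂])
    (fun j hj => by fin_cases j <;> simp at hj)
  rw [sum_piFinset_fin_two] at h
  refine le_trans (le_of_eq ?_) h
  refine Finset.sum_congr rfl fun y _ => Finset.sum_congr rfl fun z _ => ?_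
  rw [faceAltSum_insert _ (by simp), faceAltSum_singleton, faceAltSum_singleton]
  simp [ladderSuccPi, Function.update]

/-- The section at `c` differs from the section at the upper end `b₂` by second differences, whose
sum is part of the two-dimensional Vitali variation. Each of the two contributes at most `V`. -/
theorem weight_sum_fst_le (hV : 0 ≤ V)
    (hg : hardyKrauseVariation (fun z : Fin 2 → ℝ => g (z 0) (z 1)) 0 ![b₁, b₂]
      ≤ ENNReal.ofReal V) {Y : Finset ℝ} (h : IsLadder 0 b₁ Y) {c : ℝ} (hc : c ∈ Set.Icc 0 b₂) :
    ∑ y ∈ Y, |g (ladderSucc b₁ Y y) c - g y c| ≤ 2 * V := by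
  have h1 : ∑ y ∈ Y, |g (ladderSucc b₁ Y y) b₂ - g y b₂| ≤ V := by
    have h := face_sum_le_of_hardyKrauseVariation_le hV hg (v := {0}) (by simp)
      (Y := ![Y, {b₂}]) (fun j hj => by fin_cases j; exacts [h, by simp at hj])
      (fun j hj => by fin_cases j; exacts [by simp at hj, rfl])
    rw [sum_piFinset_fin_two] at h
    refine le_trans (le_of_eq ?_) h
    refine Finset.sum_congr rfl fun y _ => ?_
    simp [faceAltSum_singleton, ladderSuccPi, Function.update]
  rcases hc.2.eq_or_lt with rfl | hcb
  · linarith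
  -- Its last cell is `[c, b₂]`, over which the second differences are taken.
  have hL : IsLadder 0 b₂ {0, c} := by
    refine ⟨by simp, fun y hy => ?_⟩
    rcases Finset.mem_insert.mp hy with rfl | hy
    · exact Or.inl rfl
    · rw [Finset.mem_singleton] at hy
      subst hy
      rcases hc.1.eq_or_lt with h0 | h0
      · exact Or.inl h0.symm
      · exact Or.inr ⟨h0, hcb⟩
  have hs : ladderSucc b₂ {0, c} c = b₂ := ladderSucc_eq_right fun w hw => by
    rcases Finset.mem_insert.mp hw with rfl | hw
    · exact hc.1
    · exact (Finset.mem_singleton.mp hw).le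
  have h2 : ∑ y ∈ Y, |(g (ladderSucc b₁ Y y) b₂ - g y b₂) - (g (ladderSucc b₁ Y y) c - g y c)|
      ≤ V := by
    refine le_trans (Finset.sum_le_sum fun y _ => ?_) (weight_sum₂_le hV hg h hL)
    have := Finset.single_le_sum (s := {0, c})
      (f := fun z => |(g (ladderSucc b₁ Y y) (ladderSucc b₂ {0, c} z) -
        g y (ladderSucc b₂ {0, c} z)) - (g (ladderSucc b₁ Y y) z - g y z)|)
      (fun _ _ => abs_nonneg _) (a := c) (by simp)
    simpa only [hs] using this
  have h3 : ∀ y ∈ Y, |g (ladderSucc b₁ Y y) c - g y c| ≤ |g (ladderSucc b₁ Y y) b₂ - g y b₂| +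
      |(g (ladderSucc b₁ Y y) b₂ - g y b₂) - (g (ladderSucc b₁ Y y) c - g y c)| := by
    intro y _
    have := abs_sub (g (ladderSucc b₁ Y y) b₂ - g y b₂)
      ((g (ladderSucc b₁ Y y) b₂ - g y b₂) - (g (ladderSucc b₁ Y y) c - g y c))
    simpa only [sub_sub_cancel] using this
  refine (Finset.sum_le_sum h3).trans ?_
  rw [Finset.sum_add_distrib]
  linarith

theorem weight_sum_snd_le (hV : 0 ≤ V)
    (hg : hardyKrauseVariation (fun z : Fin 2 → ℝ => g (z 0) (z 1)) 0 ![b₁, b₂]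
      ≤ ENNReal.ofReal V) {Y : Finset ℝ} (h : IsLadder 0 b₂ Y) {c : ℝ} (hc : c ∈ Set.Icc 0 b₁) :
    ∑ y ∈ Y, |g c (ladderSucc b₂ Y y) - g c y| ≤ 2 * V := by
  have h1 : ∑ y ∈ Y, |g b₁ (ladderSucc b₂ Y y) - g b₁ y| ≤ V := by
    have h := face_sum_le_of_hardyKrauseVariation_le hV hg (v := {1}) (by simp)
      (Y := ![{b₁}, Y]) (fun j hj => by fin_cases j; exacts [by simp at hj, h])
      (fun j hj => by fin_cases j; exacts [rfl, by simp at hj])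
    rw [sum_piFinset_fin_two] at h
    refine le_trans (le_of_eq ?_) h
    rw [Finset.sum_comm]
    refine Finset.sum_congr rfl fun y _ => ?_
    simp [faceAltSum_singleton, ladderSuccPi, Function.update]
  rcases hc.2.eq_or_lt with rfl | hcb
  · linarith
  have hL : IsLadder 0 b₁ {0, c} := by
    refine ⟨by simp, fun y hy => ?_⟩
    rcases Finset.mem_insert.mp hy with rfl | hy
    · exact Or.inl rfl
    · rw [Finset.mem_singleton] at hy
      subst hy
      rcases hc.1.eq_or_lt with h0 | h0
      · exact Or.inl h0.symm
      · exact Or.inr ⟨h0, hcb⟩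
  have hs : ladderSucc b₁ {0, c} c = b₁ := ladderSucc_eq_right fun w hw => by
    rcases Finset.mem_insert.mp hw with rfl | hw
    · exact hc.1
    · exact (Finset.mem_singleton.mp hw).le
  have h2 : ∑ y ∈ Y, |(g b₁ (ladderSucc b₂ Y y) - g b₁ y) - (g c (ladderSucc b₂ Y y) - g c y)|
      ≤ V := by
    have h := weight_sum₂_le hV hg hL h
    rw [Finset.sum_comm] at h
    refine le_trans (Finset.sum_le_sum fun y _ => ?_) h
    have := Finset.single_le_sum (s := {0, c})
      (f := fun z => |(g (ladderSucc b₁ {0, c} z) (ladderSucc b₂ Y y) -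
        g z (ladderSucc b₂ Y y)) - (g (ladderSucc b₁ {0, c} z) y - g z y)|)
      (fun _ _ => abs_nonneg _) (a := c) (by simp)
    refine le_trans (le_of_eq ?_) this
    simp only [hs]
    congr 1
    ring
  have h3 : ∀ y ∈ Y, |g c (ladderSucc b₂ Y y) - g c y| ≤ |g b₁ (ladderSucc b₂ Y y) - g b₁ y| +
      |(g b₁ (ladderSucc b₂ Y y) - g b₁ y) - (g c (ladderSucc b₂ Y y) - g c y)| := by
    intro y _
    have := abs_sub (g b₁ (ladderSucc b₂ Y y) - g b₁ y)
      ((g b₁ (ladderSucc b₂ Y y) - g b₁ y) - (g c (ladderSucc b₂ Y y) - g c y))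
    simpa only [sub_sub_cancel] using this
  refine (Finset.sum_le_sum h3).trans ?_
  rw [Finset.sum_add_distrib]
  linarith

/-- The weight does not depend on coordinate `0`, so faces spanned in that direction contribute
nothing. Among the others the plane face gives `V`, an edge `2 * V` and a point `M`. Dilation by `θ`
is absorbed by `IsLadder.exists_dilate`. -/
theorem weight_faceVariationLe (hV : 0 ≤ V)
    (hg : hardyKrauseVariation (fun z : Fin 2 → ℝ => g (z 0) (z 1)) 0 ![b₁, b₂]
      ≤ ENNReal.ofReal V) {M : ℝ}
    (hM : ∀ s ∈ Set.Icc 0 b₁, ∀ t ∈ Set.Icc 0 b₂, |g s t| ≤ M) {θ B : Fin 3 → ℝ}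
    (hθ : ∀ j, 0 < θ j) (hB : ∀ j, 0 < B j) (hb₁ : θ 1 * B 1 ≤ b₁) (hb₂ : θ 2 * B 2 ≤ b₂) :
    FaceVariationLe (fun z : Fin 3 → ℝ => g (θ 1 * z 1) (θ 2 * z 2)) 0 B (2 * V + M) := by
  set F : (Fin 3 → ℝ) → ℝ := fun z => g (θ 1 * z 1) (θ 2 * z 2) with hF
  intro v Y hYv hY
  have hscale : ∀ j, ∀ z ∈ Set.Icc ((0 : Fin 3 → ℝ) j) (B j), ∀ b', θ j * B j ≤ b' →
      θ j * z ∈ Set.Icc 0 b' := fun j z hz b' hb' =>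
    ⟨mul_nonneg (hθ j).le hz.1, (mul_le_mul_of_nonneg_left hz.2 (hθ j).le).trans hb'⟩
  have hM0 : 0 ≤ M := (abs_nonneg _).trans (hM (θ 1 * 0)
    (hscale 1 0 ⟨le_rfl, (hB 1).le⟩ _ hb₁) (θ 2 * 0) (hscale 2 0 ⟨le_rfl, (hB 2).le⟩ _ hb₂))
  by_cases h0 : (0 : Fin 3) ∈ v
  · rw [Finset.sum_eq_zero]
    · positivity
    · intro y _
      rw [← Finset.insert_erase h0, faceAltSum_insert _ (Finset.notMem_erase _ _), abs_eq_zero,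
        sub_eq_zero, faceAltSum, faceAltSum]
      refine Finset.sum_congr rfl fun u _ => ?_
      simp [hF, Finset.piecewise, Function.update]
  obtain ⟨z₀, -, hY0⟩ := hY 0 h0
  rw [sum_piFinset_fin_three, hY0, Finset.sum_singleton]
  by_cases h1 : (1 : Fin 3) ∈ v <;> by_cases h2 : (2 : Fin 3) ∈ v
  · have hv : v = {2, 1} := by ext j; fin_cases j <;> simp [h0, h1, h2]
    obtain ⟨Y₁, hY₁, H₁⟩ := (hYv 1 h1).exists_dilate (hB 1) (hθ 1) hb₁
    obtain ⟨Y₂, hY₂, H₂⟩ := (hYv 2 h2).exists_dilate (hB 2) (hθ 2) hb₂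
    have hsum := weight_sum₂_le hV hg hY₁ hY₂
    have hout := H₁ (fun s s' => ∑ z ∈ Y₂, |(g s' (ladderSucc b₂ Y₂ z) -
      g s (ladderSucc b₂ Y₂ z)) - (g s' z - g s z)|)
      fun s t => Finset.sum_nonneg fun _ _ => abs_nonneg _
    refine le_trans (Finset.sum_le_sum fun c _ => ?_) (hout.trans (hsum.trans (by linarith)))
    refine le_trans (le_of_eq ?_) (H₂ (fun t t' => |(g (θ 1 * ladderSucc (B 1) (Y 1) c) t' -
      g (θ 1 * c) t') - (g (θ 1 * ladderSucc (B 1) (Y 1) c) t - g (θ 1 * c) t)|)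
      fun _ _ => abs_nonneg _)
    refine Finset.sum_congr rfl fun d _ => ?_
    rw [hv, faceAltSum_insert _ (by simp), faceAltSum_singleton, faceAltSum_singleton]
    simp [hF, ladderSuccPi, Function.update]
  · have hv : v = {1} := by ext j; fin_cases j <;> simp [h0, h1, h2]
    obtain ⟨Y₁, hY₁, H₁⟩ := (hYv 1 h1).exists_dilate (hB 1) (hθ 1) hb₁
    obtain ⟨z₂, hz₂, hY2⟩ := hY 2 h2
    have hsum := weight_sum_fst_le hV hg hY₁ (hscale 2 z₂ hz₂ _ hb₂)
    refine le_trans (le_of_eq ?_) ((H₁ (fun s s' => |g s' (θ 2 * z₂) - g s (θ 2 * z₂)|)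
      fun _ _ => abs_nonneg _).trans (hsum.trans (by linarith)))
    refine Finset.sum_congr rfl fun c _ => ?_
    rw [hY2, Finset.sum_singleton, hv, faceAltSum_singleton]
    simp [hF, ladderSuccPi, Function.update]
  · have hv : v = {2} := by ext j; fin_cases j <;> simp [h0, h1, h2]
    obtain ⟨Y₂, hY₂, H₂⟩ := (hYv 2 h2).exists_dilate (hB 2) (hθ 2) hb₂
    obtain ⟨z₁, hz₁, hY1⟩ := hY 1 h1
    have hsum := weight_sum_snd_le hV hg hY₂ (hscale 1 z₁ hz₁ _ hb₁)
    rw [hY1, Finset.sum_singleton]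
    refine le_trans (le_of_eq ?_) ((H₂ (fun s s' => |g (θ 1 * z₁) s' - g (θ 1 * z₁) s|)
      fun _ _ => abs_nonneg _).trans (hsum.trans (by linarith)))
    refine Finset.sum_congr rfl fun c _ => ?_
    rw [hv, faceAltSum_singleton]
    simp [hF, ladderSuccPi, Function.update]
  · have hv : v = ∅ := by ext j; fin_cases j <;> simp [h0, h1, h2]
    obtain ⟨z₁, hz₁, hY1⟩ := hY 1 h1
    obtain ⟨z₂, hz₂, hY2⟩ := hY 2 h2
    rw [hY1, Finset.sum_singleton, hY2, Finset.sum_singleton, hv, faceAltSum_empty]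
    exact (hM _ (hscale 1 z₁ hz₁ _ hb₁) _ (hscale 2 z₂ hz₂ _ hb₂)).trans (by linarith)

end

/-! ### Variation of the integrand -/

/-- The weight is multiplied by three kernels, each a function of one coordinate with Lipschitz
constant proportional to `θ j`. As `θ j * B j ≤ b j`, the bound is free of `θ` and `B`, which yields
all later uniformity. -/
theorem limitIntegrand_faceVariationLe {Om : Fin 3 → ℝ} (hOm : ∀ j, 0 < Om j)
    {w : ℝ → ℝ → ℝ → ℝ → ℝ} {b : Fin 3 → ℝ} {V M : ℝ} (hV : 0 ≤ V) {p : Fin 4 → ℝ}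
    (hw : hardyKrauseVariation (fun z : Fin 2 → ℝ => w (z 0) (z 1) (p 2) (p 3)) 0 ![b 1, b 2]
      ≤ ENNReal.ofReal V)
    (hM : ∀ s ∈ Set.Icc 0 (b 1), ∀ t ∈ Set.Icc 0 (b 2), |w s t (p 2) (p 3)| ≤ M)
    {θ B : Fin 3 → ℝ} (hθ : ∀ j, 0 < θ j) (hB : ∀ j, 0 < B j) (hb : ∀ j, θ j * B j ≤ b j) :
    FaceVariationLe (limitIntegrand Om θ w p) 0 B
      ((∏ j, (Om j / Real.pi + Om j / Real.pi * Om j * b j)) * (2 * V + M)) := by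
  have hpi := Real.pi_pos
  have hB' : (0 : Fin 3 → ℝ) ≤ B := fun j => (hB j).le
  have h := weight_faceVariationLe (g := fun s t => w s t (p 2) (p 3)) hV hw hM hθ hB (hb 1) (hb 2)
  have hk : ∀ (j : Fin 3) (f : (Fin 3 → ℝ) → ℝ) (W x : ℝ), FaceVariationLe f 0 B W →
      FaceVariationLe (fun z => kernel₁ (Om j) (x - θ j * z j) * f z) 0 B
        ((Om j / Real.pi + Om j / Real.pi * Om j * b j) * W) := by
    intro j f W x hf
    have hOj := hOm j
    have hW := hf.nonneg hB'
    refine (hf.mul_coord hB' j (fun t => kernel₁ (Om j) (x - θ j * t))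
      (K := Om j / Real.pi) (L := Om j / Real.pi * Om j * θ j) (fun t => abs_kernel₁_le hOj _)
      fun s t => ?_).mono (mul_le_mul_of_nonneg_right ?_ hW)
    · refine (abs_kernel₁_sub_le hOj _ _).trans_eq ?_
      rw [sub_sub_sub_cancel_left, ← mul_sub, abs_mul, abs_of_pos (hθ j), abs_sub_comm t s]
      ring
    · rw [Pi.zero_apply, sub_zero, mul_assoc _ (θ j)]
      have := mul_le_mul_of_nonneg_left (hb j)
        (mul_nonneg (div_nonneg hOj.le hpi.le) hOj.le)
      linarith
  have h' := hk 0 _ _ (p 1) (hk 1 _ _ (p 2) (hk 2 _ _ (p 3) h))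
  rw [Fin.prod_univ_three]
  convert h' using 1
  · ext z
    simp only [limitIntegrand, kernel₃]
    ring
  · ring

/-! ### Sums over equidistant grids -/

/-- The sum of the increments of `x` over the cells of the grid of mesh sizes `h` in the box
with upper corner `N * h`, weighted by the values of `f` at the upper corners. -/
def gridSum {ι : Type*} [Fintype ι] [DecidableEq ι] (x f : (ι → ℝ) → ℝ) (h : ι → ℝ)
    (N : ι → ℕ) : ℝ :=
  ∑ i ∈ Fintype.piFinset fun j => Finset.range (N j),
    altSum x (fun j => i j * h j) (fun j => (i j + 1 : ℕ) * h j) *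
      f (fun j => (i j + 1 : ℕ) * h j)

theorem gridSum_eq {ι : Type*} [Fintype ι] [DecidableEq ι] (x f : (ι → ℝ) → ℝ) {h : ι → ℝ}
    (N : ι → ℕ) (hh : ∀ j, 0 < h j) :
    gridSum x f h N = ∑ y ∈ Fintype.piFinset fun j => gridLadder 0 (h j) (N j),
      altSum x y (ladderSuccPi (fun j => N j * h j) (fun j => gridLadder 0 (h j) (N j)) y) *
        f (ladderSuccPi (fun j => N j * h j) (fun j => gridLadder 0 (h j) (N j)) y) := by
  refine Finset.sum_nbij (fun i j => i j * h j) ?_ ?_ ?_ ?_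
  · intro i hi
    rw [Fintype.mem_piFinset] at hi ⊢
    exact fun j => mem_gridLadder.mpr ⟨i j, Finset.mem_range.mp (hi j), zero_add _⟩
  · intro i _ i' _ hii
    ext j
    have := congrFun hii j
    exact_mod_cast mul_right_cancel₀ (hh j).ne' this
  · intro y hy
    rw [Finset.mem_coe, Fintype.mem_piFinset] at hy
    choose i hi hiy using fun j => mem_gridLadder.mp (hy j)
    refine ⟨i, ?_, ?_⟩
    · rw [Finset.mem_coe, Fintype.mem_piFinset]
      exact fun j => Finset.mem_range.mpr (hi j)
    · ext j
      rw [← hiy j, zero_add]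
  · intro i hi
    have hs : ladderSuccPi (fun j => N j * h j) (fun j => gridLadder 0 (h j) (N j))
        (fun j => i j * h j) = fun j => (i j + 1 : ℕ) * h j := by
      ext j
      have := ladderSucc_gridLadder (a := 0) (hh j).le
        (Finset.mem_range.mp (Fintype.mem_piFinset.mp hi j))
      simp only [zero_add] at this
      exact this
    rw [hs]

theorem isLadder_grid {h : ℝ} {N : ℕ} (hh : 0 < h) (hN : 0 < N) :
    IsLadder 0 (N * h) (gridLadder 0 h N) := by
  have := isLadder_gridLadder (a := 0) hh.le hN
  rwa [zero_add] at this

theorem gridSum_sub {ι : Type*} [Fintype ι] [DecidableEq ι] (x x' f : (ι → ℝ) → ℝ) (h : ι → ℝ)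
    (N : ι → ℕ) :
    gridSum (fun z => x z - x' z) f h N = gridSum x f h N - gridSum x' f h N := by
  simp only [gridSum, altSum_sub, sub_mul, Finset.sum_sub_distrib]

theorem abs_gridSum_le {ι : Type*} [Fintype ι] [DecidableEq ι] {x f : (ι → ℝ) → ℝ} {h B : ι → ℝ}
    {N : ι → ℕ} (hh : ∀ j, 0 < h j) (hN : ∀ j, 0 < N j) (hB : ∀ j, N j * h j = B j) {V M : ℝ}
    (hf : FaceVariationLe f 0 B V) (hM : 0 ≤ M) (hx : ∀ z ∈ Set.Icc 0 B, |x z| ≤ M) :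
    |gridSum x f h N| ≤ 4 ^ Fintype.card ι * (M * V) := by
  obtain rfl : (fun j => N j * h j) = B := funext hB
  have hb : (0 : ι → ℝ) ≤ fun j => N j * h j :=
    fun j => mul_nonneg (Nat.cast_nonneg _) (hh j).le
  rw [gridSum_eq x f N hh]
  exact abs_sum_altSum_mul_le hb (hf.faceBounded hb) hM hx fun j => isLadder_grid (hh j) (hN j)

theorem abs_gridSum_sub_le {ι : Type*} [Fintype ι] [DecidableEq ι] {x f : (ι → ℝ) → ℝ}
    {h B : ι → ℝ} {N : ι → ℕ} (hh : ∀ j, 0 < h j) (hN : ∀ j, 0 < N j)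
    (hB : ∀ j, N j * h j = B j) {V δ η I : ℝ}
    (hf : FaceVariationLe f 0 B V) (hI : HasPartsIntegral f x 0 B I) (hη : 0 ≤ η)
    (hδ : 0 < δ) (hx : ModulusLe x 0 B δ η) (hm : ∀ j, h j ≤ δ / 2) :
    |gridSum x f h N - I| ≤ 4 ^ Fintype.card ι * (η * V) := by
  obtain rfl : (fun j => N j * h j) = B := funext hB
  have hb : (0 : ι → ℝ) ≤ fun j => N j * h j :=
    fun j => mul_nonneg (Nat.cast_nonneg _) (hh j).le
  rw [gridSum_eq x f N hh]
  refine hI.abs_sum_sub_le hb (hf.faceBounded hb) hδ hη hx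
    (fun j => isLadder_grid (hh j) (hN j)) fun j y hy => ?_
  obtain ⟨i, hi, rfl⟩ := mem_gridLadder.mp hy
  have := ladderSucc_gridLadder (a := 0) (hh j).le hi
  simp only [zero_add] at this ⊢
  rw [this]
  have := hm j
  push_cast
  linarith

theorem ModulusLe.mono {ι : Type*} {h : (ι → ℝ) → ℝ} {a b b' : ι → ℝ} {δ η : ℝ}
    (hh : ModulusLe h a b δ η) (hb : b' ≤ b) : ModulusLe h a b' δ η :=
  fun p hp q hq => hh p ⟨hp.1, hp.2.trans hb⟩ q ⟨hq.1, hq.2.trans hb⟩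

/-! ### Convergence of the sums, uniformly in the parameters -/

theorem continuousOn_limitIntegrand {Om : Fin 3 → ℝ} (hOm : ∀ j, 0 < Om j)
    {w : ℝ → ℝ → ℝ → ℝ → ℝ} {b τbar : Fin 3 → ℝ}
    (hwc : ContinuousOn (fun p : ℝ × ℝ × ℝ × ℝ => w p.1 p.2.1 p.2.2.1 p.2.2.2)
      (Set.Icc 0 (b 1) ×ˢ Set.Icc 0 (b 2) ×ˢ Set.Icc 0 (τbar 1) ×ˢ Set.Icc 0 (τbar 2)))
    {X : Type*} [TopologicalSpace X] {s : Set X} {θ : X → Fin 3 → ℝ} {p : X → Fin 4 → ℝ}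
    {z : X → Fin 3 → ℝ} (hθ : Continuous θ) (hp : Continuous p) (hz : Continuous z)
    (hθz : ∀ x ∈ s, ∀ j, θ x j * z x j ∈ Set.Icc 0 (b j))
    (hp₂ : ∀ x ∈ s, p x 2 ∈ Set.Icc 0 (τbar 1)) (hp₃ : ∀ x ∈ s, p x 3 ∈ Set.Icc 0 (τbar 2)) :
    ContinuousOn (fun x => limitIntegrand Om (θ x) w (p x) (z x)) s := by
  unfold limitIntegrand kernel₃
  have h0 := continuous_kernel₁ (hOm 0)
  have h1 := continuous_kernel₁ (hOm 1)
  have h2 := continuous_kernel₁ (hOm 2)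
  refine ContinuousOn.mul (Continuous.continuousOn (by fun_prop)) ?_
  have hc : Continuous fun x => (θ x 1 * z x 1, θ x 2 * z x 2, p x 2, p x 3) := by fun_prop
  exact hwc.comp hc.continuousOn fun x hx => ⟨hθz x hx 1, hθz x hx 2, hp₂ x hx, hp₃ x hx⟩

/-- The number of cells is fixed and only the cell width `s / N` varies with the box, so no floor
function occurs and the sum is finite with jointly continuous terms. On the compact parameter set
this becomes uniform continuity. -/
theorem continuousOn_coarseSum {Om : Fin 3 → ℝ} (hOm : ∀ j, 0 < Om j)
    {w : ℝ → ℝ → ℝ → ℝ → ℝ} {b τbar : Fin 3 → ℝ} {s₀ : ℝ}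
    (hwc : ContinuousOn (fun p : ℝ × ℝ × ℝ × ℝ => w p.1 p.2.1 p.2.2.1 p.2.2.2)
      (Set.Icc 0 (b 1) ×ˢ Set.Icc 0 (b 2) ×ˢ Set.Icc 0 (τbar 1) ×ˢ Set.Icc 0 (τbar 2)))
    {β : (Fin 3 → ℝ) → ℝ} (hβ : ContinuousOn β (Set.Icc 0 1)) {N : ℕ} (hN : 0 < N) :
    ContinuousOn (fun q : ℝ × (Fin 3 → ℝ) × (Fin 4 → ℝ) =>
      gridSum β (limitIntegrand Om q.2.1 w q.2.2) ![q.1 / N, 1 / N, 1 / N] fun _ => N)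
      (Set.Icc 0 1 ×ˢ Set.Icc 0 b ×ˢ Set.Icc ![s₀, 0, 0, 0] ![1, τbar 0, τbar 1, τbar 2]) := by
  unfold gridSum
  have hN' : (0 : ℝ) < N := by exact_mod_cast hN
  have hcorner : ∀ k : Fin 3 → ℕ,
      Continuous fun q : ℝ × (Fin 3 → ℝ) × (Fin 4 → ℝ) =>
        (fun j => (k j : ℝ) * (![q.1 / N, 1 / N, 1 / N] : Fin 3 → ℝ) j) := by
    intro k
    refine continuous_pi fun j => ?_
    fin_cases j
    · exact continuous_const.mul (continuous_fst.div_const _)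
    · change Continuous fun _ => (k 1 : ℝ) * (1 / (N : ℝ))
      exact continuous_const
    · change Continuous fun _ => (k 2 : ℝ) * (1 / (N : ℝ))
      exact continuous_const
  have hmem : ∀ k : Fin 3 → ℕ, (∀ j, k j ≤ N) → ∀ s ∈ Set.Icc (0 : ℝ) 1, ∀ j,
      (k j : ℝ) * (![s / N, 1 / N, 1 / N] : Fin 3 → ℝ) j ∈ Set.Icc (0 : ℝ) 1 := by
    intro k hk s hs j
    have hkN : (k j : ℝ) ≤ N := by exact_mod_cast hk j
    have hk0 : (0 : ℝ) ≤ k j := Nat.cast_nonneg _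
    have h1 : (![s / N, 1 / N, 1 / N] : Fin 3 → ℝ) j ∈ Set.Icc 0 (1 / (N : ℝ)) := by
      fin_cases j
      · exact ⟨div_nonneg hs.1 hN'.le, div_le_div_of_nonneg_right hs.2 hN'.le⟩
      · exact ⟨by simp, le_rfl⟩
      · exact ⟨by simp, le_rfl⟩
    refine ⟨mul_nonneg hk0 h1.1, (mul_le_mul hkN h1.2 h1.1 hN'.le).trans_eq ?_⟩
    field_simp
  refine continuousOn_finsetSum _ fun i hi => ?_
  have hi' : ∀ j, i j + 1 ≤ N := fun j => Finset.mem_range.mp (Fintype.mem_piFinset.mp hi j)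
  refine ContinuousOn.mul ?_ ?_
  · unfold altSum
    refine continuousOn_finsetSum _ fun v _ => continuousOn_const.mul ?_
    have hpc : ∀ q : ℝ × (Fin 3 → ℝ) × (Fin 4 → ℝ),
        v.piecewise (fun j => (i j : ℝ) * (![q.1 / N, 1 / N, 1 / N] : Fin 3 → ℝ) j)
          (fun j => ((i j + 1 : ℕ) : ℝ) * (![q.1 / N, 1 / N, 1 / N] : Fin 3 → ℝ) j)
        = fun j => ((v.piecewise i (fun j => i j + 1) j : ℕ) : ℝ) *
            (![q.1 / N, 1 / N, 1 / N] : Fin 3 → ℝ) j := by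
      intro q
      ext j
      by_cases hj : j ∈ v <;> simp [hj]
    simp only [hpc]
    refine hβ.comp (hcorner _).continuousOn fun q hq => ?_
    have := hmem (v.piecewise i fun j => i j + 1) (fun j => by
      have := hi' j
      by_cases hj : j ∈ v
      · rw [Finset.piecewise_eq_of_mem _ _ _ hj]; omega
      · rw [Finset.piecewise_eq_of_notMem _ _ _ hj]; omega) q.1 hq.1
    exact ⟨fun j => (this j).1, fun j => (this j).2⟩
  · refine continuousOn_limitIntegrand (τbar := τbar) hOm hwc (by fun_prop) (by fun_prop)
      (hcorner fun j => i j + 1) ?_ ?_ ?_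
    · intro q hq j
      have h1 := hmem (fun j => i j + 1) hi' q.1 hq.1 j
      have h2 := hq.2.1.1 j
      exact ⟨mul_nonneg h2 h1.1, (mul_le_of_le_one_right h2 h1.2).trans (hq.2.1.2 j)⟩
    · intro q hq
      exact ⟨hq.2.2.1 2, hq.2.2.2 2⟩
    · intro q hq
      exact ⟨hq.2.2.1 3, hq.2.2.2 3⟩

theorem abs_floor_div_sub_le {m : ℕ} (hm : 0 < m) {s : ℝ} (hs : 0 ≤ s) :
    |(⌊m * s⌋₊ : ℝ) / m - s| ≤ 1 / m := by
  have hm' : (0 : ℝ) < m := by exact_mod_cast hm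
  have h1 := Nat.floor_le (mul_nonneg hm'.le hs)
  have h2 := Nat.lt_floor_add_one ((m : ℝ) * s)
  have e : (⌊m * s⌋₊ : ℝ) / m - s = ((⌊m * s⌋₊ : ℝ) - m * s) / m := by field_simp
  rw [e, abs_div, abs_of_pos hm']
  refine div_le_div_of_nonneg_right ?_ hm'.le
  rw [abs_le]
  constructor <;> linarith

/-- The weighted sums of increments of a continuous function converge to the integral defined
through integration by parts, uniformly in the parameters. -/
theorem gridSum_close {Om : Fin 3 → ℝ} (hOm : ∀ j, 0 < Om j)
    {w : ℝ → ℝ → ℝ → ℝ → ℝ} {b τbar : Fin 3 → ℝ} (hτbar : ∀ j, 0 < τbar j)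
    (hb : ∀ j, τbar j ≤ b j) {s₀ : ℝ} (hs₀ : 0 < s₀)
    (hwc : ContinuousOn (fun p : ℝ × ℝ × ℝ × ℝ => w p.1 p.2.1 p.2.2.1 p.2.2.2)
      (Set.Icc 0 (b 1) ×ˢ Set.Icc 0 (b 2) ×ˢ Set.Icc 0 (τbar 1) ×ˢ Set.Icc 0 (τbar 2)))
    {C : ℝ} (hC : 0 ≤ C)
    (hvar : ∀ p ∈ Set.Icc ![s₀, 0, 0, 0] ![1, τbar 0, τbar 1, τbar 2], ∀ θ B : Fin 3 → ℝ,
      (∀ j, 0 < θ j) → (∀ j, 0 < B j) → (∀ j, θ j * B j ≤ b j) →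
      FaceVariationLe (limitIntegrand Om θ w p) 0 B C)
    {β : (Fin 3 → ℝ) → ℝ} (hβ : ContinuousOn β (Set.Icc 0 1)) {ε : ℝ} (hε : 0 < ε) :
    ∃ δ > (0 : ℝ), ∀ n : Fin 3 → ℕ, (∀ j, 1 ≤ δ * n j) → ∀ θ : Fin 3 → ℝ, (∀ j, 0 < θ j) →
      (∀ j, θ j ≤ b j) → (∀ j, |θ j - τbar j| ≤ δ) →
      ∀ p ∈ Set.Icc ![s₀, 0, 0, 0] ![1, τbar 0, τbar 1, τbar 2], ∀ I,
        HasPartsIntegral (limitIntegrand Om τbar w p) β 0 ![p 0, 1, 1] I →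
        |gridSum β (limitIntegrand Om θ w p) (fun j => 1 / n j) ![⌊n 0 * p 0⌋₊, n 1, n 2] - I|
          ≤ ε := by
  -- There are three comparisons of a sum with an integral, each costing `4 ^ 3 * (η * C)`, and one
  -- `η` for moving the parameters of the coarse sum.
  obtain ⟨η, hη, hηε⟩ : ∃ η > 0, 192 * (η * C) + η ≤ ε := by
    refine ⟨ε / (192 * C + 1), by positivity, le_of_eq ?_⟩
    field_simp
  obtain ⟨δ₁, hδ₁, hmod⟩ := hβ.exists_modulusLe hη
  obtain ⟨N', hN'⟩ := exists_nat_one_div_lt (half_pos hδ₁)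
  obtain ⟨N, hN, hNδ⟩ : ∃ N : ℕ, 0 < N ∧ 1 / (N : ℝ) ≤ δ₁ / 2 :=
    ⟨N' + 1, Nat.succ_pos _, by exact_mod_cast hN'.le⟩
  have hNpos : (0 : ℝ) < N := by exact_mod_cast hN
  have huc := ((isCompact_Icc (a := (0 : ℝ)) (b := 1)).prod ((isCompact_Icc (a := (0 : Fin 3 → ℝ))
    (b := b)).prod (isCompact_Icc (a := (![s₀, 0, 0, 0] : Fin 4 → ℝ))
      (b := ![1, τbar 0, τbar 1, τbar 2])))).uniformContinuousOn_of_continuous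
    (continuousOn_coarseSum hOm hwc hβ hN)
  rw [Metric.uniformContinuousOn_iff] at huc
  obtain ⟨δ₂, hδ₂, hcoarse⟩ := huc η hη
  -- The bound `s₀` ensures `1 ≤ n 0 * p 0`, so the grid has at least one cell in the first
  -- direction.
  refine ⟨min (min (δ₁ / 2) (δ₂ / 2)) s₀, by positivity, ?_⟩
  intro n hn θ hθ hθb hθτ p hp I hI
  set δ := min (min (δ₁ / 2) (δ₂ / 2)) s₀ with hδ
  have hδ1 : δ ≤ δ₁ / 2 := (min_le_left _ _).trans (min_le_left _ _)
  have hδ2 : δ ≤ δ₂ / 2 := (min_le_left _ _).trans (min_le_right _ _)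
  have hδs : δ ≤ s₀ := min_le_right _ _
  have hδ0 : 0 < δ := by positivity
  have hnpos : ∀ j, 0 < n j := by
    intro j
    rcases Nat.eq_zero_or_pos (n j) with h | h
    · have := hn j
      rw [h] at this
      norm_num at this
    · exact h
  have hnpos' : ∀ j, (0 : ℝ) < n j := fun j => by exact_mod_cast hnpos j
  have hninv : ∀ j, 1 / (n j : ℝ) ≤ δ := fun j => by
    rw [div_le_iff₀ (hnpos' j)]
    exact hn j
  have hp0 : s₀ ≤ p 0 := hp.1 0
  have hp1 : p 0 ≤ 1 := hp.2 0
  have hs : 0 < p 0 := hs₀.trans_le hp0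
  have hfloor : 0 < ⌊n 0 * p 0⌋₊ := by
    rw [Nat.floor_pos]
    refine (hn 0).trans ?_
    rw [mul_comm]
    exact mul_le_mul_of_nonneg_left (hδs.trans hp0) (hnpos' 0).le
  set sn : ℝ := (⌊n 0 * p 0⌋₊ : ℝ) / n 0 with hsn
  have hsn0 : 0 < sn := div_pos (by exact_mod_cast hfloor) (hnpos' 0)
  have hsn1 : sn ≤ p 0 := by
    rw [hsn, div_le_iff₀ (hnpos' 0), mul_comm (p 0)]
    exact Nat.floor_le (mul_nonneg (hnpos' 0).le hs.le)
  have hsnp : |sn - p 0| ≤ δ := (abs_floor_div_sub_le (hnpos 0) hs.le).trans (hninv 0)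
  have hbox : ∀ s : ℝ, 0 < s → s ≤ 1 →
      (∀ j, 0 < (![s, 1, 1] : Fin 3 → ℝ) j) ∧ (![s, 1, 1] : Fin 3 → ℝ) ≤ 1 := by
    intro s h0 h1
    refine ⟨fun j => ?_, fun j => ?_⟩
    · fin_cases j
      exacts [h0, one_pos, one_pos]
    · fin_cases j
      exacts [h1, le_rfl, le_rfl]
  have hvar' : ∀ s : ℝ, 0 < s → s ≤ 1 → ∀ θ' : Fin 3 → ℝ, (∀ j, 0 < θ' j) → (∀ j, θ' j ≤ b j) →
      FaceVariationLe (limitIntegrand Om θ' w p) 0 ![s, 1, 1] C := by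
    intro s h0 h1 θ' hθ' hθb'
    refine hvar p hp θ' _ hθ' (hbox s h0 h1).1 fun j => ?_
    exact (mul_le_of_le_one_right (hθ' j).le ((hbox s h0 h1).2 j)).trans (hθb' j)
  have hsn1' : sn ≤ 1 := hsn1.trans hp1
  have hfine : ∀ s : ℝ, 0 < s → s ≤ 1 → ∀ θ' : Fin 3 → ℝ, (∀ j, 0 < θ' j) →
      (∀ j, θ' j ≤ b j) → ∀ J, HasPartsIntegral (limitIntegrand Om θ' w p) β 0 ![s, 1, 1] J →
      ∀ (h : Fin 3 → ℝ) (k : Fin 3 → ℕ), (∀ j, 0 < h j) → (∀ j, 0 < k j) →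
      (∀ j, k j * h j = (![s, 1, 1] : Fin 3 → ℝ) j) → (∀ j, h j ≤ δ₁ / 2) →
      |gridSum β (limitIntegrand Om θ' w p) h k - J| ≤ 64 * (η * C) := by
    intro s h0 h1 θ' hθ' hθb' J hJ h k hh hk hkh hhδ
    have := abs_gridSum_sub_le hh hk hkh (hvar' s h0 h1 θ' hθ' hθb') hJ hη.le hδ₁
      (hmod.mono (hbox s h0 h1).2) hhδ
    norm_num at this
    linarith
  have hcoarseGrid : ∀ s : ℝ, 0 < s → s ≤ 1 →
      (∀ j, 0 < (![s / N, 1 / N, 1 / N] : Fin 3 → ℝ) j) ∧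
      (∀ j, (N : ℝ) * (![s / N, 1 / N, 1 / N] : Fin 3 → ℝ) j = (![s, 1, 1] : Fin 3 → ℝ) j) ∧
      (∀ j, (![s / N, 1 / N, 1 / N] : Fin 3 → ℝ) j ≤ δ₁ / 2) := by
    intro s h0 h1
    have e : ∀ t : ℝ, (N : ℝ) * (t / N) = t := fun t => by field_simp
    have h2 : s / N ≤ δ₁ / 2 := (div_le_div_of_nonneg_right h1 hNpos.le).trans hNδ
    refine ⟨fun j => ?_, fun j => ?_, fun j => ?_⟩
    · fin_cases j
      exacts [div_pos h0 hNpos, one_div_pos.mpr hNpos, one_div_pos.mpr hNpos]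
    · fin_cases j
      exacts [e s, e 1, e 1]
    · fin_cases j
      exacts [h2, hNδ, hNδ]
  -- The integral over the exact grid box `[0, sn] × [0, 1]²` with dilation `θ` joins the fine sum
  -- to the coarse sum; the coarse sum is then moved to `(p 0, τbar)` and compared with `I`.
  obtain ⟨J, hJ⟩ := exists_hasPartsIntegral (fun j => ((hbox sn hsn0 hsn1').1 j).le)
    ((hvar' sn hsn0 hsn1' θ hθ hθb).faceBounded fun j => ((hbox sn hsn0 hsn1').1 j).le)
    (hβ.mono (Set.Icc_subset_Icc_right (hbox sn hsn0 hsn1').2))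
  have e1 := hfine sn hsn0 hsn1' θ hθ hθb J hJ (fun j => 1 / n j) ![⌊n 0 * p 0⌋₊, n 1, n 2]
    (fun j => one_div_pos.mpr (hnpos' j))
    (fun j => by fin_cases j; exacts [hfloor, hnpos 1, hnpos 2])
    (fun j => by
      have h1 := (hnpos' 1).ne'
      have h2 := (hnpos' 2).ne'
      fin_cases j
      · change (⌊n 0 * p 0⌋₊ : ℝ) * (1 / n 0) = sn
        rw [mul_one_div]
      · change (n 1 : ℝ) * (1 / n 1) = 1
        field_simp
      · change (n 2 : ℝ) * (1 / n 2) = 1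
        field_simp) (fun j => (hninv j).trans hδ1)
  obtain ⟨g1, g2, g3⟩ := hcoarseGrid sn hsn0 hsn1'
  have e2 := hfine sn hsn0 hsn1' θ hθ hθb J hJ _ (fun _ => N) g1 (fun _ => hN) g2 g3
  obtain ⟨g1, g2, g3⟩ := hcoarseGrid (p 0) hs hp1
  have e3 := hfine (p 0) hs hp1 τbar hτbar hb I hI _ (fun _ => N) g1 (fun _ => hN) g2 g3
  have e4 := hcoarse (sn, θ, p) ⟨⟨hsn0.le, hsn1'⟩, ⟨fun j => (hθ j).le, hθb⟩, hp⟩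
    (p 0, τbar, p) ⟨⟨hs.le, hp1⟩, ⟨fun j => (hτbar j).le, hb⟩, hp⟩ (by
      rw [Prod.dist_eq, Prod.dist_eq, dist_self]
      refine max_lt ?_ (max_lt ?_ hδ₂)
      · exact (hsnp.trans hδ2).trans_lt (half_lt_self hδ₂)
      · exact ((dist_pi_le_iff hδ0.le).mpr hθτ |>.trans hδ2).trans_lt (half_lt_self hδ₂))
  rw [Real.dist_eq] at e4
  simp only at e4
  rw [abs_le] at e1 e2 e3 ⊢
  rw [abs_lt] at e4
  constructor <;> linarith [e1.1, e1.2, e2.1, e2.2, e3.1, e3.2, e4.1, e4.2]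

/-! ### The extended continuous mapping theorem -/

/-- If `Z k` converges in distribution to `Zlim` and the maps `T k` converge continuously at almost
every value of the limit, then `T k (Z k)` converges in distribution. -/
theorem tendstoInDistribution_of_tendsto_prod {κ S S' D E : Type*} [MeasurableSpace S]
    [MeasurableSpace S'] [PseudoEMetricSpace D] [MeasurableSpace D] [BorelSpace D]
    [PseudoEMetricSpace E] [MeasurableSpace E] [BorelSpace E] {l : Filter κ}
    [l.IsCountablyGenerated] {P : Measure S} [IsProbabilityMeasure P] {P' : Measure S'}
    [IsProbabilityMeasure P'] {Z : κ → S → D} {Zlim : S' → D}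
    (hZ : TendstoInDistribution Z l Zlim (fun _ => P) P') {T : κ → D → E} {U : κ → S → E}
    {Ulim : S' → E} (hU : ∀ k, AEMeasurable (U k) P) (hUlim : AEMeasurable Ulim P')
    (hT : ∀ᶠ k in l, ∀ᵐ ω ∂P, U k ω = T k (Z k ω))
    (hlim : ∀ᵐ ω ∂P', Tendsto (fun q : κ × D => T q.1 q.2) (l ×ˢ 𝓝 (Zlim ω)) (𝓝 (Ulim ω))) :
    TendstoInDistribution U l Ulim (fun _ => P) P' := by
  refine ⟨hU, hUlim, tendsto_of_forall_isClosed_limsup_le' fun F hF => ?_⟩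
  obtain ⟨B, hB⟩ := l.exists_antitone_basis
  -- The `T k` need not be measurable; the closures are, and they allow the portmanteau theorem. For
  -- large `k` the event `U k ∈ F` lies in `Z k ∈ A m` up to a null set.
  set A : ℕ → Set D := fun m => closure (⋃ k ∈ B m, T k ⁻¹' F) with hA
  have hAcl : ∀ m, IsClosed (A m) := fun m => isClosed_closure
  have hAanti : Antitone A := fun m m' hm =>
    closure_mono (Set.biUnion_subset_biUnion_left (hB.antitone hm))
  have h1 : ∀ m, limsup (fun k => P.map (U k) F) l ≤ P'.map Zlim (A m) := by
    intro m
    refine le_trans ?_ (ProbabilityMeasure.limsup_measure_closed_le_of_tendsto hZ.tendsto (hAcl m))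
    refine limsup_le_limsup ?_
    filter_upwards [hT, hB.mem m] with k hk hkm
    simp only [ProbabilityMeasure.coe_mk]
    rw [Measure.map_apply_of_aemeasurable (hU k) hF.measurableSet,
      Measure.map_apply_of_aemeasurable (hZ.forall_aemeasurable k) (hAcl m).measurableSet]
    refine measure_mono_ae ?_
    filter_upwards [hk] with ω hω hωF
    refine subset_closure (Set.mem_biUnion hkm ?_)
    have hωF' : U k ω ∈ F := hωF
    rw [hω] at hωF'
    exact hωF'
  have h2 : Tendsto (fun m => P'.map Zlim (A m)) atTop (𝓝 (P'.map Zlim (⋂ m, A m))) := by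
    have := Measure.isProbabilityMeasure_map (μ := P') hZ.aemeasurable_limit
    exact tendsto_measure_iInter_atTop (fun m => (hAcl m).measurableSet.nullMeasurableSet) hAanti
      ⟨0, measure_ne_top _ _⟩
  refine (ge_of_tendsto' h2 h1).trans ?_
  simp only [ProbabilityMeasure.coe_mk]
  rw [Measure.map_apply_of_aemeasurable hUlim hF.measurableSet,
    Measure.map_apply_of_aemeasurable hZ.aemeasurable_limit
      (isClosed_iInter hAcl).measurableSet]
  refine measure_mono_ae ?_
  filter_upwards [hlim] with ω hω hωA
  change Ulim ω ∈ F
  -- If the limit missed `F`, continuous convergence would give an `m` and a neighbourhood of `Zlim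
  -- ω` that `T k` maps off `F` for all `k ∈ B m`, contrary to `Zlim ω ∈ A m`.
  by_contra hnot
  have hmem := hω (hF.isOpen_compl.mem_nhds hnot)
  rw [Filter.mem_map, mem_prod_iff] at hmem
  obtain ⟨t₁, ht₁, t₂, ht₂, hsub⟩ := hmem
  obtain ⟨m, hm⟩ := hB.mem_iff.mp ht₁
  have hωm : Zlim ω ∈ A m := Set.mem_iInter.mp hωA m
  obtain ⟨z, hz₂, hz⟩ := mem_closure_iff_nhds.mp hωm t₂ ht₂
  obtain ⟨k, hk, hkz⟩ := Set.mem_iUnion₂.mp hz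
  exact hsub (Set.mk_mem_prod (hm hk) hz₂) hkz

/-! ### Skorohod convergence to a continuous function is uniform -/

theorem skorohod_edist_le {q : ℕ} {a b : Fin q → ℝ} (f g : SkorohodSpace a b) {ε : ℝ}
    (h : ∀ x, |f.toFun x - g.toFun x| ≤ ε) : edist f g ≤ ENNReal.ofReal ε := by
  refine (iInf_le _ (fun _ => OrderIso.refl _)).trans (iSup_le fun x => ?_)
  have hx : ParamChange.act (a := a) (b := b) (fun _ => OrderIso.refl _) x = x := rfl
  rw [hx, edist_self, edist_dist, Real.dist_eq]
  exact max_le (ENNReal.ofReal_le_ofReal (h x)) bot_le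

/-- A change of parameter close to the identity alters `g` little, because `g` is uniformly
continuous on the compact box. -/
theorem abs_sub_le_of_skorohod_edist_lt {q : ℕ} {a b : Fin q → ℝ} {g : SkorohodSpace a b}
    (hg : Continuous g.toFun) {ε : ℝ} (hε : 0 < ε) :
    ∃ δ > (0 : ENNReal), ∀ f : SkorohodSpace a b, edist f g < δ →
      ∀ x, |f.toFun x - g.toFun x| ≤ ε := by
  have huc := CompactSpace.uniformContinuous_of_continuous hg
  rw [Metric.uniformContinuous_iff] at huc
  obtain ⟨δ, hδ, H⟩ := huc (ε / 2) (half_pos hε)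
  refine ⟨ENNReal.ofReal (min δ (ε / 2)), ENNReal.ofReal_pos.mpr (by positivity),
    fun f hf x => ?_⟩
  obtain ⟨lam, hlam⟩ := iInf_lt_iff.mp (show skorohodEDist f g < _ from hf)
  have hx := (le_iSup (fun x => max (edist (f.toFun x) (g.toFun (lam.act x)))
    (edist (lam.act x) x)) x).trans_lt hlam
  obtain ⟨h1, h2⟩ := max_lt_iff.mp hx
  rw [edist_dist, ENNReal.ofReal_lt_ofReal_iff (by positivity)] at h1 h2
  have h3 := H (h2.trans_le (min_le_left _ _))
  have h4 := h1.trans_le (min_le_right _ _)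
  rw [Real.dist_eq] at h3 h4
  have := abs_sub_le (f.toFun x) (g.toFun (lam.act x)) (g.toFun x)
  linarith

/-! ### Finite linear combinations and uniform limits in the Skorohod space -/

namespace SkorohodSpace

variable {q : ℕ} {a b : Fin q → ℝ}

/-- The linear combination `∑ i, c i • e i`. -/
def linComb {E : Type*} [Fintype E] (e : E → SkorohodSpace a b) (c : E → ℝ) :
    SkorohodSpace a b where
  toFun x := ∑ i, c i * (e i).toFun x
  exists_limit R t := by
    choose L hL using fun i => (e i).exists_limit R t
    exact ⟨_, tendsto_finsetSum _ fun i _ => (hL i).const_mul (c i)⟩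
  continuous_from_above t :=
    tendsto_finsetSum _ fun i _ => ((e i).continuous_from_above t).const_mul (c i)

/-- The Skorohod distance is at most the supremum distance. The lemma makes random elements with
random coefficients Borel measurable, as continuous images of finite random vectors. -/
theorem continuous_linComb {E : Type*} [Fintype E] (e : E → SkorohodSpace a b)
    (hM : ∀ i, ∃ M, ∀ x, |(e i).toFun x| ≤ M) : Continuous (linComb e) := by
  choose M hM using hM
  rw [continuous_iff_continuousAt]
  intro c
  rw [ContinuousAt, EMetric.tendsto_nhds]
  intro ε hε
  have hsum : Tendsto (fun c' : E → ℝ => ENNReal.ofReal (∑ i, |c' i - c i| * M i)) (𝓝 c) (𝓝 0) := by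
    have : Continuous fun c' : E → ℝ => ENNReal.ofReal (∑ i, |c' i - c i| * M i) :=
      ENNReal.continuous_ofReal.comp (by fun_prop)
    simpa using this.tendsto c
  filter_upwards [hsum.eventually (gt_mem_nhds hε)] with c' hc'
  refine (skorohod_edist_le _ _ fun x => ?_).trans_lt hc'
  simp only [linComb]
  rw [← Finset.sum_sub_distrib]
  refine (Finset.abs_sum_le_sum_abs _ _).trans (Finset.sum_le_sum fun i _ => ?_)
  rw [← sub_mul, abs_mul]
  exact mul_le_mul_of_nonneg_left (hM i x) (abs_nonneg _)

/-- A uniform limit of elements of the Skorohod space. -/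
def ofUniformLimit (f : Set.Icc a b → ℝ)
    (hf : ∀ ε > 0, ∃ g : SkorohodSpace a b, ∀ x, |g.toFun x - f x| ≤ ε) : SkorohodSpace a b where
  toFun := f
  exists_limit R t := by
    -- A quadrant that does not accumulate at `t` has the trivial filter, and any limit will do;
    -- otherwise the Cauchy criterion is transferred from a uniform approximation.
    by_cases hne : (𝓝[quadrant R t] t).NeBot
    · refine cauchy_map_iff_exists_tendsto.mp ?_
      rw [cauchy_map_iff]
      refine ⟨hne, ?_⟩
      rw [Metric.uniformity_basis_dist.tendsto_right_iff]
      intro ε hε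
      obtain ⟨g, hg⟩ := hf (ε / 4) (by positivity)
      obtain ⟨L, hL⟩ := g.exists_limit R t
      have h := hL.eventually (Metric.ball_mem_nhds L (show 0 < ε / 4 by positivity))
      filter_upwards [h.prod_mk h] with x hx
      have h1 := hx.1
      have h2 := hx.2
      rw [Real.dist_eq, abs_lt] at h1 h2
      have h3 := abs_le.mp (hg x.1)
      have h4 := abs_le.mp (hg x.2)
      change dist (f x.1) (f x.2) < ε
      rw [Real.dist_eq, abs_lt]
      constructor <;> linarith [h1.1, h1.2, h2.1, h2.2, h3.1, h3.2, h4.1, h4.2]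
    · rw [not_neBot] at hne
      exact ⟨0, by rw [hne]; exact tendsto_bot⟩
  continuous_from_above t := by
    rw [Metric.tendsto_nhds]
    intro ε hε
    obtain ⟨g, hg⟩ := hf (ε / 4) (by positivity)
    filter_upwards [(g.continuous_from_above t).eventually
      (Metric.ball_mem_nhds _ (show 0 < ε / 4 by positivity))] with x h1
    rw [Real.dist_eq, abs_lt] at h1
    have h3 := abs_le.mp (hg x)
    have h4 := abs_le.mp (hg t)
    rw [Real.dist_eq, abs_lt]
    constructor <;> linarith [h1.1, h1.2, h3.1, h3.2, h4.1, h4.2]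

/-- The product of the indicator of `c ≤ x j` with a continuous function. -/
def stepMul (j : Fin q) (c : ℝ) (f : Set.Icc a b → ℝ)
    (hf : Continuous f) : SkorohodSpace a b where
  toFun x := (Set.Ici c).indicator 1 (x.1 j) * f x
  exists_limit R t := by
    have hcj : Continuous fun s : Set.Icc a b => s.1 j :=
      (continuous_apply j).comp continuous_subtype_val
    have hmem : ∀ᶠ s in 𝓝[quadrant R t] t, s ∈ quadrant R t := self_mem_nhdsWithin
    -- Within a quadrant the indicator is eventually constant; only for `c = t j` does its value
    -- depend on `R j`.
    suffices h : ∃ d : ℝ, ∀ᶠ s in 𝓝[quadrant R t] t,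
        (Set.Ici c).indicator (1 : ℝ → ℝ) (s.1 j) = d by
      obtain ⟨d, hd⟩ := h
      refine ⟨d * f t, (tendsto_const_nhds.congr' ?_).mul (hf.continuousWithinAt.tendsto)⟩
      filter_upwards [hd] with s hs using hs.symm
    rcases lt_trichotomy c (t.1 j) with h | h | h
    · refine ⟨1, ?_⟩
      filter_upwards [nhdsWithin_le_nhds (hcj.continuousAt.eventually (lt_mem_nhds h))] with s hs
      exact Set.indicator_of_mem (Set.mem_Ici.mpr (le_of_lt hs)) _
    · by_cases hR : R j = true
      · refine ⟨1, ?_⟩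
        filter_upwards [hmem] with s hs
        have := hs j
        rw [if_pos hR] at this
        exact Set.indicator_of_mem (Set.mem_Ici.mpr (h.le.trans this)) _
      · refine ⟨0, ?_⟩
        filter_upwards [hmem] with s hs
        have := hs j
        rw [if_neg hR] at this
        exact Set.indicator_of_notMem (fun hc => absurd (h ▸ this) (not_lt.mpr hc)) _
    · refine ⟨0, ?_⟩
      filter_upwards [nhdsWithin_le_nhds (hcj.continuousAt.eventually (gt_mem_nhds h))] with s hs
      exact Set.indicator_of_notMem (fun hc => absurd hs (not_lt.mpr hc)) _
  continuous_from_above t := by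
    have hcj : Continuous fun s : Set.Icc a b => s.1 j :=
      (continuous_apply j).comp continuous_subtype_val
    refine Tendsto.mul (tendsto_const_nhds.congr' ?_) (hf.continuousWithinAt.tendsto)
    rcases le_or_gt c (t.1 j) with h | h
    · filter_upwards [self_mem_nhdsWithin] with s hs
      have : t.1 j ≤ s.1 j := by simpa using hs j
      rw [Set.indicator_of_mem (Set.mem_Ici.mpr h),
        Set.indicator_of_mem (Set.mem_Ici.mpr (h.trans this)), Pi.one_apply, Pi.one_apply]
    · filter_upwards [nhdsWithin_le_nhds (hcj.continuousAt.eventually (gt_mem_nhds h))] with s hs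
      have h1 : t.1 j ∉ Set.Ici c := fun hc => absurd h (not_lt.mpr hc)
      have h2 : s.1 j ∉ Set.Ici c := fun hc => absurd hs (not_lt.mpr hc)
      rw [Set.indicator_of_notMem h1, Set.indicator_of_notMem h2]

end SkorohodSpace

/-! ### The detector process as a functional of the partial sum process -/

theorem hasPartsIntegral_partsIntegral {ι : Type*} [Fintype ι] [DecidableEq ι]
    {f h : (ι → ℝ) → ℝ} {a b : ι → ℝ} (hI : ∃ I, HasPartsIntegral f h a b I) :
    HasPartsIntegral f h a b (partsIntegral f h a b) := by
  rw [partsIntegral, dif_pos hI]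
  exact hI.choose_spec

theorem altSum_eq_faceAltSum {ι : Type*} [Fintype ι] [DecidableEq ι] (f : (ι → ℝ) → ℝ)
    (a b : ι → ℝ) : altSum f a b = faceAltSum f Finset.univ a b := by
  simp [altSum, faceAltSum]

theorem univ_fin_three : (Finset.univ : Finset (Fin 3)) = {0, 1, 2} := by decide

theorem altSum_fin_three (f : (Fin 3 → ℝ) → ℝ) (a b : Fin 3 → ℝ) :
    altSum f a b = f ![b 0, b 1, b 2] - f ![b 0, b 1, a 2] - f ![b 0, a 1, b 2]
      + f ![b 0, a 1, a 2] - f ![a 0, b 1, b 2] + f ![a 0, b 1, a 2] + f ![a 0, a 1, b 2]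
      - f ![a 0, a 1, a 2] := by
  have hv : ∀ z : Fin 3 → ℝ, f z = f ![z 0, z 1, z 2] := fun z => by
    congr 1
    ext j
    fin_cases j <;> rfl
  rw [altSum_eq_faceAltSum, univ_fin_three, faceAltSum_insert _ (by decide),
    faceAltSum_insert _ (by decide), faceAltSum_insert _ (by decide)]
  simp only [faceAltSum_singleton]
  simp only [hv (Function.update _ _ _), hv a]
  simp [Function.update]
  ring

theorem floor_mul_grid {n : ℕ} (hn : 0 < n) (l : ℕ) : ⌊(n : ℝ) * (l * (1 / n))⌋₊ = l := by
  have : (n : ℝ) ≠ 0 := by exact_mod_cast hn.ne'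
  have e : (n : ℝ) * (l * (1 / n)) = l := by field_simp
  rw [e, Nat.floor_natCast]

/-- The increment of the partial sum process over a cell of the grid. -/
theorem altSum_partialSumProcess {S : Type*} (ε : (Fin 3 → ℤ) → S → ℝ) {n : Fin 3 → ℕ}
    (hn : ∀ j, 0 < n j) (ω : S) (l : Fin 3 → ℕ) :
    altSum (partialSumProcess ε n ω) (fun j => l j * (1 / n j))
        (fun j => (l j + 1 : ℕ) * (1 / n j))
      = (√((n 0 : ℝ) * n 1 * n 2))⁻¹ *
        ε ![((l 0 + 1 : ℕ) : ℤ), ((l 1 + 1 : ℕ) : ℤ), ((l 2 + 1 : ℕ) : ℤ)] ω := by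
  -- At grid points the floors return the indices. The eight corner sums then cancel down to the
  -- single summand at the upper corner.
  have hF : ∀ k : Fin 3 → ℕ, partialSumProcess ε n ω
      ![(k 0 : ℝ) * (1 / n 0), (k 1 : ℝ) * (1 / n 1), (k 2 : ℝ) * (1 / n 2)]
      = (√((n 0 : ℝ) * n 1 * n 2))⁻¹ * ∑ i₁ ∈ Finset.Icc 1 (k 0), ∑ i₂ ∈ Finset.Icc 1 (k 1),
        ∑ i₃ ∈ Finset.Icc 1 (k 2), ε ![(i₁ : ℤ), (i₂ : ℤ), (i₃ : ℤ)] ω := by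
    intro k
    have h0 := floor_mul_grid (hn 0) (k 0)
    have h1 := floor_mul_grid (hn 1) (k 1)
    have h2 := floor_mul_grid (hn 2) (k 2)
    unfold partialSumProcess
    rw [show (![(k 0 : ℝ) * (1 / n 0), (k 1 : ℝ) * (1 / n 1), (k 2 : ℝ) * (1 / n 2)] :
      Fin 3 → ℝ) 0 = (k 0 : ℝ) * (1 / n 0) from rfl,
      show (![(k 0 : ℝ) * (1 / n 0), (k 1 : ℝ) * (1 / n 1), (k 2 : ℝ) * (1 / n 2)] :
      Fin 3 → ℝ) 1 = (k 1 : ℝ) * (1 / n 1) from rfl,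
      show (![(k 0 : ℝ) * (1 / n 0), (k 1 : ℝ) * (1 / n 1), (k 2 : ℝ) * (1 / n 2)] :
      Fin 3 → ℝ) 2 = (k 2 : ℝ) * (1 / n 2) from rfl, h0, h1, h2]
  rw [altSum_fin_three]
  have e := fun x y z : ℕ => hF ![x, y, z]
  simp only [Matrix.cons_val_zero, Matrix.cons_val_one, Matrix.cons_val] at e
  rw [e (l 0 + 1) (l 1 + 1) (l 2 + 1), e (l 0 + 1) (l 1 + 1) (l 2), e (l 0 + 1) (l 1) (l 2 + 1),
    e (l 0 + 1) (l 1) (l 2), e (l 0) (l 1 + 1) (l 2 + 1), e (l 0) (l 1 + 1) (l 2),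
    e (l 0) (l 1) (l 2 + 1), e (l 0) (l 1) (l 2)]
  simp only [Finset.sum_Icc_succ_top (Nat.le_add_left 1 _), Finset.sum_add_distrib]
  ring

theorem sum_Icc_one_eq_range (N : ℕ) (F : ℕ → ℝ) :
    ∑ i ∈ Finset.Icc 1 N, F i = ∑ i ∈ Finset.range N, F (i + 1) := by
  rw [Finset.range_eq_Ico, Finset.sum_Ico_add' F 0 N 1]
  rfl

/-- Under the null hypothesis the detector is a linear functional of the noise. -/
theorem weightedDetector_eq {S : Type*} (Om : Fin 3 → ℝ) (w : ℝ → ℝ → ℝ → ℝ → ℝ)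
    (f f₀ : ℝ → ℝ → ℝ → ℝ) (ε : (Fin 3 → ℤ) → S → ℝ) {b τ : Fin 3 → ℝ} {n : Fin 3 → ℕ}
    (hn : ∀ j, 0 < n j) (hτ : ∀ j, 0 < τ j) (hnb : ∀ j, n j * τ j ≤ b j)
    (hH₀ : ∀ t ∈ Set.Icc 0 (b 0), ∀ r₂ ∈ Set.Icc 0 (b 1), ∀ r₃ ∈ Set.Icc 0 (b 2),
      f t r₂ r₃ = f₀ t r₂ r₃) (ω : S) {p : Fin 4 → ℝ} (hp : p 0 ≤ 1) :
    weightedDetector Om w f₀ n τ (observation f ε τ ω) p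
      = ∑ l ∈ Fintype.piFinset fun j => Finset.range ((![⌊n 0 * p 0⌋₊, n 1, n 2] : Fin 3 → ℕ) j),
        √(τ 0 * τ 1 * τ 2) *
          ε ![((l 0 + 1 : ℕ) : ℤ), ((l 1 + 1 : ℕ) : ℤ), ((l 2 + 1 : ℕ) : ℤ)] ω *
          limitIntegrand Om (fun j => n j * τ j) w p (fun j => (l j + 1 : ℕ) * (1 / n j)) := by
  have hmem : ∀ j, ∀ l < n j, ((l + 1 : ℕ) : ℝ) * τ j ∈ Set.Icc 0 (b j) := by
    intro j l hl
    refine ⟨mul_nonneg (Nat.cast_nonneg _) (hτ j).le, le_trans ?_ (hnb j)⟩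
    exact mul_le_mul_of_nonneg_right (by exact_mod_cast hl) (hτ j).le
  have hfloor : ⌊n 0 * p 0⌋₊ ≤ n 0 := by
    refine Nat.floor_le_of_le ?_
    exact mul_le_of_le_one_right (Nat.cast_nonneg _) hp
  -- The sampling points are the points `l / n` of the unit grid dilated by `n τ`; hence the limit
  -- integrand with `n τ` in place of `τbar`.
  have hcancel : ∀ j (l : ℕ), (n j : ℝ) * τ j * ((l : ℝ) * (1 / n j)) = l * τ j := by
    intro j l
    have : (n j : ℝ) ≠ 0 := by exact_mod_cast (hn j).ne'
    field_simp
  rw [weightedDetector, sum_piFinset_fin_three]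
  simp only [sum_Icc_one_eq_range, Finset.mul_sum]
  refine Finset.sum_congr rfl fun l₁ h₁ => Finset.sum_congr rfl fun l₂ h₂ =>
    Finset.sum_congr rfl fun l₃ h₃ => ?_
  have h₁' : l₁ < n 0 := (Finset.mem_range.mp h₁).trans_le hfloor
  have h₂' : l₂ < n 1 := Finset.mem_range.mp h₂
  have h₃' : l₃ < n 2 := Finset.mem_range.mp h₃
  rw [observation, hH₀ _ (hmem 0 l₁ h₁') _ (hmem 1 l₂ h₂') _ (hmem 2 l₃ h₃'), limitIntegrand,
    hcancel, hcancel, hcancel]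
  simp only [Matrix.cons_val_zero, Matrix.cons_val_one, Matrix.cons_val]
  ring

/-- The sum over the whole grid with the summands beyond `p 0` deleted. -/
theorem sum_grid_indicator {n : Fin 3 → ℕ} (hn : ∀ j, 0 < n j) {s : ℝ} (hs₀ : 0 ≤ s) (hs : s ≤ 1)
    (F : (Fin 3 → ℕ) → ℝ) :
    ∑ l ∈ Fintype.piFinset fun j => Finset.range (n j),
        (Set.Ici (((l 0 + 1 : ℕ) : ℝ) * (1 / n 0))).indicator 1 s * F l
      = ∑ l ∈ Fintype.piFinset fun j =>
          Finset.range ((![⌊n 0 * s⌋₊, n 1, n 2] : Fin 3 → ℕ) j), F l := by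
  have hn0 : (0 : ℝ) < n 0 := by exact_mod_cast hn 0
  -- The shift by one is that from `range` to sums starting at `1`. With the indicator, the index
  -- set no longer depends on `s`.
  have hiff : ∀ l : ℕ, s ∈ Set.Ici (((l + 1 : ℕ) : ℝ) * (1 / n 0)) ↔ l < ⌊n 0 * s⌋₊ := by
    intro l
    rw [Set.mem_Ici, mul_one_div, div_le_iff₀ hn0, mul_comm s, ← Nat.succ_le_iff,
      Nat.le_floor_iff (mul_nonneg hn0.le hs₀)]
  have hfloor : ⌊n 0 * s⌋₊ ≤ n 0 :=
    Nat.floor_le_of_le (mul_le_of_le_one_right (Nat.cast_nonneg _) hs)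
  rw [sum_piFinset_fin_three, sum_piFinset_fin_three]
  symm
  refine Finset.sum_subset_zero_on_sdiff (Finset.range_subset_range.mpr hfloor) ?_ ?_
  · intro l₁ h₁
    simp only [Matrix.cons_val_zero, Finset.mem_sdiff, Finset.mem_range] at h₁
    have : s ∉ Set.Ici (((l₁ + 1 : ℕ) : ℝ) * (1 / n 0)) := fun h => h₁.2 ((hiff l₁).mp h)
    simp only [Matrix.cons_val_zero, Set.indicator_of_notMem this, zero_mul,
      Finset.sum_const_zero]
  · intro l₁ h₁
    simp only [Matrix.cons_val_zero, Finset.mem_range] at h₁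
    simp only [Matrix.cons_val_zero, Set.indicator_of_mem ((hiff l₁).mpr h₁), Pi.one_apply,
      one_mul]
    rfl

theorem eventually_pi_atTop {p : Fin 3 → ℕ → Prop} (hp : ∀ j, ∀ᶠ m in atTop, p j m) :
    ∀ᶠ n : Fin 3 → ℕ in atTop, ∀ j, p j (n j) := by
  choose N hN using fun j => eventually_atTop.mp (hp j)
  filter_upwards [eventually_ge_atTop N] with n hn j using hN j _ (hn j)

/-- The convergence of the detector functional along functions that converge uniformly to `σ β`. -/
theorem detector_close {Om : Fin 3 → ℝ} (hOm : ∀ j, 0 < Om j)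
    {w : ℝ → ℝ → ℝ → ℝ → ℝ} {b τbar : Fin 3 → ℝ} (hτbar : ∀ j, 0 < τbar j)
    (hb : ∀ j, τbar j ≤ b j) {s₀ : ℝ} (hs₀ : 0 < s₀)
    (hwc : ContinuousOn (fun p : ℝ × ℝ × ℝ × ℝ => w p.1 p.2.1 p.2.2.1 p.2.2.2)
      (Set.Icc 0 (b 1) ×ˢ Set.Icc 0 (b 2) ×ˢ Set.Icc 0 (τbar 1) ×ˢ Set.Icc 0 (τbar 2)))
    {C : ℝ} (hC : 0 ≤ C)
    (hvar : ∀ p ∈ Set.Icc ![s₀, 0, 0, 0] ![1, τbar 0, τbar 1, τbar 2], ∀ θ B : Fin 3 → ℝ,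
      (∀ j, 0 < θ j) → (∀ j, 0 < B j) → (∀ j, θ j * B j ≤ b j) →
      FaceVariationLe (limitIntegrand Om θ w p) 0 B C)
    {β : (Fin 3 → ℝ) → ℝ} (hβ : ContinuousOn β (Set.Icc 0 1)) (σ : ℝ) {ε : ℝ} (hε : 0 < ε) :
    ∃ δ > (0 : ℝ), ∀ n : Fin 3 → ℕ, (∀ j, 1 ≤ δ * n j) → ∀ θ : Fin 3 → ℝ, (∀ j, 0 < θ j) →
      (∀ j, θ j ≤ b j) → (∀ j, |θ j - τbar j| ≤ δ) → ∀ z : (Fin 3 → ℝ) → ℝ,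
      (∀ v ∈ Set.Icc (0 : Fin 3 → ℝ) 1, |z v - σ * β v| ≤ δ) →
      ∀ p ∈ Set.Icc ![s₀, 0, 0, 0] ![1, τbar 0, τbar 1, τbar 2], ∀ I,
        HasPartsIntegral (limitIntegrand Om τbar w p) β 0 ![p 0, 1, 1] I →
        |√(θ 0 * θ 1 * θ 2) * gridSum z (limitIntegrand Om θ w p) (fun j => 1 / n j)
            ![⌊n 0 * p 0⌋₊, n 1, n 2] - √(τbar 0 * τbar 1 * τbar 2) * σ * I| ≤ ε := by
  set a' := √(τbar 0 * τbar 1 * τbar 2) with ha'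
  have ha'0 : 0 ≤ a' := Real.sqrt_nonneg _
  obtain ⟨M, hM⟩ := isCompact_Icc.exists_bound_of_continuousOn hβ
  have hM' : ∀ v ∈ Set.Icc (0 : Fin 3 → ℝ) 1, |β v| ≤ |M| := fun v hv =>
    (hM v hv).trans (le_abs_self M)
  -- A bound for `|I|`: the grid sum of `β` is at most `64 * (|M| * C)` and within `ε₁ ≤ 1` of `I`.
  set D := 64 * (|M| * C) + 1 with hD
  have hD0 : 0 < D := by positivity
  set ε₁ := min 1 (ε / (4 * (a' + 1) * (|σ| + 1))) with hε₁
  have hε₁0 : 0 < ε₁ := by positivity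
  obtain ⟨δ₁, hδ₁, hclose⟩ := gridSum_close hOm hτbar hb hs₀ hwc hC hvar hβ hε₁0
  set κ := min 1 (ε / (2 * (|σ| + 1) * D)) with hκ
  have hκ0 : 0 < κ := by positivity
  obtain ⟨δ₂, hδ₂, hsqrt⟩ : ∃ δ₂ > 0, ∀ θ : Fin 3 → ℝ, dist θ τbar < δ₂ →
      dist (√(θ 0 * θ 1 * θ 2)) a' < κ := by
    have hc : Continuous fun θ : Fin 3 → ℝ => √(θ 0 * θ 1 * θ 2) := by fun_prop
    exact Metric.continuousAt_iff.mp hc.continuousAt κ hκ0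
  set δ₃ := ε / (4 * (a' + 1) * (64 * C + 1)) with hδ₃
  have hδ₃0 : 0 < δ₃ := by positivity
  refine ⟨min (min δ₁ (δ₂ / 2)) (min δ₃ s₀), by positivity, ?_⟩
  intro n hn θ hθ hθb hθτ z hz p hp I hI
  set δ := min (min δ₁ (δ₂ / 2)) (min δ₃ s₀) with hδ
  have hδ0 : 0 < δ := by positivity
  have hd1 : δ ≤ δ₁ := (min_le_left _ _).trans (min_le_left _ _)
  have hd2 : δ ≤ δ₂ / 2 := (min_le_left _ _).trans (min_le_right _ _)
  have hd3 : δ ≤ δ₃ := (min_le_right _ _).trans (min_le_left _ _)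
  have hd4 : δ ≤ s₀ := (min_le_right _ _).trans (min_le_right _ _)
  have hnpos : ∀ j, 0 < n j := by
    intro j
    rcases Nat.eq_zero_or_pos (n j) with h | h
    · have := hn j
      rw [h] at this
      norm_num at this
    · exact h
  have hnpos' : ∀ j, (0 : ℝ) < n j := fun j => by exact_mod_cast hnpos j
  have h1 := hclose n (fun j => (hn j).trans
    (mul_le_mul_of_nonneg_right hd1 (hnpos' j).le)) θ hθ hθb (fun j => (hθτ j).trans hd1) p hp I hI
  have h2 := hsqrt θ (((dist_pi_le_iff hδ0.le).mpr hθτ |>.trans hd2).trans_lt (half_lt_self hδ₂))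
  rw [Real.dist_eq] at h2
  set a := √(θ 0 * θ 1 * θ 2) with ha
  set f := limitIntegrand Om θ w p with hf
  set N : Fin 3 → ℕ := ![⌊n 0 * p 0⌋₊, n 1, n 2] with hN
  have hfloor : 0 < ⌊n 0 * p 0⌋₊ := by
    rw [Nat.floor_pos]
    refine (hn 0).trans ?_
    rw [mul_comm]
    exact mul_le_mul_of_nonneg_left (hd4.trans (hp.1 0)) (hnpos' 0).le
  have hp0 : 0 ≤ p 0 := hs₀.le.trans (hp.1 0)
  have hNpos : ∀ j, 0 < N j := fun j => by
    fin_cases j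
    exacts [hfloor, hnpos 1, hnpos 2]
  have hNn : ∀ j, N j ≤ n j := fun j => by
    fin_cases j
    · exact Nat.floor_le_of_le (mul_le_of_le_one_right (Nat.cast_nonneg _) (hp.2 0))
    · exact le_rfl
    · exact le_rfl
  have hNB : ∀ j, (N j : ℝ) * (1 / n j) ≤ 1 := fun j => by
    rw [mul_one_div, div_le_one (hnpos' j)]
    exact_mod_cast hNn j
  have hB0 : ∀ j, 0 < (N j : ℝ) * (1 / n j) := fun j =>
    mul_pos (by exact_mod_cast hNpos j) (one_div_pos.mpr (hnpos' j))
  have hfv : FaceVariationLe f 0 (fun j => (N j : ℝ) * (1 / n j)) C :=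
    hvar p hp θ _ hθ hB0 fun j =>
      (mul_le_of_le_one_right (hθ j).le (hNB j)).trans (hθb j)
  have hsub : Set.Icc 0 (fun j => (N j : ℝ) * (1 / n j)) ⊆ Set.Icc (0 : Fin 3 → ℝ) 1 :=
    Set.Icc_subset_Icc_right hNB
  have h3 := abs_gridSum_le (fun j => one_div_pos.mpr (hnpos' j)) hNpos (fun j => rfl) hfv
    (abs_nonneg M) fun v hv => hM' v (hsub hv)
  have h4 := abs_gridSum_le (x := fun v => z v - σ * β v) (fun j => one_div_pos.mpr (hnpos' j))
    hNpos (fun j => rfl) hfv hδ0.le fun v hv => hz v (hsub hv)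
  rw [gridSum_sub z (fun v => σ * β v)] at h4
  have h5 : gridSum (fun v => σ * β v) f (fun j => 1 / (n j : ℝ)) N
      = σ * gridSum β f (fun j => 1 / (n j : ℝ)) N := by
    simp only [gridSum, altSum_const_mul, Finset.mul_sum, mul_assoc]
  rw [h5] at h4
  norm_num only [Fintype.card_fin] at h3 h4
  set G := gridSum z f (fun j => 1 / (n j : ℝ)) N with hG
  set G₀ := gridSum β f (fun j => 1 / (n j : ℝ)) N with hG₀
  have hI' : |I| ≤ D := by
    have e1 : |I| ≤ |G₀| + |G₀ - I| := by
      have := abs_sub G₀ (G₀ - I)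
      rwa [sub_sub_cancel] at this
    have e2 : ε₁ ≤ 1 := min_le_left _ _
    linarith
  have hGI : |G - σ * I| ≤ 64 * (δ * C) + |σ| * ε₁ := by
    have e1 := abs_sub_le G (σ * G₀) (σ * I)
    rw [← mul_sub σ G₀ I, abs_mul] at e1
    have e2 := mul_le_mul_of_nonneg_left h1 (abs_nonneg σ)
    linarith
  have ha1 : a ≤ a' + 1 := by
    have e1 := (abs_lt.mp h2).2
    have e2 : κ ≤ 1 := min_le_left _ _
    linarith
  have hfin : |a * G - a' * σ * I| ≤ (a' + 1) * (64 * (δ * C) + |σ| * ε₁) + κ * (|σ| * D) := by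
    -- The replacement of `z` by `σ β` costs `ε / 4`, that of the sum by the integral `ε / 4`, and
    -- that of the normalizing root `ε / 2`.
    have e : a * G - a' * σ * I = a * (G - σ * I) + (a - a') * (σ * I) := by ring
    rw [e]
    refine (abs_add_le _ _).trans (add_le_add ?_ ?_)
    · rw [abs_mul, abs_of_nonneg (Real.sqrt_nonneg _)]
      exact mul_le_mul ha1 hGI (abs_nonneg _) (by positivity)
    · rw [abs_mul, abs_mul]
      exact mul_le_mul h2.le (mul_le_mul_of_nonneg_left hI' (abs_nonneg _)) (by positivity)
        hκ0.le
  refine hfin.trans ?_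
  have b1 : (a' + 1) * (64 * (δ * C)) ≤ ε / 4 := by
    have e1 : δ * (64 * C) ≤ δ₃ * (64 * C + 1) :=
      mul_le_mul hd3 (by linarith) (by positivity) hδ₃0.le
    have e2 : (a' + 1) * (δ₃ * (64 * C + 1)) = ε / 4 := by
      rw [hδ₃]
      field_simp
    have e3 := mul_le_mul_of_nonneg_left e1 (show 0 ≤ a' + 1 by positivity)
    linarith
  have b2 : (a' + 1) * (|σ| * ε₁) ≤ ε / 4 := by
    have e1 : |σ| * ε₁ ≤ (|σ| + 1) * (ε / (4 * (a' + 1) * (|σ| + 1))) :=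
      mul_le_mul (by linarith) (min_le_right _ _) hε₁0.le (by positivity)
    have e2 : (a' + 1) * ((|σ| + 1) * (ε / (4 * (a' + 1) * (|σ| + 1)))) = ε / 4 := by
      field_simp
    have e3 := mul_le_mul_of_nonneg_left e1 (show 0 ≤ a' + 1 by positivity)
    linarith
  have b3 : κ * (|σ| * D) ≤ ε / 2 := by
    have e1 : κ * (|σ| * D) ≤ ε / (2 * (|σ| + 1) * D) * ((|σ| + 1) * D) :=
      mul_le_mul (min_le_right _ _) (mul_le_mul_of_nonneg_right (by linarith) hD0.le)
        (by positivity) (by positivity)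
    have e2 : ε / (2 * (|σ| + 1) * D) * ((|σ| + 1) * D) = ε / 2 := by
      field_simp
    linarith
  linarith

instance {q : ℕ} {a b : Fin q → ℝ} : Inhabited (SkorohodSpace a b) :=
  ⟨SkorohodSpace.linComb (E := Fin 0) Fin.elim0 fun _ => 0⟩

open Classical in
/-- The extension by zero of an element of the Skorohod space. -/
def SkorohodSpace.extend {q : ℕ} {a b : Fin q → ℝ} (z : SkorohodSpace a b) (v : Fin q → ℝ) : ℝ :=
  if hv : v ∈ Set.Icc a b then z.toFun ⟨v, hv⟩ else 0

theorem SkorohodSpace.extend_apply {q : ℕ} {a b : Fin q → ℝ} (z : SkorohodSpace a b)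
    (v : Set.Icc a b) : z.extend v.1 = z.toFun v := by
  rw [SkorohodSpace.extend, dif_pos v.2]

theorem grid_mem_Icc {n k : ℕ} (hk : k ≤ n) : (k : ℝ) * (1 / n) ∈ Set.Icc (0 : ℝ) 1 := by
  refine ⟨by positivity, ?_⟩
  rcases Nat.eq_zero_or_pos n with rfl | hn
  · simp
  · have hn' : (0 : ℝ) < n := by exact_mod_cast hn
    rw [mul_one_div, div_le_one hn']
    exact_mod_cast hk

theorem altSum_congr_Icc {ι : Type*} [Fintype ι] [DecidableEq ι] {f g : (ι → ℝ) → ℝ}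
    {a b c d : ι → ℝ} (h : ∀ z ∈ Set.Icc c d, f z = g z) (ha : a ∈ Set.Icc c d)
    (hb : b ∈ Set.Icc c d) : altSum f a b = altSum g a b := by
  refine altSum_congr fun z hz => h z ⟨fun j => ?_, fun j => ?_⟩
  · rcases hz j with h | h <;> rw [h]
    exacts [ha.1 j, hb.1 j]
  · rcases hz j with h | h <;> rw [h]
    exacts [ha.2 j, hb.2 j]

theorem corner_mem_Icc {n l : Fin 3 → ℕ} (hl : l ∈ Fintype.piFinset fun j => Finset.range (n j)) :
    (fun j => (l j : ℝ) * (1 / n j)) ∈ Set.Icc (0 : Fin 3 → ℝ) 1 ∧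
      (fun j => ((l j + 1 : ℕ) : ℝ) * (1 / n j)) ∈ Set.Icc (0 : Fin 3 → ℝ) 1 := by
  have hl' : ∀ j, l j < n j := fun j => Finset.mem_range.mp (Fintype.mem_piFinset.mp hl j)
  exact ⟨⟨fun j => (grid_mem_Icc (hl' j).le).1, fun j => (grid_mem_Icc (hl' j).le).2⟩,
    ⟨fun j => (grid_mem_Icc (hl' j)).1, fun j => (grid_mem_Icc (hl' j)).2⟩⟩

/-- The summands of the detector process as elements of the Skorohod space. -/
theorem exists_detector_summand {Om : Fin 3 → ℝ} (hOm : ∀ j, 0 < Om j)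
    {w : ℝ → ℝ → ℝ → ℝ → ℝ} {b τbar : Fin 3 → ℝ} {s₀ : ℝ}
    (hwc : ContinuousOn (fun p : ℝ × ℝ × ℝ × ℝ => w p.1 p.2.1 p.2.2.1 p.2.2.2)
      (Set.Icc 0 (b 1) ×ˢ Set.Icc 0 (b 2) ×ˢ Set.Icc 0 (τbar 1) ×ˢ Set.Icc 0 (τbar 2)))
    {θ : Fin 3 → ℝ} (hθ : ∀ j, 0 ≤ θ j) (hθb : ∀ j, θ j ≤ b j) {z : Fin 3 → ℝ}
    (hz : z ∈ Set.Icc (0 : Fin 3 → ℝ) 1) :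
    ∃ e : SkorohodSpace ![s₀, 0, 0, 0] ![1, τbar 0, τbar 1, τbar 2],
      (∃ M, ∀ x, |e.toFun x| ≤ M) ∧
      ∀ x, e.toFun x = (Set.Ici (z 0)).indicator 1 (x.1 0) * limitIntegrand Om θ w x.1 z := by
  have hc : Continuous fun x : Set.Icc (![s₀, 0, 0, 0] : Fin 4 → ℝ) ![1, τbar 0, τbar 1, τbar 2] =>
      limitIntegrand Om θ w x.1 z := by
    rw [← continuousOn_univ]
    refine continuousOn_limitIntegrand (τbar := τbar) hOm hwc continuous_const
      continuous_subtype_val continuous_const ?_ ?_ ?_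
    · exact fun _ _ j => ⟨mul_nonneg (hθ j) (hz.1 j),
        (mul_le_of_le_one_right (hθ j) (hz.2 j)).trans (hθb j)⟩
    · exact fun x _ => ⟨x.2.1 2, x.2.2 2⟩
    · exact fun x _ => ⟨x.2.1 3, x.2.2 3⟩
  obtain ⟨M, hM⟩ := isCompact_univ.exists_bound_of_continuousOn hc.continuousOn
  refine ⟨SkorohodSpace.stepMul 0 (z 0) _ hc, ⟨M, fun x => ?_⟩, fun x => rfl⟩
  refine le_trans ?_ (hM x (Set.mem_univ x))
  change |(Set.Ici (z 0)).indicator (1 : ℝ → ℝ) (x.1 0) * limitIntegrand Om θ w x.1 z| ≤ _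
  rw [abs_mul, Real.norm_eq_abs]
  refine mul_le_of_le_one_left (abs_nonneg _) ?_
  by_cases h : x.1 0 ∈ Set.Ici (z 0) <;> simp [h]

end

/-! ### The functional central limit theorem for the weighted detector -/

theorem mainTheorem5
    {S S' : Type*} [MeasurableSpace S] [MeasurableSpace S']
    (P : Measure S) [IsProbabilityMeasure P] (P' : Measure S') [IsProbabilityMeasure P']
    -- band widths, sampling periods, their limits, start of monitoring
    (Om : Fin 3 → ℝ) (hOm : ∀ j, 0 < Om j)
    (τ : Fin 3 → ℕ → ℝ) (hτ : ∀ j m, 0 < τ j m)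
    (τbar : Fin 3 → ℝ) (hτbar : ∀ j, 0 < τbar j)
    (hlim : ∀ j, Tendsto (fun m : ℕ => (m : ℝ) * τ j m) atTop (𝓝 (τbar j)))
    (s₀ : ℝ) (hs₀ : s₀ ∈ Set.Ioo (0 : ℝ) 1)
    -- the observation window `∏ [0, b j]`, which contains `∏ [0, τbar j]` and the sampling points
    (b : Fin 3 → ℝ) (hb : ∀ j, τbar j ≤ b j)
    (hbτ : ∀ j, ∀ᶠ m : ℕ in atTop, (m : ℝ) * τ j m ≤ b j)
    -- the weight function
    (w : ℝ → ℝ → ℝ → ℝ → ℝ)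
    (hwc : ContinuousOn (fun p : ℝ × ℝ × ℝ × ℝ => w p.1 p.2.1 p.2.2.1 p.2.2.2)
      (Set.Icc 0 (b 1) ×ˢ Set.Icc 0 (b 2) ×ˢ Set.Icc 0 (τbar 1) ×ˢ Set.Icc 0 (τbar 2)))
    (hwv : (⨆ r₂ ∈ Set.Icc 0 (τbar 1), ⨆ r₃ ∈ Set.Icc 0 (τbar 2),
      hardyKrauseVariation (fun z : Fin 2 → ℝ => w (z 0) (z 1) r₂ r₃) 0 ![b 1, b 2]) < ⊤)
    -- noise and Brownian motion
    (ε : (Fin 3 → ℤ) → S → ℝ) (σ : ℝ) (B : S' → (Fin 3 → ℝ) → ℝ)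
    (hB : IsBrownianSheet B P') (hε : NoiseAssumption ε P σ B P')
    -- true signal and reference signal, null hypothesis
    (f f₀ : ℝ → ℝ → ℝ → ℝ)
    (hH₀ : ∀ t ∈ Set.Icc 0 (b 0), ∀ r₂ ∈ Set.Icc 0 (b 1), ∀ r₃ ∈ Set.Icc 0 (b 2),
      f t r₂ r₃ = f₀ t r₂ r₃) :
    (∀ᵐ ω ∂P', ∀ x ∈ Set.Icc ![s₀, 0, 0, 0] ![1, τbar 0, τbar 1, τbar 2],
      ∃ I, HasPartsIntegral (limitIntegrand Om τbar w x) (B ω) 0 ![x 0, 1, 1] I) ∧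
    ConvergesWeaklyInSkorohod ![s₀, 0, 0, 0] ![1, τbar 0, τbar 1, τbar 2]
      (fun (n : Fin 3 → ℕ) ω => weightedDetector Om w f₀ n (fun j => τ j (n j))
        (observation f ε (fun j => τ j (n j)) ω)) P atTop
      (fun ω => limitProcess Om τbar w σ (B ω)) P' := by
  classical
  -- bounds for the integrands
  have hbpos : ∀ j, 0 < b j := fun j => (hτbar j).trans_le (hb j)
  obtain ⟨M, hM⟩ := ((isCompact_Icc (a := (0 : ℝ)) (b := b 1)).prod
    ((isCompact_Icc (a := (0 : ℝ)) (b := b 2)).prod ((isCompact_Icc (a := (0 : ℝ))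
      (b := τbar 1)).prod (isCompact_Icc (a := (0 : ℝ))
        (b := τbar 2))))).exists_bound_of_continuousOn hwc
  set W := ⨆ r₂ ∈ Set.Icc 0 (τbar 1), ⨆ r₃ ∈ Set.Icc 0 (τbar 2),
    hardyKrauseVariation (fun z : Fin 2 → ℝ => w (z 0) (z 1) r₂ r₃) 0 ![b 1, b 2] with hW
  set C := (∏ j, (Om j / Real.pi + Om j / Real.pi * Om j * b j)) * (2 * W.toReal + |M|) with hCdef
  have hC : 0 ≤ C := by
    refine mul_nonneg (Finset.prod_nonneg fun j _ => ?_) (by positivity)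
    have := Real.pi_pos
    have := hOm j
    have := hbpos j
    positivity
  have hvar : ∀ p ∈ Set.Icc ![s₀, 0, 0, 0] ![1, τbar 0, τbar 1, τbar 2], ∀ θ B : Fin 3 → ℝ,
      (∀ j, 0 < θ j) → (∀ j, 0 < B j) → (∀ j, θ j * B j ≤ b j) →
      FaceVariationLe (limitIntegrand Om θ w p) 0 B C := by
    intro p hp θ B hθ hB' hθB
    have hp2 : p 2 ∈ Set.Icc 0 (τbar 1) := ⟨hp.1 2, hp.2 2⟩
    have hp3 : p 3 ∈ Set.Icc 0 (τbar 2) := ⟨hp.1 3, hp.2 3⟩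
    refine limitIntegrand_faceVariationLe hOm ENNReal.toReal_nonneg ?_ ?_ hθ hB' hθB
    · rw [ENNReal.ofReal_toReal hwv.ne]
      exact le_iSup₂_of_le (p 2) hp2 (le_iSup₂_of_le (p 3) hp3 le_rfl)
    · exact fun s hs t ht => (hM (s, t, p 2, p 3) ⟨hs, ht, hp2, hp3⟩).trans (le_abs_self M)
  have hexists : ∀ β : (Fin 3 → ℝ) → ℝ, ContinuousOn β (Set.Icc 0 1) →
      ∀ x ∈ Set.Icc ![s₀, 0, 0, 0] ![1, τbar 0, τbar 1, τbar 2],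
        ∃ I, HasPartsIntegral (limitIntegrand Om τbar w x) β 0 ![x 0, 1, 1] I := by
    intro β hβ x hx
    have h0 : ∀ j, 0 < (![x 0, 1, 1] : Fin 3 → ℝ) j := fun j => by
      fin_cases j
      exacts [hs₀.1.trans_le (hx.1 0), one_pos, one_pos]
    have h1 : (![x 0, 1, 1] : Fin 3 → ℝ) ≤ 1 := fun j => by
      fin_cases j
      exacts [hx.2 0, le_rfl, le_rfl]
    exact exists_hasPartsIntegral (fun j => (h0 j).le)
      ((hvar x hx τbar _ hτbar h0 fun j =>
        (mul_le_of_le_one_right (hτbar j).le (h1 j)).trans (hb j)).faceBounded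
          fun j => (h0 j).le) (hβ.mono (Set.Icc_subset_Icc_right h1))
  refine ⟨?_, ?_⟩
  · filter_upwards [hB.continuous] with ω hω using hexists _ hω
  -- admissible sample sizes
  set θ : (Fin 3 → ℕ) → Fin 3 → ℝ := fun n j => n j * τ j (n j) with hθdef
  set good : (Fin 3 → ℕ) → Prop := fun n => (∀ j, 0 < n j) ∧ ∀ j, θ n j ≤ b j with hgood
  have hθpos : ∀ n, good n → ∀ j, 0 < θ n j := fun n hn j =>
    mul_pos (by exact_mod_cast hn.1 j) (hτ j _)
  have hev : ∀ δ > (0 : ℝ), ∀ᶠ n : Fin 3 → ℕ in atTop, good n ∧ (∀ j, 1 ≤ δ * n j) ∧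
      ∀ j, |θ n j - τbar j| ≤ δ := by
    intro δ hδ
    have h1 := eventually_pi_atTop fun _ : Fin 3 => eventually_gt_atTop 0
    have h2 := eventually_pi_atTop hbτ
    have h3 : ∀ᶠ m : ℕ in atTop, 1 ≤ δ * m :=
      (tendsto_natCast_atTop_atTop.const_mul_atTop hδ).eventually_ge_atTop 1
    have h4 := eventually_pi_atTop fun j =>
      (hlim j).eventually (Metric.closedBall_mem_nhds (τbar j) hδ)
    filter_upwards [h1, h2, eventually_pi_atTop fun _ : Fin 3 => h3, h4] with n a1 a2 a3 a4
    exact ⟨⟨a1, a2⟩, a3, a4⟩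
  -- the processes as elements of the Skorohod space
  have hsummand : ∀ n l, ∃ e : SkorohodSpace ![s₀, 0, 0, 0] ![1, τbar 0, τbar 1, τbar 2],
      good n → l ∈ Fintype.piFinset (fun j => Finset.range (n j)) →
      (∃ M, ∀ x, |e.toFun x| ≤ M) ∧ ∀ x, e.toFun x =
        (Set.Ici (((l 0 + 1 : ℕ) : ℝ) * (1 / n 0))).indicator 1 (x.1 0) *
          limitIntegrand Om (θ n) w x.1 (fun j => ((l j + 1 : ℕ) : ℝ) * (1 / n j)) := by
    intro n l
    by_cases h : good n ∧ l ∈ Fintype.piFinset (fun j => Finset.range (n j))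
    · obtain ⟨e, he⟩ := exists_detector_summand (s₀ := s₀) hOm hwc
        (fun j => (hθpos n h.1 j).le) h.1.2 (corner_mem_Icc h.2).2
      exact ⟨e, fun _ _ => he⟩
    · exact ⟨default, fun h1 h2 => absurd ⟨h1, h2⟩ h⟩
  choose e he using hsummand
  -- One map from coefficient vectors to paths serves twice: noise variables as coefficients give
  -- the detector, increments of a function `z` give `T n z`.
  set X : (n : Fin 3 → ℕ) → (Fintype.piFinset (fun j => Finset.range (n j)) → ℝ) →
      SkorohodSpace ![s₀, 0, 0, 0] ![1, τbar 0, τbar 1, τbar 2] := fun n c =>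
    if good n then SkorohodSpace.linComb
      (fun l : Fintype.piFinset (fun j => Finset.range (n j)) => e n l) c else default with hX
  have hXc : ∀ n, Continuous (X n) := by
    intro n
    by_cases hn : good n
    · simp only [hX, if_pos hn]
      exact SkorohodSpace.continuous_linComb _ fun l => (he n l hn l.2).1
    · simp only [hX, if_neg hn]
      exact continuous_const
  have hXval : ∀ n, good n → ∀ (c : (Fin 3 → ℕ) → ℝ) x, (X n fun l => c l).toFun x
      = ∑ l ∈ Fintype.piFinset fun j =>
          Finset.range ((![⌊n 0 * x.1 0⌋₊, n 1, n 2] : Fin 3 → ℕ) j),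
        c l * limitIntegrand Om (θ n) w x.1 (fun j => ((l j + 1 : ℕ) : ℝ) * (1 / n j)) := by
    intro n hn c x
    rw [← sum_grid_indicator hn.1 (hs₀.1.le.trans (x.2.1 0)) (x.2.2 0)]
    simp only [hX, if_pos hn, SkorohodSpace.linComb]
    rw [Finset.sum_coe_sort (Fintype.piFinset fun j => Finset.range (n j))
      fun l => c l * (e n l).toFun x]
    refine Finset.sum_congr rfl fun l hl => ?_
    rw [(he n l hn hl).2]
    ring
  set T : (n : Fin 3 → ℕ) → ((Fin 3 → ℝ) → ℝ) →
      SkorohodSpace ![s₀, 0, 0, 0] ![1, τbar 0, τbar 1, τbar 2] := fun n z =>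
    X n fun l => √(θ n 0 * θ n 1 * θ n 2) *
      altSum z (fun j => l.1 j * (1 / n j)) (fun j => (l.1 j + 1 : ℕ) * (1 / n j)) with hT
  have hTval : ∀ n, good n → ∀ z x, (T n z).toFun x = √(θ n 0 * θ n 1 * θ n 2) *
      gridSum z (limitIntegrand Om (θ n) w x.1) (fun j => 1 / n j)
        ![⌊n 0 * x.1 0⌋₊, n 1, n 2] := by
    intro n hn z x
    simp only [hT]
    rw [hXval n hn (fun l => √(θ n 0 * θ n 1 * θ n 2) *
      altSum z (fun j => l j * (1 / n j)) (fun j => (l j + 1 : ℕ) * (1 / n j))), gridSum,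
      Finset.mul_sum]
    exact Finset.sum_congr rfl fun l _ => mul_assoc _ _ _
  have hclose : ∀ β : (Fin 3 → ℝ) → ℝ, ContinuousOn β (Set.Icc 0 1) → ∀ ε' > 0, ∃ δ > (0 : ℝ),
      ∀ᶠ n : Fin 3 → ℕ in atTop, ∀ z : (Fin 3 → ℝ) → ℝ,
        (∀ v ∈ Set.Icc (0 : Fin 3 → ℝ) 1, |z v - σ * β v| ≤ δ) →
        ∀ x, |(T n z).toFun x - limitProcess Om τbar w σ β x.1| ≤ ε' := by
    intro β hβ ε' hε'
    obtain ⟨δ, hδ, H⟩ := detector_close hOm hτbar hb hs₀.1 hwc hC hvar hβ σ hε'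
    refine ⟨δ, hδ, ?_⟩
    filter_upwards [hev δ hδ] with n hn z hz x
    rw [hTval n hn.1, limitProcess]
    exact H n hn.2.1 (θ n) (hθpos n hn.1) hn.1.2 hn.2.2 z hz x.1 x.2 _
      (hasPartsIntegral_partsIntegral (hexists β hβ x.1 x.2))
  have hself : ∀ β : (Fin 3 → ℝ) → ℝ, ContinuousOn β (Set.Icc 0 1) → ∀ ε' > 0,
      ∀ᶠ n : Fin 3 → ℕ in atTop,
        ∀ x, |(T n fun v => σ * β v).toFun x - limitProcess Om τbar w σ β x.1| ≤ ε' := by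
    intro β hβ ε' hε'
    obtain ⟨δ, hδ, H⟩ := hclose β hβ ε' hε'
    filter_upwards [H] with n hn
    exact hn _ fun v _ => by rw [sub_self, abs_zero]; exact hδ.le
  -- On continuous paths the limit process belongs to the Skorohod space as the uniform limit of `T
  -- n (σ B)`; the same approximation gives its measurability below. Off this almost sure event the
  -- value is irrelevant.
  set U : S' → SkorohodSpace ![s₀, 0, 0, 0] ![1, τbar 0, τbar 1, τbar 2] := fun ω =>
    if hω : ContinuousOn (B ω) (Set.Icc 0 1) then
      SkorohodSpace.ofUniformLimit (fun x => limitProcess Om τbar w σ (B ω) x.1)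
        fun ε' hε' => ⟨_, (hself _ hω ε' hε').exists.choose_spec⟩
    else default with hU
  have hUval : ∀ ω, ContinuousOn (B ω) (Set.Icc 0 1) →
      ∀ x, (U ω).toFun x = limitProcess Om τbar w σ (B ω) x.1 := by
    intro ω hω x
    simp only [hU, dif_pos hω]
    rfl
  have hUmeas : AEMeasurable U P' := by
    refine aemeasurable_of_tendsto_metrizable_ae (atTop : Filter (Fin 3 → ℕ))
      (f := fun n ω => T n fun v => σ * B ω v) (fun n => ?_) ?_
    · refine (hXc n).measurable.comp_aemeasurable (aemeasurable_pi_lambda _ fun l => ?_)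
      refine AEMeasurable.const_mul ?_ _
      unfold altSum
      refine Finset.aemeasurable_fun_sum _ fun v _ =>
        ((hB.aemeasurable _ ?_).const_mul σ).const_mul _
      obtain ⟨h1, h2⟩ := corner_mem_Icc l.2
      have := piecewise_mem v (W := fun _ => Set.Icc (0 : ℝ) 1)
        (fun j => ⟨h1.1 j, h1.2 j⟩) (fun j => ⟨h2.1 j, h2.2 j⟩)
      exact ⟨fun j => (this j).1, fun j => (this j).2⟩
    · filter_upwards [hB.continuous] with ω hω
      rw [EMetric.tendsto_nhds]
      intro η hη
      obtain ⟨ε', -, hε', hε'η⟩ := ENNReal.lt_iff_exists_real_btwn.mp hη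
      filter_upwards [hself _ hω ε' (ENNReal.ofReal_pos.mp hε')] with n hn
      refine (skorohod_edist_le _ _ fun x => ?_).trans_lt hε'η
      rw [hUval ω hω]
      exact hn x
  obtain ⟨Z, Zlim, hZ, hZlim, hZdist⟩ := hε.fclt
  -- Built from the noise itself, so that measurability follows from that of the noise variables;
  -- equality with `T n` of the partial sum process is needed only almost surely.
  refine ⟨fun n ω => X n fun l => √(τ 0 (n 0) * τ 1 (n 1) * τ 2 (n 2)) *
    ε ![((l.1 0 + 1 : ℕ) : ℤ), ((l.1 1 + 1 : ℕ) : ℤ), ((l.1 2 + 1 : ℕ) : ℤ)] ω, U, ?_, ?_, ?_⟩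
  · filter_upwards [hev 1 one_pos] with n hn
    refine Eventually.of_forall fun ω x => ?_
    rw [hXval n hn.1 (fun l => √(τ 0 (n 0) * τ 1 (n 1) * τ 2 (n 2)) *
      ε ![((l 0 + 1 : ℕ) : ℤ), ((l 1 + 1 : ℕ) : ℤ), ((l 2 + 1 : ℕ) : ℤ)] ω),
      weightedDetector_eq Om w f f₀ ε hn.1.1 (fun j => hτ j (n j)) hn.1.2 hH₀ ω (x.2.2 0)]
  · filter_upwards [hB.continuous] with ω hω using hUval ω hω
  · refine tendstoInDistribution_of_tendsto_prod hZdist (T := fun n z => T n z.extend)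
      (fun n => ?_) hUmeas ?_ ?_
    · refine (hXc n).measurable.comp_aemeasurable (aemeasurable_pi_lambda _ fun l => ?_)
      exact ((hε.stationary.memLp _).aestronglyMeasurable.aemeasurable).const_mul _
    · filter_upwards [hZ, hev 1 one_pos] with n hZn hn
      filter_upwards [hZn] with ω hω
      simp only [hT]
      congr 1
      ext l
      obtain ⟨h1, h2⟩ := corner_mem_Icc l.2
      rw [altSum_congr_Icc (g := partialSumProcess ε n ω) (fun v hv => by
        rw [← hω ⟨v, hv⟩]; exact (Z n ω).extend_apply ⟨v, hv⟩) h1 h2,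
        altSum_partialSumProcess ε hn.1.1]
      have hnn : (0 : ℝ) < (n 0 : ℝ) * n 1 * n 2 := by
        have := fun j => Nat.cast_pos (α := ℝ).mpr (hn.1.1 j)
        exact mul_pos (mul_pos (this 0) (this 1)) (this 2)
      -- The factor `√(n₁n₂n₃)` contained in the root cancels the normalization of the partial sum
      -- process.
      have hsq : √(θ n 0 * θ n 1 * θ n 2)
          = √((n 0 : ℝ) * n 1 * n 2) * √(τ 0 (n 0) * τ 1 (n 1) * τ 2 (n 2)) := by
        rw [← Real.sqrt_mul hnn.le]
        congr 1
        simp only [hθdef]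
        ring
      have hne := (Real.sqrt_pos.mpr hnn).ne'
      rw [hsq]
      field_simp
    · filter_upwards [hB.continuous, hZlim] with ω hω hZω
      rw [EMetric.tendsto_nhds]
      intro η hη
      obtain ⟨ε', -, hε', hε'η⟩ := ENNReal.lt_iff_exists_real_btwn.mp hη
      obtain ⟨δ, hδ, H⟩ := hclose _ hω ε' (ENNReal.ofReal_pos.mp hε')
      have hcont : Continuous (Zlim ω).toFun := by
        have : Continuous fun v : Set.Icc (0 : Fin 3 → ℝ) 1 => σ * B ω v.1 :=
          continuous_const.mul hω.domRestrict
        rwa [show (Zlim ω).toFun = _ from funext hZω]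
      obtain ⟨ρ, hρ, hρ'⟩ := abs_sub_le_of_skorohod_edist_lt hcont hδ
      -- Continuous convergence: large `n` and Skorohod proximity to the continuous path `σ B` are
      -- imposed jointly, and the latter means uniform proximity.
      filter_upwards [H.prod_mk (Metric.eball_mem_nhds (Zlim ω) hρ)] with q hq
      refine (skorohod_edist_le _ _ fun x => ?_).trans_lt hε'η
      rw [hUval ω hω]
      refine hq.1 _ (fun v hv => ?_) x
      rw [← hZω ⟨v, hv⟩, q.2.extend_apply ⟨v, hv⟩]
      exact hρ' q.2 hq.2 ⟨v, hv⟩
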